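/- Let $\mathbb T^2=\mathbb R^2/\mathbb Z^2$ with normalized Haar (Lebesgue) measure, $K=2\pi\mathbb Z^2\setminus\{0\}$, and let $V=\{f\in L^2(\mathbb T^2;\mathbb C):\int_{\mathbb T^2} f=0\}$, with orthonormal basis $e_k(x)=e^{i\langle k,x\rangle}$, $k\in K$. Let $(\Omega,\mathcal F,\mathbb P)$ be a probability space, $\nu>0$ and $H\in(0,1)$. Let $(\alpha_k)_{k\in K}\subset[c,\infty)$ for some $c>0$, with $\alpha_{-k}=\alpha_k$ and $\alpha_k\to\infty$ as $|k|\to\infty$, and let $(\sqrt{\lambda_k})_{k\in K}\subset[0,\infty)$ be bounded with $\sqrt{\lambda_{-k}}=\sqrt{\lambda_k}$. Let $A$ and $Q^{1/2}$ be the operators on $V$ that are diagonal in $(e_k)$ with $Ae_k=-\alpha_ke_k$ and $Q^{1/2}e_k=\sqrt{\lambda_k}\,e_k$, and let $S(t)$ be the semigroup generated by $\nu A$, so that $S(t)e_k=e^{-t\nu\alpha_k}e_k$. Let $B^H=\sum_{k\in K}\beta^H_ke_k$, where $\beta^H_k=\frac1{\sqrt2}X_k+\frac{i}{\sqrt2}Y_k$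 with $X_k,Y_k$ independent real normalized two-sided fractional Brownian motions of Hurst parameter $H$, $\beta^H_{-k}=(\beta^H_k)^*$, and the $\beta^H_k$ are independent apart from this relation. A jointly measurable $V$-valued process $\psi=(\psi(t))_{t\in\mathbb R}$ is a mild solution of $$d\psi_t=\nu A\psi_t\,dt+\nu^HQ^{1/2}\,dB^H_t \qquad (M3)$$ on $\mathbb R$ if for all $s\le t$, $\mathbb P$-a.s., $$\psi(t)=S(t-s)\psi(s)+\sum_{k\in K}\sqrt{\lambda_k}\,\nu^H\int_s^te^{-(t-r)\nu\alpha_k}\,d\beta^H_k(r)\,e_k,$$ where the integrals are pathwise Riemann--Stieltjes integrals and the series converges in $L^2(\Omega;V)$. It is strictly stationary if its finite-dimensional distributions are invariant under time shifts, and a strictly stationary $\psi$ is ergodic if for every measurable $\rho:V\to\mathbb R$ with $\mathbb E|\rho(\psi(0))|<\infty$ one has $\lim_{T\to\infty}\frac1T\int_0^T\rho(\psi(t))\,dt=\mathbb E\,\rho(\psi(0))$ $\mathbb P$-a.s. Assume that for some $m\in\mathbb N_0$ and $\gamma\in(0,1)$ $$\sum_{k\in K}\lambda_k\alpha_k^{2\gamma-2H}|k|^{2m}<\infty\quad\text{and}\quad\sum_{k\in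 K}\lambda_k\alpha_k^{-2H}|k|^{2m+2\gamma}<\infty,$$ and let $\psi$ be an ergodic (strictly stationary) mild solution of (M3) on $\mathbb R$. Then $\psi$ has a version (again denoted by $\psi$), real-valued, with $$\psi\in C(\mathbb R,C^m(\mathbb T^2))\quad\mathbb P\text{-a.s.},$$ where $|f|_{C^m(\mathbb T^2)}=\max_{|\delta|\le m}\sup_{x}|D^\delta f(x)|$. Moreover, for all $-\infty<T_1<T_2<\infty$ there is a positive random variable $\kappa=\kappa_{T_1,T_2}$ with $\mathbb E(\kappa^2)<\infty$ such that $\mathbb P$-a.s. $$|\psi|_{C([T_1,T_2],C^m(\mathbb T^2))}=\sup_{t\in[T_1,T_2]}|\psi(t)|_{C^m(\mathbb T^2)}\le \kappa.$$ -/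

import Mathlib

open MeasureTheory ProbabilityTheory Filter Topology Set
open scoped ENNReal

noncomputable section

namespace FractionalFlow

/-! ### The two-dimensional torus `ℝ² / ℤ²` and the spaces `C^m(𝕋²)` -/

/-- The two-dimensional torus `ℝ² / ℤ²`. -/
abbrev Torus : Type := UnitAddTorus (Fin 2)

/-- Haar probability measure on the torus, i.e. Lebesgue measure on `[0,1)²`. -/
abbrev torusMeasure : Measure Torus := Measure.pi fun _ => AddCircle.haarAddCircle

/-- The projection `ℝ² → 𝕋²`. -/
def proj (y : Fin 2 → ℝ) : Torus := fun i => (y i : UnitAddCircle)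

/-- The partial derivative `∂f / ∂x_i` of a function on the torus. -/
def partialDeriv (i : Fin 2) (f : Torus → ℝ) : Torus → ℝ :=
  fun x => deriv (fun s : ℝ => f (x + proj (Pi.single i s))) 0

/-- `D^δ f = ∂^{|δ|} f / ∂x₁^{δ₁} ∂x₂^{δ₂}`. -/
def multiDeriv (δ : ℕ × ℕ) (f : Torus → ℝ) : Torus → ℝ :=
  (partialDeriv 0)^[δ.1] ((partialDeriv 1)^[δ.2] f)

/-- The multi-indices `δ` with `|δ| ≤ m`. -/
abbrev MultiIdx (m : ℕ) : Type := {δ : Fin (m + 1) × Fin (m + 1) // (δ.1 : ℕ) + (δ.2 : ℕ) ≤ m}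

/-- `C^m(𝕋²)`: the real-valued functions on the torus whose pullback to `ℝ²` is `C^m`. -/
structure CmTorus (m : ℕ) : Type where
  /-- the underlying function -/
  toFun : Torus → ℝ
  contDiff : ContDiff ℝ m (fun y => toFun (proj y))

lemma proj_add (y z : Fin 2 → ℝ) : proj (y + z) = proj y + proj z := by
  ext i; simp [proj]

lemma proj_isOpenQuotientMap : IsOpenQuotientMap proj :=
  IsOpenQuotientMap.piMap (fun _ : Fin 2 => QuotientAddGroup.isOpenQuotientMap_mk)

lemma partialDeriv_proj (i : Fin 2) {f : Torus → ℝ}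
    (hf : Differentiable ℝ fun y => f (proj y)) (y : Fin 2 → ℝ) :
    partialDeriv i f (proj y) = fderiv ℝ (fun y => f (proj y)) y (Pi.single i 1) := by
  have h := (hf y).lineDeriv_eq_fderiv (v := Pi.single i (1 : ℝ))
  rw [← h, lineDeriv, partialDeriv]
  congr 1
  ext s
  rw [← proj_add]
  congr 2
  ext j
  by_cases hj : j = i
  · subst hj; simp
  · simp [hj]

lemma contDiff_partialDeriv (i : Fin 2) {n : ℕ} {f : Torus → ℝ}
    (hf : ContDiff ℝ (n + 1 : ℕ) fun y => f (proj y)) :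
    ContDiff ℝ n fun y => partialDeriv i f (proj y) := by
  have hd : Differentiable ℝ fun y => f (proj y) := hf.differentiable (by simp)
  have h : (fun y => partialDeriv i f (proj y)) =
      fun y => fderiv ℝ (fun y => f (proj y)) y (Pi.single i 1) :=
    funext (partialDeriv_proj i hd)
  rw [h]
  exact (hf.fderiv_right (m := n) (by norm_cast)).clm_apply contDiff_const

lemma contDiff_iterate (i : Fin 2) (a : ℕ) {n : ℕ} {f : Torus → ℝ}
    (hf : ContDiff ℝ (n + a : ℕ) fun y => f (proj y)) :
    ContDiff ℝ n fun y => (partialDeriv i)^[a] f (proj y) := by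
  induction a generalizing f with
  | zero => exact hf
  | succ a ih => exact ih (contDiff_partialDeriv i (n := n + a) hf)

lemma partialDeriv_add (i : Fin 2) {f g : Torus → ℝ}
    (hf : Differentiable ℝ fun y => f (proj y)) (hg : Differentiable ℝ fun y => g (proj y)) :
    partialDeriv i (f + g) = partialDeriv i f + partialDeriv i g := by
  ext x
  obtain ⟨y, rfl⟩ := proj_isOpenQuotientMap.surjective x
  have hfg : Differentiable ℝ fun y => (f + g) (proj y) := hf.add hg
  rw [Pi.add_apply, partialDeriv_proj i hf, partialDeriv_proj i hg, partialDeriv_proj i hfg]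
  have := fderiv_add (hf y) (hg y)
  exact congrArg (fun L => L (Pi.single i 1)) this

lemma iterate_add (i : Fin 2) (a : ℕ) {f g : Torus → ℝ}
    (hf : ContDiff ℝ a fun y => f (proj y)) (hg : ContDiff ℝ a fun y => g (proj y)) :
    (partialDeriv i)^[a] (f + g) = (partialDeriv i)^[a] f + (partialDeriv i)^[a] g := by
  induction a generalizing f g with
  | zero => rfl
  | succ a ih =>
    simp only [Function.iterate_succ, Function.comp]
    rw [partialDeriv_add i (hf.differentiable (by simp)) (hg.differentiable (by simp)),
      ih (contDiff_partialDeriv i hf) (contDiff_partialDeriv i hg)]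

namespace CmTorus

variable {m : ℕ}

instance : CoeFun (CmTorus m) fun _ => Torus → ℝ := ⟨toFun⟩

lemma toFun_injective : Function.Injective (toFun : CmTorus m → Torus → ℝ) := by
  rintro ⟨f, hf⟩ ⟨g, hg⟩ h
  cases h
  rfl

instance : Zero (CmTorus m) := ⟨⟨0, contDiff_const⟩⟩
instance : Add (CmTorus m) := ⟨fun f g => ⟨f + g, f.contDiff.add g.contDiff⟩⟩
instance : Neg (CmTorus m) := ⟨fun f => ⟨-f, f.contDiff.neg⟩⟩
instance : Sub (CmTorus m) := ⟨fun f g => ⟨f - g, f.contDiff.sub g.contDiff⟩⟩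
instance : SMul ℕ (CmTorus m) := ⟨fun n f => ⟨n • ⇑f, f.contDiff.const_smul n⟩⟩
instance : SMul ℤ (CmTorus m) := ⟨fun n f => ⟨n • ⇑f, f.contDiff.const_smul n⟩⟩

/-- `C^m(𝕋²)` with pointwise operations. -/
instance : AddCommGroup (CmTorus m) :=
  toFun_injective.addCommGroup toFun rfl (fun _ _ => rfl) (fun _ => rfl) (fun _ _ => rfl)
    (fun _ _ => rfl) (fun _ _ => rfl)

lemma contDiff_multiDeriv_aux (f : CmTorus m) (δ : MultiIdx m) :
    ContDiff ℝ (δ.1.1 : ℕ) fun y => (partialDeriv 1)^[(δ.1.2 : ℕ)] f (proj y) :=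
  contDiff_iterate 1 _ (f.contDiff.of_le (by exact_mod_cast δ.2))

lemma continuous_multiDeriv (f : CmTorus m) (δ : MultiIdx m) :
    Continuous (multiDeriv (δ.1.1, δ.1.2) f) := by
  rw [proj_isOpenQuotientMap.isQuotientMap.continuous_iff]
  exact (contDiff_iterate 0 (δ.1.1 : ℕ) (n := 0)
    ((contDiff_multiDeriv_aux f δ).of_le (by simp))).continuous

/-- All derivatives of order at most `m`, as continuous functions on the torus. -/
def jet (m : ℕ) : CmTorus m →+ (MultiIdx m → C(Torus, ℝ)) :=
  AddMonoidHom.mk' (fun f δ => ⟨multiDeriv (δ.1.1, δ.1.2) f, continuous_multiDeriv f δ⟩) (by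
    intro f g
    ext δ x
    have h1 : (partialDeriv 1)^[(δ.1.2 : ℕ)] (⇑f + ⇑g) =
        (partialDeriv 1)^[(δ.1.2 : ℕ)] ⇑f + (partialDeriv 1)^[(δ.1.2 : ℕ)] ⇑g :=
      iterate_add 1 _ (f.contDiff.of_le (by exact_mod_cast (le_add_self.trans δ.2)))
        (g.contDiff.of_le (by exact_mod_cast (le_add_self.trans δ.2)))
    have h2 := iterate_add 0 (δ.1.1 : ℕ) (contDiff_multiDeriv_aux f δ)
      (contDiff_multiDeriv_aux g δ)
    have h3 : multiDeriv (δ.1.1, δ.1.2) (⇑f + ⇑g) =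
        multiDeriv (δ.1.1, δ.1.2) f + multiDeriv (δ.1.1, δ.1.2) g := by
      simp only [multiDeriv]
      rw [h1, h2]
    exact congrFun h3 x)

lemma jet_injective : Function.Injective (jet m) := by
  intro f g h
  apply toFun_injective
  have h0 := congrFun h ⟨(0, 0), by simp⟩
  ext x
  exact DFunLike.congr_fun h0 x

/-- The norm `|f|_{C^m} = max_{|δ| ≤ m} sup_x |D^δ f(x)|`. -/
instance : NormedAddCommGroup (CmTorus m) :=
  NormedAddCommGroup.induced (CmTorus m) (MultiIdx m → C(Torus, ℝ)) (jet m) jet_injective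

lemma norm_le_iff (f : CmTorus m) {C : ℝ} (hC : 0 ≤ C) :
    ‖f‖ ≤ C ↔ ∀ δ : MultiIdx m, ∀ x, |multiDeriv (δ.1.1, δ.1.2) f x| ≤ C := by
  change ‖jet m f‖ ≤ C ↔ _
  rw [pi_norm_le_iff_of_nonneg hC]
  exact forall_congr' fun δ => ContinuousMap.norm_le _ hC

end CmTorus

/-! ### The Hilbert space `V`, its Fourier basis, and diagonal operators -/

/-- The complex Hilbert space `L²(𝕋²)`. -/
abbrev L2Torus : Type := Lp ℂ 2 torusMeasure

/-- `V = {f ∈ L²(𝕋²) : ∫ f = 0}`. -/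
def V : Submodule ℂ L2Torus where
  carrier := {f | ∫ x, f x ∂torusMeasure = 0}
  zero_mem' := by
    change ∫ x, (0 : L2Torus) x ∂torusMeasure = 0
    rw [integral_congr_ae (Lp.coeFn_zero ℂ 2 torusMeasure)]
    simp
  add_mem' := by
    intro f g hf hg
    change ∫ x, (f + g) x ∂torusMeasure = 0
    rw [integral_congr_ae (Lp.coeFn_add f g)]
    have hfi : Integrable f torusMeasure := (Lp.memLp f).integrable (by norm_num)
    have hgi : Integrable g torusMeasure := (Lp.memLp g).integrable (by norm_num)
    have h := integral_add hfi hgi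
    rw [show ∫ x, f x ∂torusMeasure = 0 from hf, show ∫ x, g x ∂torusMeasure = 0 from hg] at h
    simpa using h
  smul_mem' := by
    intro c f hf
    change ∫ x, (c • f) x ∂torusMeasure = 0
    rw [integral_congr_ae (Lp.coeFn_smul c f)]
    have h := integral_const_mul (μ := torusMeasure) c (fun x => f x)
    rw [show ∫ x, f x ∂torusMeasure = 0 from hf] at h
    simpa using h

/-- `V` carries its Borel `σ`-algebra. -/
instance : MeasurableSpace V := borel V

instance : BorelSpace V := ⟨rfl⟩

/-- The index set: `n ∈ ℤ² \ {0}` stands for the wave vector `k = 2πn`, so that this is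
`K = 2πℤ² \ {0}`. -/
abbrev Mode : Type := {n : Fin 2 → ℤ // n ≠ 0}

/-- The mode `-k`. -/
instance : Neg Mode := ⟨fun k => ⟨-k.1, neg_ne_zero.mpr k.2⟩⟩

/-- The Euclidean norm `|k|` of the wave vector `k = 2πn`. -/
def waveNorm (k : Mode) : ℝ := 2 * Real.pi * √((k.1 0 : ℝ) ^ 2 + (k.1 1 : ℝ) ^ 2)

/-- The basis function `e_k(x) = exp(i⟨k, x⟩)`, `k = 2πn`. -/
def e (k : Mode) : V :=
  ⟨ContinuousMap.toLp (E := ℂ) 2 torusMeasure ℂ (UnitAddTorus.mFourier k.1), by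
    change ∫ x, _ ∂torusMeasure = 0
    rw [integral_congr_ae (ContinuousMap.coeFn_toLp torusMeasure (UnitAddTorus.mFourier k.1))]
    have h := (UnitAddTorus.orthonormal_mFourier (d := Fin 2)).2 (Ne.symm k.2)
    simp only [ContinuousMap.inner_toLp, UnitAddTorus.mFourier_zero] at h
    simpa using! h⟩

/-- The operator on `V` that is diagonal in the basis `(e_k)` with bounded eigenvalues `σ_k`. -/
def diagOp (σ : Mode → ℝ) (f : V) : V := ∑' k, ((σ k : ℂ) * inner ℂ (e k) f) • e k

/-- The semigroup `S(t) = exp(t ν A)` generated by `ν A`, where `A` is the diagonal operator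
`A e_k = -α_k e_k`, so that `S(t) e_k = exp(-t ν α_k) e_k`. -/
def semigroup (ν : ℝ) (α : Mode → ℝ) (t : ℝ) : V → V :=
  diagOp fun k => Real.exp (-(t * ν * α k))

/-! ### Riemann-Stieltjes integrals -/

/-- `I` is the Riemann-Stieltjes integral `∫_a^b f dg`: the limit of the sums
`∑ f(τ_i) (g(u_{i+1}) - g(u_i))` over tagged partitions of `[a, b]` whose mesh tends to `0`. -/
def HasRSIntegral (f : ℝ → ℝ) (g : ℝ → ℂ) (a b : ℝ) (I : ℂ) : Prop :=
  ∀ ε > 0, ∃ δ > 0, ∀ (n : ℕ) (u τ : ℕ → ℝ), Monotone u → u 0 = a → u n = b →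
    (∀ i < n, u (i + 1) - u i < δ) → (∀ i < n, τ i ∈ Icc (u i) (u (i + 1))) →
      ‖∑ i ∈ Finset.range n, (f (τ i) : ℂ) * (g (u (i + 1)) - g (u i)) - I‖ < ε

open Classical in
/-- The Riemann-Stieltjes integral `∫_a^b f dg` (set to `0` if it does not exist). -/
def rsIntegral (f : ℝ → ℝ) (g : ℝ → ℂ) (a b : ℝ) : ℂ :=
  if h : ∃ I, HasRSIntegral f g a b I then h.choose else 0

/-! ### Fractional Brownian motion -/

section Noise

variable {Ω : Type*} [MeasurableSpace Ω]

/-- A real-valued normalized two-sided fractional Brownian motion with Hurst parameter `H`. -/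
structure IsRealFBM (H : ℝ) (b : ℝ → Ω → ℝ) (P : Measure Ω) : Prop where
  measurable : ∀ t, Measurable (b t)
  gaussian : IsGaussianProcess b P
  zero : ∀ᵐ ω ∂P, b 0 ω = 0
  mean : ∀ t, ∫ ω, b t ω ∂P = 0
  cov : ∀ s t, ∫ ω, b t ω * b s ω ∂P =
    1 / 2 * (|t| ^ (2 * H) + |s| ^ (2 * H) - |t - s| ^ (2 * H))
  continuous : ∀ᵐ ω ∂P, Continuous fun t => b t ω

/-- A complex-valued normalized fractional Brownian motion `β = 2^{-1/2} (X + i Y)` with `X`, `Y`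
independent real-valued normalized fractional Brownian motions. -/
def IsComplexFBM (H : ℝ) (β : ℝ → Ω → ℂ) (P : Measure Ω) : Prop :=
  ∃ X Y : ℝ → Ω → ℝ, IsRealFBM H X P ∧ IsRealFBM H Y P ∧
    IndepFun (fun ω t => X t ω) (fun ω t => Y t ω) P ∧
    ∀ t ω, β t ω = ((1 / √2 * X t ω : ℝ) : ℂ) + Complex.I * ((1 / √2 * Y t ω : ℝ) : ℂ)

/-- The coefficients `(β_k)` of the infinite-dimensional fractional Brownian motion
`B(t) = ∑_k β_k(t) e_k`: complex fractional Brownian motions which are independent except that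
`β_{-k}` is the complex conjugate of `β_k`. -/
structure IsNoise (H : ℝ) (β : Mode → ℝ → Ω → ℂ) (P : Measure Ω) : Prop where
  fbm : ∀ k, IsComplexFBM H (β k) P
  conj : ∀ k t, ∀ᵐ ω ∂P, β (-k) t ω = starRingEnd ℂ (β k t ω)
  indep : ∀ S : Set Mode, (∀ k ∈ S, -k ∉ S) →
    iIndepFun (fun (k : S) (ω : Ω) (t : ℝ) => β k t ω) P

/-- The standing assumptions on the viscosity `ν`, the Hurst parameter `H`, the eigenvalues
`-α_k` of `A`, the eigenvalues `√λ_k` of the bounded operator `Q^{1/2}`, and the noise. -/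
structure StandingAssumption (ν H : ℝ) (α lam : Mode → ℝ) (β : Mode → ℝ → Ω → ℂ)
    (P : Measure Ω) : Prop where
  nu_pos : 0 < ν
  hurst : H ∈ Ioo (0 : ℝ) 1
  alpha_lower : ∃ c > 0, ∀ k, c ≤ α k
  alpha_symm : ∀ k, α (-k) = α k
  alpha_tendsto : Tendsto α (comap waveNorm atTop) atTop
  lam_nonneg : ∀ k, 0 ≤ lam k
  lam_symm : ∀ k, √(lam (-k)) = √(lam k)
  lam_bdd : BddAbove (range fun k => √(lam k))
  noise : IsNoise H β P

/-! ### Ergodic mild solutions of `dψ = ν A ψ dt + ν^H Q^{1/2} dB` on the whole time axis -/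

/-- `J` is the stochastic convolution `ν^H ∫_s^t S(t-r) Q^{1/2} dB(r)`, i.e. the sum of the series
`∑_k √λ_k ν^H (∫_s^t exp(-(t-r) ν α_k) dβ_k(r)) e_k`, which converges in `L²(Ω; V)`. -/
def IsStochConv (ν H : ℝ) (α lam : Mode → ℝ) (β : Mode → ℝ → Ω → ℂ) (P : Measure Ω)
    (s t : ℝ) (J : Ω → V) : Prop :=
  MemLp J 2 P ∧
  Tendsto (fun F : Finset Mode => eLpNorm (fun ω => J ω - ∑ k ∈ F,
      (((√(lam k) * ν ^ H : ℝ) : ℂ) *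
        rsIntegral (fun r => Real.exp (-((t - r) * ν * α k))) (fun r => β k r ω) s t) • e k) 2 P)
    atTop (𝓝 0)

/-- `ψ` is a mild solution on `ℝ`: a jointly measurable `V`-valued process such that for all
`s ≤ t`, almost surely, `ψ(t) = S(t-s) ψ(s) + ν^H ∫_s^t S(t-r) Q^{1/2} dB(r)`. -/
structure IsMildSolution (ν H : ℝ) (α lam : Mode → ℝ) (β : Mode → ℝ → Ω → ℂ) (P : Measure Ω)
    (ψ : ℝ → Ω → V) : Prop where
  measurable : Measurable (Function.uncurry ψ)
  mild : ∀ s t, s ≤ t → ∃ J : Ω → V, IsStochConv ν H α lam β P s t J ∧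
    ∀ᵐ ω ∂P, ψ t ω = semigroup ν α (t - s) (ψ s ω) + J ω

/-- Strict stationarity: the finite-dimensional distributions are invariant under time shifts. -/
def IsStrictlyStationary (P : Measure Ω) (ψ : ℝ → Ω → V) : Prop :=
  ∀ (n : ℕ) (t : Fin n → ℝ) (r : ℝ),
    P.map (fun ω i => ψ (t i + r) ω) = P.map (fun ω i => ψ (t i) ω)

/-- Ergodicity: time averages of integrable observables converge to their expectation. -/
def IsErgodic (P : Measure Ω) (ψ : ℝ → Ω → V) : Prop :=
  ∀ ρ : V → ℝ, Measurable ρ → Integrable (fun ω => ρ (ψ 0 ω)) P → ∀ᵐ ω ∂P,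
    (∀ T : ℝ, IntervalIntegrable (fun t => ρ (ψ t ω)) volume 0 T) ∧
    Tendsto (fun T : ℝ => 1 / T * ∫ t in (0 : ℝ)..T, ρ (ψ t ω)) atTop
      (𝓝 (∫ ω', ρ (ψ 0 ω') ∂P))

/-- A mild solution on `ℝ` that is strictly stationary and ergodic. -/
structure IsErgodicMildSolution (ν H : ℝ) (α lam : Mode → ℝ) (β : Mode → ℝ → Ω → ℂ)
    (P : Measure Ω) (ψ : ℝ → Ω → V) : Prop where
  mildSolution : IsMildSolution ν H α lam β P ψ
  stationary : IsStrictlyStationary P ψ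
  ergodic : IsErgodic P ψ

end Noise

end FractionalFlow

end

open MeasureTheory ProbabilityTheory Filter Topology Set
open scoped ENNReal

noncomputable section

namespace FractionalFlow

/-! Every real linear functional of finitely many Fourier coefficients of `ψ(t)` is subgaussian, and
the theorem follows from bounds on its scale. In mode `k`, `ψ_k(t)` is `exp(-nνα_k) ψ_k(t-n)` plus a
convolution over `[t-n, t]`. By stationarity the first term tends to `0` in probability, so the
functional is a limit of functionals of stochastic convolutions, which are themselves limits of
Riemann-Stieltjes sums. Abel summation turns such a sum into an average, with nonnegative weights of
total `1`, of increments `X(t) - X(u)` of fractional Brownian motion, whence the scale `min(2a^{-H},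
h^H)` with `a = να_k` (`IsRealFBM.subGauss_leftSum`). Across the modes of a half plane, independence
makes the squared scales add. Up to constants, `∑ Re(c_k ψ_k(t))` thus has scale `(∑ |c_k|² λ_k
α_k^{-2H})^{1/2}`, and an increment over a time `h` gains a factor `(να_k h)^g` in each mode, for
any `0 < g ≤ H` (`subGauss_sum_coef`, `subGauss_sum_coef_increment`).

The rest is chaining in space and time at once. Level `j` keeps the modes with `|n_i| ≤ 2^j`,
samples at times spaced by `2^{-j}` and interpolates. Neighbouring samples of consecutive levels
differ by new modes, small by the second summability condition, and by a short time increment of the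
old modes, small by the first. With `g = min(γ, H)` all derivatives of order at most `m` of the
difference have pointwise scale `O(2^{-gj})` (`exists_subGauss_pair`). In the `q`-th moment, passing
to the supremum over the torus costs `O(4^j)` (`enorm_pow_le_lintegral`) and passing to the maximum
over pairs costs `O(16^j)`. Neither base depends on `q`, so a large `q` yields geometric decay
(`lintegral_levelBound_pow_le`).

Hence the interpolations converge almost surely in `C^m`, locally uniformly in time, and the summed
level differences give the square integrable bound. The limit has the Fourier coefficients of `ψ(t)`
(`ae_coeFn_eq_of_tendsto_interp`); it may be taken real because `ψ_{-k}` is the conjugate of `ψ_k`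
(`coef_neg`). -/

/-! ### Subgaussian random variables -/

section SubGauss

variable {Ω : Type*} [MeasurableSpace Ω] {P : Measure Ω}

/-- `X` is subgaussian with scale `s`: `E exp(tX) ≤ exp(s² t² / 2)` for all `t`. -/
def SubGauss (X : Ω → ℝ) (s : ℝ) (P : Measure Ω) : Prop :=
  0 ≤ s ∧ HasSubgaussianMGF X (s ^ 2).toNNReal P

namespace SubGauss

variable {X Y : Ω → ℝ} {s s' : ℝ}

lemma coe_sq (s : ℝ) : (((s ^ 2).toNNReal : NNReal) : ℝ) = s ^ 2 :=
  Real.coe_toNNReal _ (sq_nonneg s)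

lemma mono (h : SubGauss X s P) (hs : s ≤ s') : SubGauss X s' P := by
  refine ⟨h.1.trans hs, h.2.integrable_exp_mul, fun t => (h.2.mgf_le t).trans ?_⟩
  rw [coe_sq, coe_sq]
  have := pow_le_pow_left₀ h.1 hs 2
  gcongr

lemma congr (h : SubGauss X s P) (hXY : X =ᵐ[P] Y) : SubGauss Y s P :=
  ⟨h.1, h.2.congr hXY⟩

/-- By Hölder's inequality the scales add without any independence. This is why the scale, rather
than its square, is the parameter. -/
lemma add (hX : SubGauss X s P) (hY : SubGauss Y s' P) :
    SubGauss (fun ω => X ω + Y ω) (s + s') P := by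
  refine ⟨add_nonneg hX.1 hY.1, ?_⟩
  convert hX.2.add hY.2 using 1
  rw [← NNReal.coe_inj, coe_sq]
  push_cast
  rw [coe_sq, coe_sq, Real.sqrt_sq hX.1, Real.sqrt_sq hY.1]

lemma const_mul (hX : SubGauss X s P) (r : ℝ) : SubGauss (fun ω => r * X ω) (|r| * s) P := by
  refine ⟨mul_nonneg (abs_nonneg r) hX.1, ?_⟩
  convert hX.2.const_mul r using 1
  rw [← NNReal.coe_inj, coe_sq]
  change _ = r ^ 2 * (((s ^ 2).toNNReal : NNReal) : ℝ)
  rw [coe_sq, mul_pow, sq_abs]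

lemma neg (hX : SubGauss X s P) : SubGauss (fun ω => -X ω) s P := by
  simpa using hX.const_mul (-1)

lemma sub (hX : SubGauss X s P) (hY : SubGauss Y s' P) :
    SubGauss (fun ω => X ω - Y ω) (s + s') P := by
  simpa [sub_eq_add_neg] using hX.add hY.neg

lemma zero [IsProbabilityMeasure P] : SubGauss (fun _ : Ω => (0 : ℝ)) 0 P :=
  ⟨le_rfl, by simp⟩

lemma sum [IsProbabilityMeasure P] {ι : Type*} {X : ι → Ω → ℝ} {s : ι → ℝ} (F : Finset ι)
    (h : ∀ i ∈ F, SubGauss (X i) (s i) P) :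
    SubGauss (fun ω => ∑ i ∈ F, X i ω) (∑ i ∈ F, s i) P := by
  classical
  induction F using Finset.induction_on with
  | empty => simp [zero]
  | insert a F ha ih =>
    simp only [Finset.sum_insert ha]
    exact (h a (Finset.mem_insert_self _ _)).add
      (ih fun i hi => h i (Finset.mem_insert_of_mem hi))

/-- Under independence the squares of the scales add, which is what makes the summability conditions
quadratic. -/
lemma sum_of_iIndepFun {ι : Type*} {X : ι → Ω → ℝ} (hX : iIndepFun X P)
    {s : ι → ℝ} (F : Finset ι) (h : ∀ i ∈ F, SubGauss (X i) (s i) P) :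
    SubGauss (fun ω => ∑ i ∈ F, X i ω) √(∑ i ∈ F, s i ^ 2) P := by
  refine ⟨Real.sqrt_nonneg _, ?_⟩
  convert HasSubgaussianMGF.sum_of_iIndepFun hX fun i hi => (h i hi).2 using 1
  rw [← NNReal.coe_inj, coe_sq, Real.sq_sqrt (Finset.sum_nonneg fun i _ => sq_nonneg _)]
  push_cast
  exact Finset.sum_congr rfl fun i _ => (coe_sq _).symm

/-- Fatou's lemma for `exp(tX_n)`: a uniform bound on the moment generating functions survives the
limit. -/
lemma of_tendsto_ae [IsProbabilityMeasure P] {X : ℕ → Ω → ℝ} (h : ∀ n, SubGauss (X n) s P)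
    (hY : ∀ᵐ ω ∂P, Tendsto (fun n => X n ω) atTop (𝓝 (Y ω))) : SubGauss Y s P := by
  have hmY : AEMeasurable Y P := aemeasurable_of_tendsto_metrizable_ae atTop
    (fun n => (h n).2.aemeasurable) hY
  have key : ∀ t : ℝ, ∫⁻ ω, ENNReal.ofReal (Real.exp (t * Y ω)) ∂P ≤
      ENNReal.ofReal (Real.exp (s ^ 2 * t ^ 2 / 2)) := by
    intro t
    have h1 : ∫⁻ ω, ENNReal.ofReal (Real.exp (t * Y ω)) ∂P =
        ∫⁻ ω, liminf (fun n => ENNReal.ofReal (Real.exp (t * X n ω))) atTop ∂P := by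
      refine lintegral_congr_ae ?_
      filter_upwards [hY] with ω hω
      refine (Tendsto.liminf_eq ?_).symm
      exact ENNReal.tendsto_ofReal ((Real.continuous_exp.tendsto _).comp (hω.const_mul t))
    rw [h1]
    refine (lintegral_liminf_le' fun n => ?_).trans ?_
    · exact ENNReal.measurable_ofReal.comp_aemeasurable
        (Real.measurable_exp.comp_aemeasurable ((h n).2.aemeasurable.const_mul t))
    · refine liminf_le_of_frequently_le' (Frequently.of_forall fun n => ?_)
      rw [← ofReal_integral_eq_lintegral_ofReal ((h n).2.integrable_exp_mul t)
        (ae_of_all _ fun ω => (Real.exp_pos _).le)]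
      refine ENNReal.ofReal_le_ofReal (((h n).2.mgf_le t).trans_eq ?_)
      rw [coe_sq]
  have hint : ∀ t : ℝ, Integrable (fun ω => Real.exp (t * Y ω)) P := fun t =>
    ⟨(Real.measurable_exp.comp_aemeasurable (hmY.const_mul t)).aestronglyMeasurable, by
      rw [hasFiniteIntegral_iff_ofReal (ae_of_all _ fun ω => (Real.exp_pos _).le)]
      exact (key t).trans_lt ENNReal.ofReal_lt_top⟩
  refine ⟨(h 0).1, hint, fun t => ?_⟩
  rw [coe_sq, mgf, ← ENNReal.ofReal_le_ofReal_iff (Real.exp_pos _).le,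
    ofReal_integral_eq_lintegral_ofReal (hint t) (ae_of_all _ fun ω => (Real.exp_pos _).le)]
  exact key t

lemma of_tendstoInMeasure [IsProbabilityMeasure P] {X : ℕ → Ω → ℝ}
    (h : ∀ n, SubGauss (X n) s P) (hY : TendstoInMeasure P X atTop Y) : SubGauss Y s P := by
  obtain ⟨ns, -, hns⟩ := hY.exists_seq_tendsto_ae
  exact of_tendsto_ae (fun n => h (ns n)) hns

/-- From `y^n / n! ≤ exp y` at `y = |X|/s`. The factor `4` is `2 · 2`: two signs, each with
exponential moment `exp(1/2) ≤ 2`. -/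
lemma lintegral_pow_le (h : SubGauss X s P) (hs : 0 < s) (n : ℕ) :
    ∫⁻ ω, ‖X ω‖ₑ ^ n ∂P ≤ ENNReal.ofReal (4 * n.factorial * s ^ n) := by
  have h1 : ∀ ω, ‖X ω‖ₑ ^ n ≤ ENNReal.ofReal (n.factorial * s ^ n *
      (Real.exp (s⁻¹ * X ω) + Real.exp (-s⁻¹ * X ω))) := by
    intro ω
    rw [Real.enorm_eq_ofReal_abs, ← ENNReal.ofReal_pow (abs_nonneg _)]
    refine ENNReal.ofReal_le_ofReal ?_
    have h2 := Real.pow_div_factorial_le_exp (s⁻¹ * |X ω|) (by positivity) n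
    have h3 : Real.exp (s⁻¹ * |X ω|) ≤ Real.exp (s⁻¹ * X ω) + Real.exp (-s⁻¹ * X ω) := by
      rcases abs_cases (X ω) with ⟨h, -⟩ | ⟨h, -⟩ <;> rw [h]
      · exact le_add_of_nonneg_right (Real.exp_pos _).le
      · rw [mul_neg, ← neg_mul]; exact le_add_of_nonneg_left (Real.exp_pos _).le
    rw [div_le_iff₀ (by positivity), mul_pow, inv_pow, inv_mul_le_iff₀ (by positivity)] at h2
    calc |X ω| ^ n ≤ _ := h2
      _ = n.factorial * s ^ n * Real.exp (s⁻¹ * |X ω|) := by ring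
      _ ≤ _ := by gcongr
  have hi : Integrable (fun ω => Real.exp (s⁻¹ * X ω) + Real.exp (-s⁻¹ * X ω)) P :=
    (h.2.integrable_exp_mul s⁻¹).add (h.2.integrable_exp_mul (-s⁻¹))
  refine (lintegral_mono h1).trans ?_
  rw [← ofReal_integral_eq_lintegral_ofReal (hi.const_mul _) (ae_of_all _ fun ω => by
    simp only [Pi.zero_apply]; positivity)]
  refine ENNReal.ofReal_le_ofReal ?_
  rw [integral_const_mul, integral_add (h.2.integrable_exp_mul s⁻¹) (h.2.integrable_exp_mul (-s⁻¹))]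
  have e1 := h.2.mgf_le s⁻¹
  have e2 := h.2.mgf_le (-s⁻¹)
  have e3 : Real.exp (1 / 2) ≤ 2 := by
    have h5 : Real.exp (1 / 2) ^ 2 ≤ 2 ^ 2 := by
      rw [← Real.exp_nat_mul]; norm_num; linarith [Real.exp_one_lt_d9]
    exact (sq_le_sq₀ (Real.exp_pos _).le (by norm_num)).1 h5
  rw [coe_sq, show s ^ 2 * s⁻¹ ^ 2 / 2 = 1 / 2 by field_simp] at e1
  rw [coe_sq, show s ^ 2 * (-s⁻¹) ^ 2 / 2 = 1 / 2 by field_simp] at e2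
  rw [mgf] at e1 e2
  calc _ ≤ n.factorial * s ^ n * (2 + 2 : ℝ) := by gcongr <;> linarith
    _ = _ := by ring

lemma of_gaussian (hX : HasGaussianLaw X P) (h0 : ∫ ω, X ω ∂P = 0)
    (hv : ∫ ω, X ω ^ 2 ∂P ≤ s ^ 2) (hs : 0 ≤ s) : SubGauss X s P := by
  have hmap := hX.map_eq_gaussianReal
  rw [h0] at hmap
  have hm : AEMeasurable X P := hX.aemeasurable
  have hvar : Var[X; P] = ∫ ω, X ω ^ 2 ∂P := variance_of_integral_eq_zero hm h0
  refine ⟨hs, fun t => ?_, fun t => ?_⟩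
  · have : Integrable (fun x => Real.exp (t * x)) (P.map X) := by
      rw [hmap]; exact integrable_exp_mul_gaussianReal t
    exact this.comp_aemeasurable hm
  · rw [mgf_gaussianReal hmap, coe_sq, zero_mul, zero_add,
      Real.coe_toNNReal _ (variance_nonneg _ _), hvar]
    gcongr

end SubGauss

end SubGauss

/-! ### Riemann-Stieltjes sums and integrals -/

section RiemannStieltjes

/-- The points of the uniform partition of `[s, t]` into `n` intervals. -/
def unifPt (s t : ℝ) (n i : ℕ) : ℝ := s + i * ((t - s) / n)

lemma unifPt_zero (s t : ℝ) (n : ℕ) : unifPt s t n 0 = s := by simp [unifPt]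

lemma unifPt_self (s t : ℝ) {n : ℕ} (hn : n ≠ 0) : unifPt s t n n = t := by
  have : (n : ℝ) ≠ 0 := by exact_mod_cast hn
  simp only [unifPt]; field_simp; ring

lemma unifPt_succ_sub (s t : ℝ) (n i : ℕ) :
    unifPt s t n (i + 1) - unifPt s t n i = (t - s) / n := by
  simp only [unifPt]; push_cast; ring

lemma monotone_unifPt {s t : ℝ} (hst : s ≤ t) (n : ℕ) : Monotone (unifPt s t n) := by
  refine monotone_nat_of_le_succ fun i => ?_
  have := unifPt_succ_sub s t n i
  have h : 0 ≤ (t - s) / n := div_nonneg (sub_nonneg.2 hst) (Nat.cast_nonneg n)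
  linarith

/-- The left Riemann-Stieltjes sum of `∫_s^t f dg` over the uniform partition. -/
def leftSum (f : ℝ → ℝ) (g : ℝ → ℂ) (s t : ℝ) (n : ℕ) : ℂ :=
  ∑ i ∈ Finset.range n,
    (f (unifPt s t n i) : ℂ) * (g (unifPt s t n (i + 1)) - g (unifPt s t n i))

/-- Abel summation. It is used with `d` measuring what remains up to the right endpoint, so that the
boundary term `f n * d n` vanishes. -/
lemma sum_mul_sub_succ {R : Type*} [CommRing R] (f d : ℕ → R) (n : ℕ) :
    ∑ i ∈ Finset.range n, f i * (d i - d (i + 1)) =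
      f 0 * d 0 + ∑ i ∈ Finset.range n, (f (i + 1) - f i) * d (i + 1) - f n * d n := by
  induction n with
  | zero => simp
  | succ n ih => rw [Finset.sum_range_succ, Finset.sum_range_succ, ih]; ring

/-- Integration by parts: a `C¹` integrand needs only continuity of the integrator. The error is
bounded cell by cell through the uniform continuity of `g`. -/
lemma hasRSIntegral_of_continuous {f f' : ℝ → ℝ} (hf : ∀ x, HasDerivAt f (f' x) x)
    (hf' : Continuous f') {g : ℝ → ℂ} (hg : Continuous g) {a b : ℝ} (hab : a ≤ b) :
    HasRSIntegral f g a b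
      (f b * g b - f a * g a - ∫ r in a..b, (f' r : ℂ) * g r) := by
  obtain ⟨M, hM⟩ := isCompact_Icc.exists_bound_of_continuousOn (hf'.continuousOn (s := Icc a b))
  have hM0 : 0 ≤ M := (norm_nonneg _).trans (hM a ⟨le_rfl, hab⟩)
  have huc := isCompact_Icc.uniformContinuousOn_of_continuous (hg.continuousOn (s := Icc a b))
  rw [Metric.uniformContinuousOn_iff] at huc
  intro ε hε
  -- The `+ 1` avoids division by zero and makes the final estimate strict.
  set η : ℝ := ε / (M * (b - a) + 1) with hη
  have hden : 0 < M * (b - a) + 1 := by nlinarith [mul_nonneg hM0 (sub_nonneg.2 hab)]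
  have hηpos : 0 < η := div_pos hε hden
  obtain ⟨δ, hδ, hgδ⟩ := huc η hηpos
  refine ⟨δ, hδ, fun n u τ hu hu0 hun hmesh hτ => ?_⟩
  have hcont : Continuous fun r => (f' r : ℂ) * g r :=
    (Complex.continuous_ofReal.comp hf').mul hg
  have hfc : ∀ x y : ℝ, ∫ r in x..y, (f' r : ℂ) = f y - f x := fun x y => by
    rw [intervalIntegral.integral_ofReal, intervalIntegral.integral_eq_sub_of_hasDerivAt
      (fun z _ => hf z) (hf'.intervalIntegrable _ _)]
    push_cast; ring
  have hsum : f b * g b - f a * g a - ∫ r in a..b, (f' r : ℂ) * g r =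
      ∑ i ∈ Finset.range n, ((f (u (i + 1)) * g (u (i + 1)) - f (u i) * g (u i)) -
        ∫ r in (u i)..(u (i + 1)), (f' r : ℂ) * g r) := by
    rw [Finset.sum_sub_distrib, Finset.sum_range_sub (fun i => (f (u i) : ℂ) * g (u i)),
      intervalIntegral.sum_integral_adjacent_intervals
        (fun i _ => hcont.intervalIntegrable _ _), hu0, hun]
  rw [hsum, ← Finset.sum_sub_distrib]
  have hterm : ∀ i ∈ Finset.range n,
      ‖(f (τ i) : ℂ) * (g (u (i + 1)) - g (u i)) -
        ((f (u (i + 1)) * g (u (i + 1)) - f (u i) * g (u i)) -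
          ∫ r in (u i)..(u (i + 1)), (f' r : ℂ) * g r)‖ ≤ M * η * (u (i + 1) - u i) := by
    intro i hi
    have hi := Finset.mem_range.1 hi
    obtain ⟨h1, h2⟩ := hτ i hi
    have hlo : a ≤ u i := hu0 ▸ hu (Nat.zero_le i)
    have hhi : u (i + 1) ≤ b := hun ▸ hu hi
    have hm := hmesh i hi
    have hbound : ∀ p x y : ℝ, u i ≤ x → x ≤ y → y ≤ u (i + 1) → u i ≤ p → p ≤ u (i + 1) →
        ‖∫ r in x..y, (f' r : ℂ) * (g r - g p)‖ ≤ M * η * (y - x) := by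
      intro p x y hx hxy hy hp hp'
      have := intervalIntegral.norm_integral_le_of_norm_le_const (a := x) (b := y)
        (f := fun r => (f' r : ℂ) * (g r - g p)) (C := M * η) (fun r hr => by
          rw [uIoc_of_le hxy] at hr
          have hr' : r ∈ Icc a b := ⟨by linarith [hr.1], by linarith [hr.2]⟩
          have hpp : p ∈ Icc a b := ⟨by linarith, by linarith⟩
          rw [norm_mul, Complex.norm_real]
          refine mul_le_mul (hM r hr') ?_ (norm_nonneg _) hM0
          rw [← dist_eq_norm]
          refine (hgδ r hr' p hpp ?_).le
          rw [Real.dist_eq, abs_lt]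
          constructor <;> linarith [hr.1, hr.2])
      rwa [abs_of_nonneg (sub_nonneg.2 hxy)] at this
    -- Split the cell at its tag: to the left of it compare `g` with its value at the left endpoint,
    -- to the right with its value at the right endpoint.
    have hsplit : (f (τ i) : ℂ) * (g (u (i + 1)) - g (u i)) -
        ((f (u (i + 1)) * g (u (i + 1)) - f (u i) * g (u i)) -
          ∫ r in (u i)..(u (i + 1)), (f' r : ℂ) * g r) =
        (∫ r in (u i)..(τ i), (f' r : ℂ) * (g r - g (u i))) +
          ∫ r in (τ i)..(u (i + 1)), (f' r : ℂ) * (g r - g (u (i + 1))) := by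
      have e : ∀ p x y : ℝ, ∫ r in x..y, (f' r : ℂ) * (g r - g p) =
          (∫ r in x..y, (f' r : ℂ) * g r) - (f y - f x) * g p := by
        intro p x y
        simp_rw [mul_sub]
        rw [intervalIntegral.integral_sub (hcont.intervalIntegrable _ _)
          (Continuous.intervalIntegrable (by fun_prop) _ _),
          intervalIntegral.integral_mul_const, hfc]
      rw [e, e, ← intervalIntegral.integral_add_adjacent_intervals
        (hcont.intervalIntegrable (u i) (τ i)) (hcont.intervalIntegrable (τ i) (u (i + 1)))]
      ring
    rw [hsplit]
    calc _ ≤ M * η * (τ i - u i) + M * η * (u (i + 1) - τ i) :=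
          (norm_add_le _ _).trans (add_le_add
            (hbound _ _ _ le_rfl h1 h2 le_rfl (h1.trans h2))
            (hbound _ _ _ h1 h2 le_rfl (h1.trans h2) le_rfl))
      _ = _ := by ring
  calc _ ≤ ∑ i ∈ Finset.range n, M * η * (u (i + 1) - u i) :=
        (norm_sum_le _ _).trans (Finset.sum_le_sum hterm)
    _ = M * (b - a) * η := by
        rw [← Finset.mul_sum, Finset.sum_range_sub, hu0, hun]; ring
    _ < (M * (b - a) + 1) * η := by linarith
    _ = ε := by rw [hη]; field_simp

/-- The value chosen in `rsIntegral` satisfies the defining estimate itself, so its uniqueness is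
not needed. The index `n + 1` excludes the empty partition. -/
lemma tendsto_leftSum {f f' : ℝ → ℝ} (hf : ∀ x, HasDerivAt f (f' x) x)
    (hf' : Continuous f') {g : ℝ → ℂ} (hg : Continuous g) {s t : ℝ} (hst : s ≤ t) :
    Tendsto (fun n => leftSum f g s t (n + 1)) atTop (𝓝 (rsIntegral f g s t)) := by
  have hex : ∃ I, HasRSIntegral f g s t I := ⟨_, hasRSIntegral_of_continuous hf hf' hg hst⟩
  rw [rsIntegral, dif_pos hex]
  refine Metric.tendsto_atTop.2 fun ε hε => ?_
  obtain ⟨δ, hδ, h⟩ := hex.choose_spec ε hε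
  obtain ⟨N, hN⟩ := exists_nat_gt ((t - s) / δ)
  refine ⟨N, fun n hn => ?_⟩
  rw [dist_eq_norm]
  refine h (n + 1) (unifPt s t (n + 1)) (unifPt s t (n + 1)) (monotone_unifPt hst _)
    (unifPt_zero _ _ _) (unifPt_self _ _ (Nat.succ_ne_zero n)) (fun i _ => ?_)
    (fun i _ => ⟨le_rfl, monotone_unifPt hst _ (Nat.le_succ i)⟩)
  rw [unifPt_succ_sub, div_lt_iff₀ (by positivity)]
  rw [div_lt_iff₀ hδ] at hN
  have : (N : ℝ) ≤ ((n + 1 : ℕ) : ℝ) := by exact_mod_cast hn.trans (Nat.le_succ n)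
  nlinarith

lemma hasDerivAt_expKernel (t a x : ℝ) :
    HasDerivAt (fun r => Real.exp (-((t - r) * a))) (a * Real.exp (-((t - x) * a))) x := by
  have h : HasDerivAt (fun r : ℝ => -((t - r) * a)) a x := by
    have := (((hasDerivAt_id x).const_sub t).mul_const a).fun_neg
    simpa using this
  simpa [mul_comm] using h.exp

lemma tendsto_leftSum_exp (a : ℝ) {g : ℝ → ℂ} (hg : Continuous g) {s t : ℝ} (hst : s ≤ t) :
    Tendsto (fun n => leftSum (fun r => Real.exp (-((t - r) * a))) g s t (n + 1)) atTop
      (𝓝 (rsIntegral (fun r => Real.exp (-((t - r) * a))) g s t)) :=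
  tendsto_leftSum (hasDerivAt_expKernel t a) (by fun_prop) hg hst

end RiemannStieltjes

/-! ### Riemann-Stieltjes sums of fractional Brownian motion -/

section FBM

variable {Ω : Type*} [MeasurableSpace Ω] {P : Measure Ω} {H : ℝ}

lemma IsRealFBM.subGauss_sub [IsProbabilityMeasure P] {X : ℝ → Ω → ℝ} (hX : IsRealFBM H X P)
    (hH : 0 < H) (s t : ℝ) : SubGauss (fun ω => X t ω - X s ω) (|t - s| ^ H) P := by
  have hi : ∀ r, MemLp (X r) 2 P := fun r => (hX.gaussian.hasGaussianLaw_eval r).memLp_two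
  have hm : ∀ r q, Integrable (fun ω => X r ω * X q ω) P := fun r q => (hi r).integrable_mul (hi q)
  refine SubGauss.of_gaussian (hX.gaussian.hasGaussianLaw_fun_sub) ?_ (le_of_eq ?_)
    (by positivity)
  · rw [integral_sub ((hi t).integrable one_le_two) ((hi s).integrable one_le_two), hX.mean,
      hX.mean, sub_zero]
  · have e : ∀ ω, (X t ω - X s ω) ^ 2 =
        X t ω * X t ω - 2 * (X t ω * X s ω) + X s ω * X s ω := fun ω => by ring
    simp_rw [e]
    have h2 : Integrable (fun ω => X t ω * X t ω - 2 * (X t ω * X s ω)) P :=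
      (hm t t).sub ((hm t s).const_mul 2)
    rw [integral_add h2 (hm s s),
      integral_sub (hm t t) ((hm t s).const_mul 2), integral_const_mul, hX.cov, hX.cov, hX.cov,
      ← Real.rpow_natCast, ← Real.rpow_mul (abs_nonneg _)]
    simp only [sub_self, abs_zero]
    rw [Real.zero_rpow (by positivity), mul_comm H]
    push_cast
    ring

/-- Rescaling reduces this to `y^H ≤ 1 + y`. A majorant affine in `x` can be summed by parts
exactly, unlike `x^H`. -/
lemma rpow_le_inv_rpow_mul {a x H : ℝ} (ha : 0 < a) (hx : 0 ≤ x) (hH : H ∈ Ioo (0 : ℝ) 1) :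
    x ^ H ≤ a ^ (-H) * (1 + a * x) := by
  have h1 : x ^ H = a ^ (-H) * (a * x) ^ H := by
    rw [Real.mul_rpow ha.le hx, ← mul_assoc, ← Real.rpow_add ha]; simp
  rw [h1]
  gcongr
  have hax : 0 ≤ a * x := by positivity
  rcases le_total (a * x) 1 with h | h
  · exact (Real.rpow_le_one hax h hH.1.le).trans (by linarith)
  · calc (a * x) ^ H ≤ (a * x) ^ (1 : ℝ) := Real.rpow_le_rpow_of_exponent_le h hH.2.le
      _ ≤ _ := by rw [Real.rpow_one]; linarith

/-- The scale `min (2 a^{-H}) (h^H)` of `∫_s^{s+h} exp(-(s+h-r)a) dX(r)`. -/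
def convScale (H a h : ℝ) : ℝ := min (2 * a ^ (-H)) (h ^ H)

/-- After Abel summation the sum is an average of the increments `X(t) - X(u_i)` with nonnegative
weights of total `1`, because the exponential kernel increases to `1` at the right endpoint. The
scale is therefore at most the average of `(t - u_i)^H`. Bounding each term by `(t - s)^H` gives one
half of the minimum; the affine majorant gives the other, uniformly in the partition and in `t - s`.
-/
lemma IsRealFBM.subGauss_leftSum [IsProbabilityMeasure P] {X : ℝ → Ω → ℝ} (hX : IsRealFBM H X P)
    (hH : H ∈ Ioo (0 : ℝ) 1) {a s t : ℝ} (ha : 0 < a) (hst : s ≤ t) (n : ℕ) :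
    SubGauss (fun ω => ∑ i ∈ Finset.range (n + 1),
      Real.exp (-((t - unifPt s t (n + 1) i) * a)) *
        (X (unifPt s t (n + 1) (i + 1)) ω - X (unifPt s t (n + 1) i) ω))
      (convScale H a (t - s)) P := by
  set u := unifPt s t (n + 1)
  have hu : Monotone u := monotone_unifPt hst _
  have hu0 : u 0 = s := unifPt_zero _ _ _
  have hun : u (n + 1) = t := unifPt_self _ _ (Nat.succ_ne_zero n)
  set f : ℕ → ℝ := fun i => Real.exp (-((t - u i) * a)) with hf
  have hfpos : ∀ i, 0 < f i := fun i => Real.exp_pos _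
  have hfn : f (n + 1) = 1 := by simp [hf, hun]
  -- A discrete form of `f' = a f`, from `1 + x ≤ exp x`.
  have hfm : ∀ i, a * (f i * (u (i + 1) - u i)) ≤ f (i + 1) - f i := by
    intro i
    have : f (i + 1) = f i * Real.exp ((u (i + 1) - u i) * a) := by
      simp only [hf]; rw [← Real.exp_add]; congr 1; ring
    rw [this]
    nlinarith [Real.add_one_le_exp ((u (i + 1) - u i) * a), hfpos i]
  have hfi : ∀ i, 0 ≤ f (i + 1) - f i := fun i => le_trans
    (mul_nonneg ha.le (mul_nonneg (hfpos i).le (sub_nonneg.2 (hu (Nat.le_succ i))))) (hfm i)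
  have hle : ∀ i, i ≤ n + 1 → u i ≤ t := fun i hi => hun ▸ hu hi
  have hsg : SubGauss (fun ω => ∑ i ∈ Finset.range (n + 1), f i * (X (u (i + 1)) ω - X (u i) ω))
      (f 0 * |t - u 0| ^ H +
        ∑ i ∈ Finset.range (n + 1), (f (i + 1) - f i) * |t - u (i + 1)| ^ H) P := by
    have h0 := ((hX.subGauss_sub hH.1 (u 0) t).const_mul (f 0)).add
      (SubGauss.sum (Finset.range (n + 1)) fun i _ =>
        (hX.subGauss_sub hH.1 (u (i + 1)) t).const_mul (f (i + 1) - f i))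
    simp only [abs_of_pos (hfpos 0), abs_of_nonneg (hfi _)] at h0
    refine h0.congr (ae_of_all _ fun ω => ?_)
    have := sum_mul_sub_succ f (fun i => X t ω - X (u i) ω) (n + 1)
    simp only [hun, sub_self, mul_zero, sub_zero] at this
    dsimp only
    rw [← this]
    exact Finset.sum_congr rfl fun i _ => by ring
  have hs1 : f 0 + ∑ i ∈ Finset.range (n + 1), (f (i + 1) - f i) = 1 := by
    rw [Finset.sum_range_sub, hfn]; ring
  refine hsg.mono (le_min ?_ ?_)
  · have hW : ∀ i, i ≤ n + 1 → |t - u i| ^ H ≤ a ^ (-H) * (1 + a * (t - u i)) := fun i hi => by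
      rw [abs_of_nonneg (sub_nonneg.2 (hle i hi))]
      exact rpow_le_inv_rpow_mul ha (sub_nonneg.2 (hle i hi)) hH
    -- Summing the linear part back by parts gives the lower Riemann sum of `f`, which `hfm` bounds
    -- by `1 / a`.
    have h2 := sum_mul_sub_succ f (fun i => t - u i) (n + 1)
    simp only [hun, sub_self, mul_zero, sub_zero] at h2
    calc _ ≤ f 0 * (a ^ (-H) * (1 + a * (t - u 0))) + ∑ i ∈ Finset.range (n + 1),
          (f (i + 1) - f i) * (a ^ (-H) * (1 + a * (t - u (i + 1)))) := by
          refine add_le_add (mul_le_mul_of_nonneg_left (hW 0 (Nat.zero_le _)) (hfpos 0).le)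
            (Finset.sum_le_sum fun i hi => ?_)
          exact mul_le_mul_of_nonneg_left (hW _ (Finset.mem_range.1 hi)) (hfi i)
      _ = a ^ (-H) * ((f 0 + ∑ i ∈ Finset.range (n + 1), (f (i + 1) - f i)) + a * (f 0 * (t - u 0) +
            ∑ i ∈ Finset.range (n + 1), (f (i + 1) - f i) * (t - u (i + 1)))) := by
          simp only [mul_add, Finset.mul_sum, mul_one, Finset.sum_add_distrib]
          have e1 : ∀ x y z w : ℝ, x = y → z = w → x + z = y + w := by rintro _ _ _ _ rfl rfl; rfl
          have e2 : ∑ i ∈ Finset.range (n + 1), (f (i + 1) - f i) * (a ^ (-H) * (a * (t - u (i + 1))))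
            = ∑ i ∈ Finset.range (n + 1), a ^ (-H) * (a * ((f (i + 1) - f i) * (t - u (i + 1)))) :=
            Finset.sum_congr rfl fun i _ => by ring
          have e3 : ∑ i ∈ Finset.range (n + 1), (f (i + 1) - f i) * a ^ (-H)
            = ∑ i ∈ Finset.range (n + 1), a ^ (-H) * (f (i + 1) - f i) :=
            Finset.sum_congr rfl fun i _ => by ring
          rw [e2, e3]; ring
      _ ≤ a ^ (-H) * (1 + 1) := by
          rw [hs1, ← h2]
          gcongr
          rw [Finset.mul_sum]
          calc _ ≤ ∑ i ∈ Finset.range (n + 1), (f (i + 1) - f i) :=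
                Finset.sum_le_sum fun i _ => by
                  have := hfm i
                  rwa [show t - u i - (t - u (i + 1)) = u (i + 1) - u i by ring]
            _ ≤ 1 := by linarith [hfpos 0]
      _ = _ := by ring
  · have hW : ∀ i, i ≤ n + 1 → |t - u i| ^ H ≤ (t - s) ^ H := fun i hi => by
      rw [abs_of_nonneg (sub_nonneg.2 (hle i hi))]
      have : s ≤ u i := hu0 ▸ hu (Nat.zero_le i)
      exact Real.rpow_le_rpow (sub_nonneg.2 (hle i hi)) (by linarith) hH.1.le
    calc _ ≤ f 0 * (t - s) ^ H + ∑ i ∈ Finset.range (n + 1),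
          (f (i + 1) - f i) * (t - s) ^ H := by
          refine add_le_add (mul_le_mul_of_nonneg_left (hW 0 (Nat.zero_le _)) (hfpos 0).le)
            (Finset.sum_le_sum fun i hi => ?_)
          exact mul_le_mul_of_nonneg_left (hW _ (Finset.mem_range.1 hi)) (hfi i)
      _ = _ := by rw [← Finset.sum_mul, ← add_mul, hs1, one_mul]

/-- The real part of `c` times the left sum is a measurable functional of the path. -/
lemma measurable_re_leftSum (f : ℝ → ℝ) (s t : ℝ) (n : ℕ) (c : ℂ) :
    Measurable fun g : ℝ → ℂ => (c * leftSum f g s t n).re := by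
  unfold leftSum
  fun_prop

/-- The real part of `c` times the sum is a combination of the sums for `X` and `Y`. Each
contributes at most `‖c‖` times the scale, hence the factor `2`. -/
lemma IsComplexFBM.subGauss_leftSum [IsProbabilityMeasure P] {b : ℝ → Ω → ℂ}
    (hb : IsComplexFBM H b P) (hH : H ∈ Ioo (0 : ℝ) 1) {a s t : ℝ} (ha : 0 < a) (hst : s ≤ t)
    (n : ℕ) (c : ℂ) :
    SubGauss (fun ω => (c * leftSum (fun r => Real.exp (-((t - r) * a))) (fun r => b r ω) s t
      (n + 1)).re) (2 * (‖c‖ * convScale H a (t - s))) P := by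
  obtain ⟨X, Y, hX, hY, -, hXY⟩ := hb
  have h1 := (hX.subGauss_leftSum hH ha hst n).const_mul (1 / √2 * c.re)
  have h2 := (hY.subGauss_leftSum hH ha hst n).const_mul (1 / √2 * c.im)
  have h0 := (hX.subGauss_leftSum hH ha hst n).1
  have hs : 1 / √2 ≤ 1 := by
    rw [div_le_one (by positivity)]; exact Real.one_le_sqrt.2 one_le_two
  refine ((h1.sub h2).congr (ae_of_all _ fun ω => ?_)).mono ?_
  · simp only [leftSum, hXY, Finset.mul_sum, Complex.re_sum, ← Finset.sum_sub_distrib]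
    refine Finset.sum_congr rfl fun i _ => ?_
    generalize Real.exp _ = e, 1 / √2 = q
    simp only [Complex.mul_re, Complex.sub_re, Complex.add_re, Complex.mul_im, Complex.sub_im,
      Complex.add_im, Complex.ofReal_re, Complex.ofReal_im, Complex.I_re, Complex.I_im]
    ring
  · rw [abs_mul, abs_mul, abs_of_nonneg (show (0 : ℝ) ≤ 1 / √2 by positivity), ← add_mul,
      ← mul_assoc]
    refine mul_le_mul_of_nonneg_right ?_ h0
    have := mul_le_mul hs (Complex.abs_re_le_norm c) (abs_nonneg _) zero_le_one
    have := mul_le_mul hs (Complex.abs_im_le_norm c) (abs_nonneg _) zero_le_one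
    linarith

lemma IsComplexFBM.ae_continuous {b : ℝ → Ω → ℂ} (hb : IsComplexFBM H b P) :
    ∀ᵐ ω ∂P, Continuous fun t => b t ω := by
  obtain ⟨X, Y, hX, hY, -, hXY⟩ := hb
  filter_upwards [hX.continuous, hY.continuous] with ω h1 h2
  simp_rw [hXY]
  fun_prop

lemma IsComplexFBM.measurable {b : ℝ → Ω → ℂ} (hb : IsComplexFBM H b P) (t : ℝ) :
    Measurable (b t) := by
  obtain ⟨X, Y, hX, hY, -, hXY⟩ := hb
  have := hX.measurable t
  have := hY.measurable t
  have h : b t = fun ω => ((1 / √2 * X t ω : ℝ) : ℂ) + Complex.I * ((1 / √2 * Y t ω : ℝ) : ℂ) :=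
    funext (hXY t)
  rw [h]
  fun_prop

end FBM

/-! ### Fourier coefficients in `V` -/

section HilbertSpace

lemma inner_toLp_mFourier (n : Fin 2 → ℤ) (f : L2Torus) :
    inner ℂ (ContinuousMap.toLp (E := ℂ) 2 torusMeasure ℂ (UnitAddTorus.mFourier n)) f =
      ∫ x, starRingEnd ℂ (UnitAddTorus.mFourier n x) * f x ∂torusMeasure := by
  rw [L2.inner_def]
  refine integral_congr_ae ?_
  filter_upwards [ContinuousMap.coeFn_toLp (E := ℂ) (𝕜 := ℂ) (p := 2) torusMeasure
    (UnitAddTorus.mFourier n)] with x hx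
  rw [hx, RCLike.inner_apply, mul_comm]

lemma mem_V_iff (f : L2Torus) : f ∈ V ↔
    inner ℂ (ContinuousMap.toLp (E := ℂ) 2 torusMeasure ℂ (UnitAddTorus.mFourier 0)) f = 0 := by
  rw [inner_toLp_mFourier, UnitAddTorus.mFourier_zero]
  simp only [ContinuousMap.one_apply, map_one, one_mul]
  rfl

instance : CompleteSpace V := by
  have : IsClosed (V : Set L2Torus) := by
    have h : (V : Set L2Torus) = {f | inner ℂ (ContinuousMap.toLp (E := ℂ) 2 torusMeasure ℂ
      (UnitAddTorus.mFourier 0)) f = 0} := Set.ext mem_V_iff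
    rw [h]
    exact isClosed_eq (by fun_prop) continuous_const
  exact this.completeSpace_coe

lemma orthonormal_e : Orthonormal ℂ e := by
  have h := (UnitAddTorus.orthonormal_mFourier (d := Fin 2)).comp (fun k : Mode => k.1)
    Subtype.val_injective
  rw [orthonormal_iff_ite] at h ⊢
  exact h

/-- The Fourier coefficient `⟨e_k, f⟩`. -/
def coef (f : V) (k : Mode) : ℂ := @inner ℂ V InnerProductSpace.toInner (e k) f

lemma inner_e (f : V) (k : Mode) : inner ℂ (e k) f = coef f k := rfl

lemma coef_add (f g : V) (k : Mode) : coef (f + g) k = coef f k + coef g k := inner_add_right _ _ _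

lemma coef_sub (f g : V) (k : Mode) : coef (f - g) k = coef f k - coef g k := inner_sub_right _ _ _

lemma coef_smul_e (c : ℂ) (k l : Mode) : coef (c • e l) k = if k = l then c else 0 := by
  have h1 : coef (c • e l) k = c * coef (e l) k :=
    (innerSL ℂ (e k)).map_smul c (e l)
  have h2 : coef (e l) k = if k = l then 1 else 0 := orthonormal_iff_ite.1 orthonormal_e k l
  rw [h1, h2, mul_ite, mul_one, mul_zero]

lemma norm_coef_le (f : V) (k : Mode) : ‖coef f k‖ ≤ ‖f‖ := by
  have h : ‖coef f k‖ ≤ ‖e k‖ * ‖f‖ := norm_inner_le_norm (𝕜 := ℂ) (e k) f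
  rwa [orthonormal_e.1 k, one_mul] at h

lemma continuous_coef (k : Mode) : Continuous fun f => coef f k :=
  (innerSL ℂ (e k)).continuous

lemma summable_diagOp {σ : Mode → ℝ} (hσ : ∀ k, |σ k| ≤ 1) (f : V) :
    Summable fun k => ((σ k : ℂ) * coef f k) • e k := by
  have h := orthonormal_e.orthogonalFamily.summable_iff_norm_sq_summable
    (fun k => (σ k : ℂ) * coef f k)
  refine h.2 ((orthonormal_e.inner_products_summable (x := f)).of_nonneg_of_le
    (fun k => by positivity) fun k => ?_)
  rw [norm_mul, Complex.norm_real, Real.norm_eq_abs]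
  gcongr
  exact mul_le_of_le_one_left (norm_nonneg _) (hσ k)

lemma coef_diagOp {σ : Mode → ℝ} (hσ : ∀ k, |σ k| ≤ 1) (f : V) (k : Mode) :
    coef (diagOp σ f) k = σ k * coef f k := by
  have h : coef (∑' l, ((σ l : ℂ) * coef f l) • e l) k =
      ∑' l, coef (((σ l : ℂ) * coef f l) • e l) k :=
    (innerSL ℂ (e k)).map_tsum (summable_diagOp hσ f)
  simp only [diagOp, inner_e]
  rw [h, tsum_eq_single k fun l hl => by rw [coef_smul_e, if_neg (Ne.symm hl)], coef_smul_e,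
    if_pos rfl]

lemma coef_semigroup {ν : ℝ} (hν : 0 ≤ ν) {α : Mode → ℝ} (hα : ∀ k, 0 ≤ α k) {t : ℝ}
    (ht : 0 ≤ t) (f : V) (k : Mode) :
    coef (semigroup ν α t f) k = Real.exp (-(t * (ν * α k))) * coef f k := by
  rw [semigroup, coef_diagOp (fun k => ?_) f k, mul_assoc]
  rw [abs_of_pos (Real.exp_pos _), Real.exp_le_one_iff, neg_nonpos]
  have := hα k
  positivity

end HilbertSpace

/-! ### The mild equation mode by mode, and stationarity. -/

section Noise

variable {Ω : Type*} [MeasurableSpace Ω] {P : Measure Ω} {ν H : ℝ} {α lam : Mode → ℝ}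
  {β : Mode → ℝ → Ω → ℂ} {ψ : ℝ → Ω → V}

lemma StandingAssumption.alpha_pos (hA : StandingAssumption ν H α lam β P) (k : Mode) :
    0 < α k := by
  obtain ⟨c, hc, h⟩ := hA.alpha_lower
  exact hc.trans_le (h k)

/-- The coefficient `√λ_k ν^H ∫_s^t exp(-(t-r) ν α_k) dβ_k(r)` of the stochastic convolution. -/
def convCoef (ν H : ℝ) (α lam : Mode → ℝ) (β : Mode → ℝ → Ω → ℂ) (s t : ℝ) (k : Mode) (ω : Ω) : ℂ :=
  ((√(lam k) * ν ^ H : ℝ) : ℂ) *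
    rsIntegral (fun r => Real.exp (-((t - r) * (ν * α k)))) (fun r => β k r ω) s t

/-- The approximation of `convCoef` by a left Riemann-Stieltjes sum. -/
def convSum (ν H : ℝ) (α lam : Mode → ℝ) (β : Mode → ℝ → Ω → ℂ) (s t : ℝ) (n : ℕ) (k : Mode)
    (ω : Ω) : ℂ :=
  ((√(lam k) * ν ^ H : ℝ) : ℂ) *
    leftSum (fun r => Real.exp (-((t - r) * (ν * α k)))) (fun r => β k r ω) s t (n + 1)

lemma ae_tendsto_convSum (hβ : IsNoise H β P) {s t : ℝ} (hst : s ≤ t) (k : Mode) :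
    ∀ᵐ ω ∂P, Tendsto (fun n => convSum ν H α lam β s t n k ω) atTop
      (𝓝 (convCoef ν H α lam β s t k ω)) := by
  filter_upwards [(hβ.fbm k).ae_continuous] with ω hω
  exact (tendsto_leftSum_exp _ hω hst).const_mul _

lemma measurable_convSum (hβ : IsNoise H β P) (s t : ℝ) (n : ℕ) (k : Mode) :
    Measurable (convSum ν H α lam β s t n k) := by
  have := (hβ.fbm k).measurable
  unfold convSum leftSum
  fun_prop

lemma aemeasurable_convCoef (hβ : IsNoise H β P) {s t : ℝ} (hst : s ≤ t) (k : Mode) :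
    AEMeasurable (convCoef ν H α lam β s t k) P :=
  aemeasurable_of_tendsto_metrizable_ae atTop
    (fun n => (measurable_convSum hβ s t n k).aemeasurable) (ae_tendsto_convSum hβ hst k)

/-- Once the finite set contains `k`, the `k`-th coefficient of the partial sum no longer changes,
so the difference is dominated by a remainder tending to `0` in `L²`. -/
lemma IsStochConv.coef_eq {s t : ℝ} {J : Ω → V} (hJ : IsStochConv ν H α lam β P s t J)
    (hβ : IsNoise H β P) (hst : s ≤ t) (k : Mode) :
    ∀ᵐ ω ∂P, coef (J ω) k = convCoef ν H α lam β s t k ω := by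
  obtain ⟨hJ2, hlim⟩ := hJ
  have hle : ∀ F : Finset Mode, k ∈ F →
      eLpNorm (fun ω => coef (J ω) k - convCoef ν H α lam β s t k ω) 2 P ≤
      eLpNorm (fun ω => J ω - ∑ k ∈ F, (((√(lam k) * ν ^ H : ℝ) : ℂ) *
        rsIntegral (fun r => Real.exp (-((t - r) * ν * α k))) (fun r => β k r ω) s t) • e k) 2 P := by
    intro F hF
    refine eLpNorm_mono fun ω => ?_
    refine le_trans (le_of_eq ?_) (norm_coef_le _ k)
    rw [coef_sub]
    congr 2
    have hsum : ∀ c : Mode → ℂ, coef (∑ l ∈ F, c l • e l) k = c k := fun c => by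
      have h1 : coef (∑ l ∈ F, c l • e l) k = ∑ l ∈ F, coef (c l • e l) k := by
        simp only [coef, inner_sum]
      simp only [h1, coef_smul_e, Finset.sum_ite_eq, if_pos hF]
    rw [hsum, convCoef]
    simp_rw [mul_assoc]
  have h0 : eLpNorm (fun ω => coef (J ω) k - convCoef ν H α lam β s t k ω) 2 P = 0 := by
    refine le_antisymm (ge_of_tendsto hlim ?_) bot_le
    filter_upwards [eventually_ge_atTop {k}] with F hF
    exact hle F (hF (Finset.mem_singleton_self k))
  rw [eLpNorm_eq_zero_iff ?_ (by norm_num)] at h0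
  · filter_upwards [h0] with ω hω
    exact sub_eq_zero.1 hω
  · exact ((continuous_coef k).comp_aestronglyMeasurable hJ2.1).sub
      (aemeasurable_convCoef hβ hst k).aestronglyMeasurable

lemma IsMildSolution.coef_eq (hψ : IsMildSolution ν H α lam β P ψ)
    (hA : StandingAssumption ν H α lam β P) {s t : ℝ} (hst : s ≤ t) (k : Mode) :
    ∀ᵐ ω ∂P, coef (ψ t ω) k = Real.exp (-((t - s) * (ν * α k))) * coef (ψ s ω) k +
      convCoef ν H α lam β s t k ω := by
  obtain ⟨J, hJ, h⟩ := hψ.mild s t hst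
  filter_upwards [h, hJ.coef_eq hA.noise hst k] with ω h1 h2
  rw [h1, coef_add, h2, coef_semigroup hA.nu_pos.le (fun k => (hA.alpha_pos k).le)
    (sub_nonneg.2 hst)]

lemma IsMildSolution.measurable_eval (hψ : IsMildSolution ν H α lam β P ψ) (t : ℝ) :
    Measurable (ψ t) := hψ.measurable.comp (by fun_prop : Measurable fun ω : Ω => (t, ω))

lemma IsMildSolution.measurable_coef (hψ : IsMildSolution ν H α lam β P ψ) (t : ℝ) (k : Mode) :
    Measurable fun ω => coef (ψ t ω) k :=
  (continuous_coef k).measurable.comp (hψ.measurable_eval t)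

lemma IsStrictlyStationary.map_eq (h : IsStrictlyStationary P ψ) (hm : ∀ t, Measurable (ψ t))
    (t : ℝ) : P.map (ψ t) = P.map (ψ 0) := by
  have h1 := h 1 (fun _ => 0) t
  have hmm : ∀ r, Measurable fun ω (_ : Fin 1) => ψ r ω :=
    fun r => measurable_pi_lambda _ fun _ => hm r
  have h2 := congrArg (Measure.map fun x : Fin 1 → V => x 0) h1
  rw [Measure.map_map (measurable_pi_apply 0) (hmm _),
    Measure.map_map (measurable_pi_apply 0) (hmm _)] at h2
  simpa [Function.comp_def] using h2

/-- The variables `‖ψ (t n)‖` all have the law of `‖ψ 0‖`, so multiplying by `r n → 0` sends them to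
`0` in probability. No moment of `ψ` is required. -/
lemma IsStrictlyStationary.tendstoInMeasure [IsProbabilityMeasure P]
    (h : IsStrictlyStationary P ψ) (hm : ∀ t, Measurable (ψ t)) {t r : ℕ → ℝ}
    (hr : Tendsto r atTop (𝓝 0)) {D : ℕ → Ω → ℝ} (hD : ∀ n, ∀ᵐ ω ∂P, |D n ω| ≤ r n * ‖ψ (t n) ω‖) :
    TendstoInMeasure P D atTop fun _ => 0 := by
  have h0 : TendstoInMeasure P (fun n ω => r n * ‖ψ 0 ω‖) atTop fun _ => (0 : ℝ) := by
    refine tendstoInMeasure_of_tendsto_ae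
      (fun n => ((hm 0).norm.const_mul _).aestronglyMeasurable) (ae_of_all _ fun ω => ?_)
    simpa using hr.mul_const ‖ψ 0 ω‖
  intro ε hε
  refine tendsto_of_tendsto_of_tendsto_of_le_of_le tendsto_const_nhds (h0 ε hε)
    (fun n => bot_le) fun n => ?_
  dsimp only
  have hms : MeasurableSet {x : V | ε ≤ edist (r n * ‖x‖) 0} :=
    measurableSet_le measurable_const ((by fun_prop : Continuous fun x : V =>
      edist (r n * ‖x‖) 0).measurable)
  calc P {x | ε ≤ edist (D n x) 0} ≤ P {ω | ε ≤ edist (r n * ‖ψ (t n) ω‖) 0} := by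
        refine measure_mono_ae ?_
        filter_upwards [hD n] with ω hω h2
        refine le_trans h2 ?_
        rw [edist_dist, edist_dist]
        refine ENNReal.ofReal_le_ofReal ?_
        rw [Real.dist_eq, Real.dist_eq, sub_zero, sub_zero]
        exact hω.trans (le_abs_self _)
    _ = P.map (ψ (t n)) {x : V | ε ≤ edist (r n * ‖x‖) 0} := by
        rw [Measure.map_apply (hm _) hms]; rfl
    _ = P.map (ψ 0) {x : V | ε ≤ edist (r n * ‖x‖) 0} := by rw [h.map_eq hm]
    _ = _ := by rw [Measure.map_apply (hm _) hms]; rfl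

end Noise

/-! ### Subgaussian bounds for the Fourier coefficients of the solution -/

section Bounds

lemma sqrt_sum_sq_le_mul {ι : Type*} {F F' : Finset ι} (hF : F' ⊆ F) {x y : ι → ℝ} {C : ℝ}
    (hC : 0 ≤ C) (hx : ∀ k, 0 ≤ x k) (hxy : ∀ k, x k ≤ C * y k) :
    √(∑ k ∈ F', x k ^ 2) ≤ C * √(∑ k ∈ F, y k ^ 2) := by
  nth_rw 1 [← Real.sqrt_sq hC]
  rw [← Real.sqrt_mul (sq_nonneg C), Finset.mul_sum]
  refine Real.sqrt_le_sqrt ((Finset.sum_le_sum fun k _ => ?_).trans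
    (Finset.sum_le_sum_of_subset_of_nonneg hF fun k _ _ => by positivity))
  rw [← mul_pow]
  exact pow_le_pow_left₀ (hx k) (hxy k) 2

/-- A half plane of modes, which together with its negative exhausts all modes. -/
def upperModes : Set Mode := {k | 0 < k.1 0 ∨ (k.1 0 = 0 ∧ 0 < k.1 1)}

lemma neg_notMem_upperModes {k : Mode} (hk : k ∈ upperModes) : -k ∉ upperModes := by
  change 0 < k.1 0 ∨ (k.1 0 = 0 ∧ 0 < k.1 1) at hk
  change ¬(0 < -(k.1 0) ∨ (-(k.1 0) = 0 ∧ 0 < -(k.1 1)))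
  omega

lemma neg_mem_upperModes {k : Mode} (hk : k ∉ upperModes) : -k ∈ upperModes := by
  change ¬(0 < k.1 0 ∨ (k.1 0 = 0 ∧ 0 < k.1 1)) at hk
  change 0 < -(k.1 0) ∨ (-(k.1 0) = 0 ∧ 0 < -(k.1 1))
  have h : ¬(k.1 0 = 0 ∧ k.1 1 = 0) := fun h => k.2 (by ext i; fin_cases i <;> simp [h.1, h.2])
  omega

variable {Ω : Type*} [MeasurableSpace Ω] {P : Measure Ω} [IsProbabilityMeasure P]
  {ν H : ℝ} {α lam : Mode → ℝ} {β : Mode → ℝ → Ω → ℂ} {ψ : ℝ → Ω → V}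

lemma convScale_nonneg {H a h : ℝ} (ha : 0 < a) (hh : 0 ≤ h) : 0 ≤ convScale H a h :=
  le_min (by positivity) (by positivity)

open Classical in
lemma subGauss_sum_convSum_of_indep (hA : StandingAssumption ν H α lam β P) {S : Set Mode}
    (hS : ∀ k ∈ S, -k ∉ S) {F : Finset Mode} (hF : ∀ k ∈ F, k ∈ S) (c : Mode → ℂ) {s t : ℝ}
    (hst : s ≤ t) (n : ℕ) :
    SubGauss (fun ω => ∑ k ∈ F, (c k * convSum ν H α lam β s t n k ω).re)
      √(∑ k ∈ F, (2 * (‖c k‖ * (√(lam k) * ν ^ H) * convScale H (ν * α k) (t - s))) ^ 2) P := by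
  set c' : Mode → ℂ := fun k => c k * ((√(lam k) * ν ^ H : ℝ) : ℂ) with hc'
  have hc : ∀ k, ‖c' k‖ = ‖c k‖ * (√(lam k) * ν ^ H) := fun k => by
    rw [hc', norm_mul, Complex.norm_real, Real.norm_eq_abs, abs_of_nonneg]
    have := hA.nu_pos
    positivity
  have hI := (hA.noise.indep S hS).comp (fun k g =>
    (c' k * leftSum (fun r => Real.exp (-((t - r) * (ν * α k)))) g s t (n + 1)).re)
    fun k => measurable_re_leftSum _ _ _ _ _
  have h := SubGauss.sum_of_iIndepFun hI (s := fun k => 2 * (‖c' k‖ *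
    convScale H (ν * α k) (t - s))) (F.subtype (· ∈ S)) fun k _ =>
      (hA.noise.fbm k).subGauss_leftSum hA.hurst (mul_pos hA.nu_pos (hA.alpha_pos k)) hst n (c' k)
  rw [Finset.sum_subtype_of_mem (fun k => (2 * (‖c' k‖ * convScale H (ν * α k) (t - s))) ^ 2) hF]
    at h
  simp only [hc] at h
  refine h.congr (ae_of_all _ fun ω => ?_)
  dsimp only
  rw [← Finset.sum_subtype_of_mem (fun k => (c k * convSum ν H α lam β s t n k ω).re) hF]
  refine Finset.sum_congr rfl fun k _ => ?_
  simp only [Function.comp_apply, convSum, hc', mul_assoc]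

/-- The relation between `β_k` and `β_{-k}` destroys joint independence, so the modes are split into
two opposite half planes. Independence is used within each, and the two scales are added: `4 = 2 +
2`. -/
lemma subGauss_sum_convSum (hA : StandingAssumption ν H α lam β P) (F : Finset Mode) (c : Mode → ℂ)
    {s t : ℝ} (hst : s ≤ t) (n : ℕ) :
    SubGauss (fun ω => ∑ k ∈ F, (c k * convSum ν H α lam β s t n k ω).re)
      (4 * √(∑ k ∈ F, (‖c k‖ * (√(lam k) * ν ^ H) * convScale H (ν * α k) (t - s)) ^ 2)) P := by
  classical
  have h1 := subGauss_sum_convSum_of_indep hA (fun k => neg_notMem_upperModes)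
    (F := F.filter (· ∈ upperModes)) (fun k hk => (Finset.mem_filter.1 hk).2) c hst n
  have h2 := subGauss_sum_convSum_of_indep hA (S := upperModesᶜ)
    (fun k hk => not_not.2 (neg_mem_upperModes hk))
    (F := F.filter (· ∉ upperModes)) (fun k hk => (Finset.mem_filter.1 hk).2) c hst n
  set w : Mode → ℝ := fun k => ‖c k‖ * (√(lam k) * ν ^ H) * convScale H (ν * α k) (t - s)
  have hw0 : ∀ k, 0 ≤ w k := fun k => by
    have := convScale_nonneg (H := H) (mul_pos hA.nu_pos (hA.alpha_pos k)) (sub_nonneg.2 hst)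
    have := hA.nu_pos
    positivity
  have hw : ∀ F' ⊆ F, √(∑ k ∈ F', (2 * w k) ^ 2) ≤ 2 * √(∑ k ∈ F, w k ^ 2) := fun F' hF' =>
    sqrt_sum_sq_le_mul hF' zero_le_two (fun k => mul_nonneg zero_le_two (hw0 k)) fun k => le_rfl
  refine ((h1.add h2).congr (ae_of_all _ fun ω => ?_)).mono ?_
  · exact Finset.sum_filter_add_sum_filter_not F _ _
  · have e1 := hw _ (Finset.filter_subset (· ∈ upperModes) F)
    have e2 := hw _ (Finset.filter_subset (· ∉ upperModes) F)
    linarith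

lemma subGauss_sum_convCoef (hA : StandingAssumption ν H α lam β P) (F : Finset Mode)
    (c : Mode → ℂ) {s t : ℝ} (hst : s ≤ t) :
    SubGauss (fun ω => ∑ k ∈ F, (c k * convCoef ν H α lam β s t k ω).re)
      (4 * √(∑ k ∈ F, (‖c k‖ * (√(lam k) * ν ^ H) * convScale H (ν * α k) (t - s)) ^ 2)) P := by
  refine SubGauss.of_tendsto_ae (fun n => subGauss_sum_convSum hA F c hst n) ?_
  have h : ∀ᵐ ω ∂P, ∀ k, Tendsto (fun n => convSum ν H α lam β s t n k ω) atTop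
      (𝓝 (convCoef ν H α lam β s t k ω)) :=
    ae_all_iff.2 fun k => ae_tendsto_convSum hA.noise hst k
  filter_upwards [h] with ω hω
  refine tendsto_finsetSum _ fun k _ => ?_
  exact (Complex.continuous_re.tendsto _).comp ((hω k).const_mul (c k))

/-- The square root of the sum of `(‖c_k‖ w_k √λ_k α_k^{-H})²`. -/
def modeScale (H : ℝ) (α lam : Mode → ℝ) (F : Finset Mode) (c : Mode → ℂ) (w : Mode → ℝ) : ℝ :=
  √(∑ k ∈ F, (‖c k‖ * w k * (√(lam k) * α k ^ (-H))) ^ 2)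

lemma tendsto_exp_neg_nat_mul {a : ℝ} (ha : 0 < a) :
    Tendsto (fun n : ℕ => Real.exp (-(n * a))) atTop (𝓝 0) :=
  Real.tendsto_exp_neg_atTop_nhds_zero.comp
    (tendsto_natCast_atTop_atTop.atTop_mul_const ha)

/-- Start the equation at time `t - n`: the error is the damped initial value, at most a constant
times `exp(-nνa) ‖ψ(t - n)‖`. -/
lemma tendstoInMeasure_coef_sub_convCoef (hA : StandingAssumption ν H α lam β P)
    (hψ : IsErgodicMildSolution ν H α lam β P ψ) (F : Finset Mode) (c : Mode → ℂ) (t : ℝ) :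
    TendstoInMeasure P (fun (n : ℕ) ω => ∑ k ∈ F, (c k * convCoef ν H α lam β (t - n) t k ω).re)
      atTop (fun ω => ∑ k ∈ F, (c k * coef (ψ t ω) k).re) := by
  obtain ⟨a, ha, hα⟩ := hA.alpha_lower
  have hν := hA.nu_pos
  have hlim : Tendsto (fun n : ℕ => (∑ k ∈ F, ‖c k‖) * Real.exp (-(n * (ν * a)))) atTop (𝓝 0) := by
    simpa using (tendsto_exp_neg_nat_mul (mul_pos hν ha)).const_mul (∑ k ∈ F, ‖c k‖)
  have h0 := hψ.stationary.tendstoInMeasure hψ.mildSolution.measurable_eval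
    (t := fun n => t - n) hlim (D := fun n ω =>
      ∑ k ∈ F, (c k * convCoef ν H α lam β (t - n) t k ω).re - ∑ k ∈ F, (c k * coef (ψ t ω) k).re)
    (fun n => by
      have h1 : ∀ᵐ ω ∂P, ∀ k, coef (ψ t ω) k =
          Real.exp (-((t - (t - n)) * (ν * α k))) * coef (ψ (t - n) ω) k +
            convCoef ν H α lam β (t - n) t k ω := ae_all_iff.2 fun k =>
        hψ.mildSolution.coef_eq hA (by simp) k
      filter_upwards [h1] with ω hω
      rw [← Finset.sum_sub_distrib, mul_assoc, Finset.sum_mul]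
      refine (Finset.abs_sum_le_sum_abs _ _).trans (Finset.sum_le_sum fun k _ => ?_)
      rw [hω k, sub_sub_cancel, ← Complex.sub_re]
      refine (Complex.abs_re_le_norm _).trans ?_
      rw [mul_add, sub_add_cancel_right, norm_neg, norm_mul, norm_mul, Complex.norm_real,
        Real.norm_eq_abs, abs_of_pos (Real.exp_pos _)]
      gcongr
      · exact hα k
      · exact norm_coef_le _ _)
  rw [tendstoInMeasure_iff_dist] at h0 ⊢
  intro ε hε
  refine (h0 ε hε).congr fun n => ?_
  simp only [Real.dist_eq, sub_zero]

/-- The scale of the convolution is bounded uniformly in its length by the first entry of the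
minimum. There `ν^H` cancels against `(να_k)^{-H}`, leaving `4 · 2` times `α_k^{-H}`. -/
lemma subGauss_sum_coef (hA : StandingAssumption ν H α lam β P)
    (hψ : IsErgodicMildSolution ν H α lam β P ψ) (F : Finset Mode) (c : Mode → ℂ) (t : ℝ) :
    SubGauss (fun ω => ∑ k ∈ F, (c k * coef (ψ t ω) k).re)
      (8 * modeScale H α lam F c fun _ => 1) P := by
  refine SubGauss.of_tendstoInMeasure (fun n => (subGauss_sum_convCoef hA F c (by simp)).mono ?_)
    (tendstoInMeasure_coef_sub_convCoef hA hψ F c t)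
  have hν := hA.nu_pos
  have h := sqrt_sum_sq_le_mul (subset_refl F) (C := 2)
    (x := fun k => ‖c k‖ * (√(lam k) * ν ^ H) * convScale H (ν * α k) (t - (t - n)))
    (y := fun k => ‖c k‖ * 1 * (√(lam k) * α k ^ (-H))) zero_le_two
    (fun k => by
      have := convScale_nonneg (H := H) (mul_pos hν (hA.alpha_pos k))
        (show (0 : ℝ) ≤ t - (t - n) by simp)
      positivity)
    (fun k => by
      have hαk := hA.alpha_pos k
      calc _ ≤ ‖c k‖ * (√(lam k) * ν ^ H) * (2 * (ν * α k) ^ (-H)) :=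
            mul_le_mul_of_nonneg_left (min_le_left _ _) (by positivity)
        _ = 2 * (‖c k‖ * 1 * (√(lam k) * α k ^ (-H))) * (ν ^ H * ν ^ (-H)) := by
            rw [Real.mul_rpow hν.le hαk.le]; ring
        _ = _ := by rw [← Real.rpow_add hν]; simp)
  rw [modeScale]
  linarith

lemma one_sub_exp_neg_le_rpow {x g : ℝ} (hx : 0 ≤ x) (hg : 0 ≤ g) (hg1 : g ≤ 1) :
    1 - Real.exp (-x) ≤ x ^ g := by
  rcases le_total x 1 with h | h
  · calc 1 - Real.exp (-x) ≤ x := by linarith [Real.one_sub_le_exp_neg x]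
      _ = x ^ (1 : ℝ) := (Real.rpow_one x).symm
      _ ≤ x ^ g := Real.rpow_le_rpow_of_exponent_ge_of_imp hx h hg1 (by intros; linarith)
  · exact (sub_le_self _ (Real.exp_pos _).le).trans (Real.one_le_rpow h hg)

/-- Interpolates between the two entries of the minimum, according to whether `a h` is below or
above `1`. -/
lemma convScale_le {H a h g : ℝ} (ha : 0 < a) (hh : 0 ≤ h) (hg : 0 < g) (hgH : g ≤ H) :
    convScale H a h ≤ 2 * a ^ (-H) * (a * h) ^ g := by
  have hah : 0 ≤ a * h := by positivity
  rcases le_total (a * h) 1 with h1 | h1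
  · have e : h ^ H = a ^ (-H) * (a * h) ^ H := by
      rw [Real.mul_rpow ha.le hh, ← mul_assoc, ← Real.rpow_add ha]; simp
    calc convScale H a h ≤ h ^ H := min_le_right _ _
      _ = a ^ (-H) * (a * h) ^ H := e
      _ ≤ a ^ (-H) * (a * h) ^ g := by
          gcongr ?_ * ?_
          exact Real.rpow_le_rpow_of_exponent_ge_of_imp hah h1 hgH (by intros; linarith)
      _ ≤ _ := by
          have : 0 ≤ a ^ (-H) * (a * h) ^ g := by positivity
          linarith
  · exact (min_le_left _ _).trans (le_mul_of_one_le_right (by positivity)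
      (Real.one_le_rpow h1 hg.le))

/-- The increment is `(exp(-(t-s)να_k) - 1) ψ_k(s)` plus the convolution over `[s, t]`. Both gain
the factor `(να_k(t-s))^g`, and the constants combine as `8 + 4 · 2`. -/
lemma subGauss_sum_coef_increment_of_le (hA : StandingAssumption ν H α lam β P)
    (hψ : IsErgodicMildSolution ν H α lam β P ψ) (F : Finset Mode) (c : Mode → ℂ) {s t : ℝ}
    (hst : s ≤ t) {g : ℝ} (hg : 0 < g) (hgH : g ≤ H) :
    SubGauss (fun ω => ∑ k ∈ F, (c k * (coef (ψ t ω) k - coef (ψ s ω) k)).re)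
      (16 * modeScale H α lam F c fun k => (ν * α k * (t - s)) ^ g) P := by
  have hν := hA.nu_pos
  have hts := sub_nonneg.2 hst
  have h1 := subGauss_sum_coef hA hψ F
    (fun k => c k * ((Real.exp (-((t - s) * (ν * α k))) - 1 : ℝ) : ℂ)) s
  have h2 := subGauss_sum_convCoef hA F c hst
  refine ((h1.add h2).congr ?_).mono ?_
  · have h3 : ∀ᵐ ω ∂P, ∀ k, coef (ψ t ω) k =
        Real.exp (-((t - s) * (ν * α k))) * coef (ψ s ω) k + convCoef ν H α lam β s t k ω :=
      ae_all_iff.2 fun k => hψ.mildSolution.coef_eq hA hst k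
    filter_upwards [h3] with ω hω
    rw [← Finset.sum_add_distrib]
    refine Finset.sum_congr rfl fun k _ => ?_
    rw [hω k, ← Complex.add_re]
    congr 1
    push_cast
    ring
  · set R := modeScale H α lam F c fun k => (ν * α k * (t - s)) ^ g with hR
    have e1 : modeScale H α lam F
        (fun k => c k * ((Real.exp (-((t - s) * (ν * α k))) - 1 : ℝ) : ℂ)) (fun _ => 1) ≤ R := by
      rw [hR, modeScale, modeScale, ← one_mul √(∑ k ∈ F, (‖c k‖ * (ν * α k * (t - s)) ^ g *
        (√(lam k) * α k ^ (-H))) ^ 2)]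
      refine sqrt_sum_sq_le_mul (subset_refl F) zero_le_one (fun k => ?_) fun k => ?_
      · have := hA.alpha_pos k
        positivity
      · have := hA.alpha_pos k
        rw [norm_mul, mul_one, one_mul, Complex.norm_real, Real.norm_eq_abs]
        refine mul_le_mul_of_nonneg_right (mul_le_mul_of_nonneg_left ?_ (norm_nonneg _))
          (by positivity)
        rw [abs_sub_comm, mul_comm (t - s), abs_of_nonneg]
        · exact one_sub_exp_neg_le_rpow (by positivity) hg.le (hgH.trans hA.hurst.2.le)
        · rw [sub_nonneg, Real.exp_le_one_iff, neg_nonpos]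
          positivity
    have e2 : √(∑ k ∈ F, (‖c k‖ * (√(lam k) * ν ^ H) * convScale H (ν * α k) (t - s)) ^ 2) ≤
        2 * R := by
      refine sqrt_sum_sq_le_mul (subset_refl F) zero_le_two (fun k => ?_) fun k => ?_
      · have := convScale_nonneg (H := H) (mul_pos hν (hA.alpha_pos k)) hts
        positivity
      · have hαk := hA.alpha_pos k
        calc _ ≤ ‖c k‖ * (√(lam k) * ν ^ H) *
              (2 * (ν * α k) ^ (-H) * (ν * α k * (t - s)) ^ g) :=
              mul_le_mul_of_nonneg_left (convScale_le (by positivity) hts hg hgH) (by positivity)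
          _ = 2 * (‖c k‖ * (ν * α k * (t - s)) ^ g * (√(lam k) * α k ^ (-H))) *
              (ν ^ H * ν ^ (-H)) := by rw [Real.mul_rpow hν.le hαk.le]; ring
          _ = _ := by rw [← Real.rpow_add hν]; simp
    linarith

lemma subGauss_sum_coef_increment (hA : StandingAssumption ν H α lam β P)
    (hψ : IsErgodicMildSolution ν H α lam β P ψ) (F : Finset Mode) (c : Mode → ℂ) (s t : ℝ)
    {g : ℝ} (hg : 0 < g) (hgH : g ≤ H) :
    SubGauss (fun ω => ∑ k ∈ F, (c k * (coef (ψ t ω) k - coef (ψ s ω) k)).re)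
      (16 * modeScale H α lam F c fun k => (ν * α k * |t - s|) ^ g) P := by
  rcases le_total s t with h | h
  · rw [abs_of_nonneg (sub_nonneg.2 h)]
    exact subGauss_sum_coef_increment_of_le hA hψ F c h hg hgH
  · rw [abs_sub_comm, abs_of_nonneg (sub_nonneg.2 h)]
    refine (subGauss_sum_coef_increment_of_le hA hψ F c h hg hgH).neg.congr (ae_of_all _ fun ω => ?_)
    dsimp only
    rw [← Finset.sum_neg_distrib]
    refine Finset.sum_congr rfl fun k _ => ?_
    rw [← Complex.neg_re]
    congr 1
    ring

/-- Almost surely, the Fourier coefficients are those of a real-valued function. -/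
lemma coef_neg (hA : StandingAssumption ν H α lam β P)
    (hψ : IsErgodicMildSolution ν H α lam β P ψ) (t : ℝ) (k : Mode) :
    ∀ᵐ ω ∂P, coef (ψ t ω) (-k) = starRingEnd ℂ (coef (ψ t ω) k) := by
  obtain ⟨a, ha, hα⟩ := hA.alpha_lower
  have hν := hA.nu_pos
  have hconv : ∀ n : ℕ, ∀ᵐ ω ∂P, convCoef ν H α lam β (t - n) t (-k) ω =
      starRingEnd ℂ (convCoef ν H α lam β (t - n) t k ω) := by
    intro n
    have hle : t - n ≤ t := by simp
    have hc : ∀ᵐ ω ∂P, ∀ N i : ℕ, β (-k) (unifPt (t - n) t N i) ω =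
        starRingEnd ℂ (β k (unifPt (t - n) t N i) ω) :=
      ae_all_iff.2 fun N => ae_all_iff.2 fun i => hA.noise.conj k _
    filter_upwards [hc, ae_tendsto_convSum (ν := ν) (α := α) (lam := lam) hA.noise hle k,
      ae_tendsto_convSum (ν := ν) (α := α) (lam := lam) hA.noise hle (-k)] with ω h1 h2 h3
    refine tendsto_nhds_unique h3 ?_
    refine ((Complex.continuous_conj.tendsto _).comp h2).congr fun N => ?_
    simp only [Function.comp_apply, convSum, leftSum, map_mul, map_sum, map_sub, h1,
      Complex.conj_ofReal, hA.lam_symm, hA.alpha_symm]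
  have hlim : Tendsto (fun n : ℕ => 2 * Real.exp (-(n * (ν * a)))) atTop (𝓝 0) := by
    simpa using (tendsto_exp_neg_nat_mul (mul_pos hν ha)).const_mul 2
  -- The noise terms are conjugate, so the defect at time `t` is the defect at `t - n` damped
  -- exponentially. As it does not depend on `n`, it vanishes.
  have h0 := hψ.stationary.tendstoInMeasure hψ.mildSolution.measurable_eval
    (t := fun n => t - n) hlim (D := fun _ ω =>
      ‖coef (ψ t ω) (-k) - starRingEnd ℂ (coef (ψ t ω) k)‖) (fun n => by
      filter_upwards [hconv n, hψ.mildSolution.coef_eq hA (show t - n ≤ t by simp) k,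
        hψ.mildSolution.coef_eq hA (show t - n ≤ t by simp) (-k)] with ω h1 h2 h3
      rw [h2, h3, h1, hA.alpha_symm, abs_of_nonneg (norm_nonneg _), sub_sub_cancel, map_add,
        map_mul, Complex.conj_ofReal, add_sub_add_right_eq_sub, ← mul_sub, norm_mul,
        Complex.norm_real, Real.norm_eq_abs, abs_of_pos (Real.exp_pos _), mul_comm 2, mul_assoc]
      gcongr
      · exact hα k
      · refine (norm_sub_le _ _).trans ?_
        rw [RCLike.norm_conj, two_mul]
        exact add_le_add (norm_coef_le _ _) (norm_coef_le _ _))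
  obtain ⟨ns, -, hns⟩ := h0.exists_seq_tendsto_ae
  filter_upwards [hns] with ω hω
  exact sub_eq_zero.1 (norm_eq_zero.1 (tendsto_nhds_unique tendsto_const_nhds hω))

end Bounds

/-! ### Real trigonometric polynomials -/

section Trig

/-- The real trigonometric polynomial `Re ∑_{k ∈ F} c_k e_k`. -/
def realTrig (F : Finset Mode) (c : Mode → ℂ) : C(Torus, ℝ) where
  toFun x := ∑ k ∈ F, (c k * UnitAddTorus.mFourier k.1 x).re
  continuous_toFun := by fun_prop

lemma realTrig_apply (F : Finset Mode) (c : Mode → ℂ) (x : Torus) :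
    realTrig F c x = ∑ k ∈ F, (c k * UnitAddTorus.mFourier k.1 x).re := rfl

/-- Complex trigonometric polynomials of degree at most `N` in each variable. -/
def trigPoly (N : ℕ) : Submodule ℂ C(Torus, ℂ) :=
  Submodule.span ℂ (UnitAddTorus.mFourier '' {n | ∀ i, |n i| ≤ N})

lemma mFourier_mem_trigPoly {N : ℕ} {n : Fin 2 → ℤ} (hn : ∀ i, |n i| ≤ N) :
    UnitAddTorus.mFourier n ∈ trigPoly N := Submodule.subset_span ⟨n, hn, rfl⟩

lemma mul_mem_trigPoly {M N : ℕ} {f g : C(Torus, ℂ)} (hf : f ∈ trigPoly M) (hg : g ∈ trigPoly N) :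
    f * g ∈ trigPoly (M + N) := by
  have h := Submodule.mul_mem_mul hf hg
  rw [trigPoly, trigPoly, Submodule.span_mul_span] at h
  refine Submodule.span_mono ?_ h
  rintro _ ⟨_, ⟨p, hp, rfl⟩, _, ⟨q, hq, rfl⟩, rfl⟩
  refine ⟨p + q, fun i => ?_, by ext x; exact UnitAddTorus.mFourier_add⟩
  push_cast
  exact (abs_add_le _ _).trans (add_le_add (hp i) (hq i))

lemma pow_mem_trigPoly {N : ℕ} {f : C(Torus, ℂ)} (hf : f ∈ trigPoly N) (q : ℕ) :
    f ^ q ∈ trigPoly (q * N) := by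
  induction q with
  | zero =>
    rw [pow_zero, ← UnitAddTorus.mFourier_zero]
    exact mFourier_mem_trigPoly (by simp)
  | succ q ih =>
    rw [pow_succ, Nat.succ_mul]
    exact mul_mem_trigPoly ih hf

/-- The square of side `2N + 1` in the lattice. -/
def latticeBox (N : ℕ) : Finset (Fin 2 → ℤ) := Fintype.piFinset fun _ => Finset.Icc (-(N : ℤ)) N

lemma mem_latticeBox {N : ℕ} {n : Fin 2 → ℤ} : n ∈ latticeBox N ↔ ∀ i, |n i| ≤ N := by
  simp [latticeBox, abs_le]

lemma card_latticeBox (N : ℕ) : (latticeBox N).card = (2 * N + 1) ^ 2 := by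
  simp only [latticeBox, Fintype.card_piFinset, Int.card_Icc, Finset.prod_const, Finset.card_univ,
    Fintype.card_fin]
  congr 1
  omega

/-- The Fourier coefficient of a continuous function. -/
def fourierFunctional (n : Fin 2 → ℤ) : C(Torus, ℂ) →L[ℂ] ℂ :=
  (innerSL ℂ (ContinuousMap.toLp (E := ℂ) 2 torusMeasure ℂ (UnitAddTorus.mFourier n))).comp
    (ContinuousMap.toLp (E := ℂ) 2 torusMeasure ℂ)

lemma fourierFunctional_apply (n : Fin 2 → ℤ) (f : C(Torus, ℂ)) :
    fourierFunctional n f =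
      ∫ x, starRingEnd ℂ (UnitAddTorus.mFourier n x) * f x ∂torusMeasure := by
  refine (inner_toLp_mFourier n (ContinuousMap.toLp (E := ℂ) 2 torusMeasure ℂ f)).trans ?_
  refine integral_congr_ae ?_
  filter_upwards [ContinuousMap.coeFn_toLp (E := ℂ) (𝕜 := ℂ) (p := 2) torusMeasure f] with x hx
  rw [hx]

lemma fourierFunctional_mFourier (n m : Fin 2 → ℤ) :
    fourierFunctional n (UnitAddTorus.mFourier m) = if n = m then 1 else 0 :=
  orthonormal_iff_ite.1 (UnitAddTorus.orthonormal_mFourier (d := Fin 2)) n m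

lemma norm_mFourier_apply (n : Fin 2 → ℤ) (x : Torus) : ‖UnitAddTorus.mFourier n x‖ = 1 := by
  simp only [UnitAddTorus.mFourier, ContinuousMap.coe_mk, fourier_apply, norm_prod,
    Circle.norm_coe, Finset.prod_const_one]

lemma norm_fourierFunctional_le (n : Fin 2 → ℤ) (f : C(Torus, ℂ)) :
    ‖fourierFunctional n f‖ ≤ ∫ x, ‖f x‖ ∂torusMeasure := by
  rw [fourierFunctional_apply]
  refine (norm_integral_le_integral_norm _).trans (le_of_eq ?_)
  simp only [norm_mul, RCLike.norm_conj, norm_mFourier_apply, one_mul]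

lemma eq_sum_of_mem_trigPoly {N : ℕ} {f : C(Torus, ℂ)} (hf : f ∈ trigPoly N) (x : Torus) :
    f x = ∑ n ∈ latticeBox N, fourierFunctional n f * UnitAddTorus.mFourier n x := by
  induction hf using Submodule.span_induction with
  | mem f h =>
    obtain ⟨m, hm, rfl⟩ := h
    simp only [fourierFunctional_mFourier, ite_mul, one_mul, zero_mul]
    rw [Finset.sum_ite_eq', if_pos (mem_latticeBox.2 hm)]
  | zero => simp
  | add f g _ _ hf hg =>
    simp only [map_add, add_mul, Finset.sum_add_distrib, ContinuousMap.add_apply]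
    rw [← hf, ← hg]
  | smul a f _ hf =>
    simp only [map_smul, smul_eq_mul, mul_assoc, ← Finset.mul_sum, ContinuousMap.smul_apply]
    rw [← hf]

/-- Each Fourier coefficient is at most the `L¹` norm, and there are `(2N + 1)²` of them. -/
lemma norm_le_of_mem_trigPoly {N : ℕ} {f : C(Torus, ℂ)} (hf : f ∈ trigPoly N) (x : Torus) :
    ‖f x‖ ≤ (2 * N + 1) ^ 2 * ∫ y, ‖f y‖ ∂torusMeasure := by
  rw [eq_sum_of_mem_trigPoly hf x]
  calc _ ≤ ∑ n ∈ latticeBox N, ‖fourierFunctional n f * UnitAddTorus.mFourier n x‖ :=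
        norm_sum_le _ _
    _ ≤ ∑ n ∈ latticeBox N, ∫ y, ‖f y‖ ∂torusMeasure := Finset.sum_le_sum fun n _ => by
        rw [norm_mul, norm_mFourier_apply, mul_one]
        exact norm_fourierFunctional_le n f
    _ = _ := by rw [Finset.sum_const, card_latticeBox, nsmul_eq_mul]; push_cast; ring

/-- The complexification of a real-valued continuous function. -/
def complexify (u : C(Torus, ℝ)) : C(Torus, ℂ) := ⟨fun x => (u x : ℂ), by fun_prop⟩

/-- A Bernstein inequality: the supremum of a trigonometric polynomial is controlled by its
`L^q` norm. -/
lemma enorm_pow_le_lintegral {N : ℕ} {u : C(Torus, ℝ)} (hu : complexify u ∈ trigPoly N) {q : ℕ}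
    (hq : q ≠ 0) :
    ‖u‖ₑ ^ q ≤ ((2 * (q * N) + 1) ^ 2 : ℕ) * ∫⁻ x, ‖u x‖ₑ ^ q ∂torusMeasure := by
  have h1 : ∀ x, |u x| ^ q ≤ (2 * ((q * N : ℕ) : ℝ) + 1) ^ 2 * ∫ y, |u y| ^ q ∂torusMeasure := by
    intro x
    -- `u^q` is again a trigonometric polynomial, of degree `qN`, so the `L¹` bound for it is an
    -- `L^q` bound for `u`.
    have := norm_le_of_mem_trigPoly (pow_mem_trigPoly hu q) x
    simpa [complexify] using this
  set I := ∫ y, |u y| ^ q ∂torusMeasure with hI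
  have hI0 : 0 ≤ I := integral_nonneg fun y => by positivity
  have h2 : ‖u‖ ^ q ≤ (2 * ((q * N : ℕ) : ℝ) + 1) ^ 2 * I := by
    have h3 : ‖u‖ ≤ ((2 * ((q * N : ℕ) : ℝ) + 1) ^ 2 * I) ^ ((q : ℝ)⁻¹) := by
      refine (ContinuousMap.norm_le _ (by positivity)).2 fun x => ?_
      rw [Real.le_rpow_inv_iff_of_pos (norm_nonneg _) (by positivity) (by positivity),
        Real.rpow_natCast]
      exact h1 x
    rwa [Real.le_rpow_inv_iff_of_pos (norm_nonneg _) (by positivity) (by positivity),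
        Real.rpow_natCast] at h3
  have hint : Integrable (fun y => |u y| ^ q) torusMeasure :=
    (by fun_prop : Continuous fun y => |u y| ^ q).integrable_of_hasCompactSupport
      (HasCompactSupport.of_compactSpace _)
  have h4 : ∫⁻ x, ‖u x‖ₑ ^ q ∂torusMeasure = ENNReal.ofReal I := by
    rw [hI, ofReal_integral_eq_lintegral_ofReal hint (ae_of_all _ fun y => by
      simp only [Pi.zero_apply]; positivity)]
    refine lintegral_congr fun x => ?_
    rw [Real.enorm_eq_ofReal_abs, ENNReal.ofReal_pow (abs_nonneg _)]
  rw [h4, ← ofReal_norm, ← ENNReal.ofReal_pow (norm_nonneg _), ← ENNReal.ofReal_natCast,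
    ← ENNReal.ofReal_mul (by positivity)]
  refine ENNReal.ofReal_le_ofReal (h2.trans_eq ?_)
  push_cast
  rfl

lemma complexify_realTrig (F : Finset Mode) (c : Mode → ℂ) :
    complexify (realTrig F c) = ∑ k ∈ F, ((c k / 2) • UnitAddTorus.mFourier k.1 +
      (starRingEnd ℂ (c k) / 2) • UnitAddTorus.mFourier (-k.1)) := by
  ext x
  simp only [complexify, realTrig, ContinuousMap.coe_mk, ContinuousMap.coe_sum, Finset.sum_apply,
    ContinuousMap.add_apply, ContinuousMap.smul_apply, UnitAddTorus.mFourier_neg, smul_eq_mul]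
  push_cast
  refine Finset.sum_congr rfl fun k _ => ?_
  rw [Complex.re_eq_add_conj, map_mul]
  ring

lemma complexify_realTrig_mem {N : ℕ} {F : Finset Mode} (hF : ∀ k ∈ F, ∀ i, |k.1 i| ≤ N)
    (c : Mode → ℂ) : complexify (realTrig F c) ∈ trigPoly N := by
  rw [complexify_realTrig]
  refine Submodule.sum_mem _ fun k hk => Submodule.add_mem _
    (Submodule.smul_mem _ _ (mFourier_mem_trigPoly (hF k hk)))
    (Submodule.smul_mem _ _ (mFourier_mem_trigPoly fun i => ?_))
  rw [Pi.neg_apply, abs_neg]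
  exact hF k hk i

lemma mFourier_proj (n : Fin 2 → ℤ) (y : Fin 2 → ℝ) :
    UnitAddTorus.mFourier n (proj y) =
      Complex.exp (2 * Real.pi * Complex.I * (n 0 * y 0 + n 1 * y 1)) := by
  simp only [UnitAddTorus.mFourier, proj, ContinuousMap.coe_mk, Fin.prod_univ_two,
    fourier_coe_apply]
  rw [← Complex.exp_add]
  congr 1
  push_cast
  ring

/-- The factor `i k_j` by which `∂_j` acts on `e_k`. -/
def derivCoef (i : Fin 2) (k : Mode) : ℂ := 2 * Real.pi * Complex.I * k.1 i

lemma hasFDerivAt_realTrig (F : Finset Mode) (c : Mode → ℂ) (y : Fin 2 → ℝ) :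
    HasFDerivAt (fun y => realTrig F c (proj y))
      (realTrig F (fun k => derivCoef 0 k * c k) (proj y) •
          ContinuousLinearMap.proj (R := ℝ) (φ := fun _ : Fin 2 => ℝ) 0 +
        realTrig F (fun k => derivCoef 1 k * c k) (proj y) •
          ContinuousLinearMap.proj (R := ℝ) (φ := fun _ : Fin 2 => ℝ) 1) y := by
  have hp : ∀ i : Fin 2, HasFDerivAt (fun y : Fin 2 → ℝ => ((y i : ℝ) : ℂ))
      (Complex.ofRealCLM.comp (ContinuousLinearMap.proj (R := ℝ) (φ := fun _ : Fin 2 => ℝ) i)) y :=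
    fun i => (Complex.ofRealCLM.comp
      (ContinuousLinearMap.proj (R := ℝ) (φ := fun _ : Fin 2 => ℝ) i)).hasFDerivAt
  have h := HasFDerivAt.fun_sum (u := F) (x := y) fun k _ =>
    Complex.reCLM.hasFDerivAt.comp y ((((((hp 0).const_mul (k.1 0 : ℂ)).add
      ((hp 1).const_mul (k.1 1 : ℂ))).const_mul (2 * Real.pi * Complex.I)).cexp).const_mul (c k))
  have e : (fun y => realTrig F c (proj y)) = fun y => ∑ k ∈ F, (Complex.reCLM ∘ fun y : Fin 2 → ℝ =>
      c k * Complex.exp (2 * Real.pi * Complex.I * (k.1 0 * y 0 + k.1 1 * y 1))) y := by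
    ext y
    simp only [realTrig_apply, mFourier_proj, Function.comp_apply, Complex.reCLM_apply]
  rw [e]
  refine h.congr_fderiv ?_
  ext v
  simp only [realTrig_apply, mFourier_proj, derivCoef, sum_apply,
    ContinuousLinearMap.comp_apply, smul_apply, add_apply,
    Complex.reCLM_apply, Complex.ofRealCLM_apply, ContinuousLinearMap.proj_apply, smul_eq_mul,
    Finset.sum_mul, ← Finset.sum_add_distrib]
  refine Finset.sum_congr rfl fun k _ => ?_
  rw [← Complex.re_mul_ofReal, ← Complex.re_mul_ofReal, ← Complex.add_re]
  congr 1
  simp only [Pi.add_apply]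
  ring

/-- The factor by which `∂_1^a ∂_2^b` acts on `e_k`. -/
def multiCoef (a b : ℕ) (k : Mode) : ℂ := derivCoef 0 k ^ a * derivCoef 1 k ^ b

/-- Induction on the order: a uniform limit whose gradients converge uniformly is differentiable,
with the limiting gradient. The induction hypothesis is applied to the coefficients multiplied by
`derivCoef`, which are those of the two partial derivatives. -/
lemma contDiff_of_tendsto_realTrig (m : ℕ) {F : ℕ → Finset Mode} {c : ℕ → Mode → ℂ}
    {G : ℕ → ℕ → C(Torus, ℝ)}
    (h : ∀ a b, a + b ≤ m → Tendsto (fun j => realTrig (F j) fun k => multiCoef a b k * c j k)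
      atTop (𝓝 (G a b))) :
    ContDiff ℝ m (fun y => G 0 0 (proj y)) ∧
      ∀ a b, a + b ≤ m → multiDeriv (a, b) (G 0 0) = G a b := by
  induction m generalizing c G with
  | zero =>
    refine ⟨?_, fun a b hab => ?_⟩
    · rw [Nat.cast_zero, contDiff_zero]
      exact (G 0 0).continuous.comp proj_isOpenQuotientMap.continuous
    · obtain ⟨rfl, rfl⟩ : a = 0 ∧ b = 0 := by omega
      rfl
  | succ m ih =>
    have h0 := ih (c := fun j k => derivCoef 0 k * c j k) (G := fun a b => G (a + 1) b)
      fun a b hab => by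
        convert h (a + 1) b (by omega) using 4
        simp only [multiCoef]; ring
    have h1 := ih (c := fun j k => derivCoef 1 k * c j k) (G := fun a b => G a (b + 1))
      fun a b hab => by
        convert h a (b + 1) (by omega) using 4
        simp only [multiCoef]; ring
    have t0 := h 0 0 (by omega)
    have t1 := h 1 0 (by omega)
    have t2 := h 0 1 (by omega)
    simp only [multiCoef, pow_zero, pow_one, one_mul, mul_one] at t0 t1 t2
    have hd : ∀ y, HasFDerivAt (fun y => G 0 0 (proj y))
        (G 1 0 (proj y) • ContinuousLinearMap.proj (R := ℝ) (φ := fun _ : Fin 2 => ℝ) 0 +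
          G 0 1 (proj y) • ContinuousLinearMap.proj (R := ℝ) (φ := fun _ : Fin 2 => ℝ) 1) y := by
      refine hasFDerivAt_of_tendstoUniformly (l := atTop) ?_ (fun j y =>
        hasFDerivAt_realTrig (F j) (c j) y) fun y => ?_
      · rw [ContinuousMap.tendsto_iff_tendstoUniformly] at t1 t2
        have key : ∀ (i : Fin 2) (f : ℕ → Torus → ℝ) (g : Torus → ℝ), TendstoUniformly f g atTop →
            TendstoUniformly (fun j y => f j (proj y) •
              ContinuousLinearMap.proj (R := ℝ) (φ := fun _ : Fin 2 => ℝ) i)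
              (fun y => g (proj y) • ContinuousLinearMap.proj (R := ℝ) (φ := fun _ : Fin 2 => ℝ) i)
              atTop := fun i f g hfg =>
          ((ContinuousLinearMap.toSpanSingleton ℝ (ContinuousLinearMap.proj (R := ℝ)
            (φ := fun _ : Fin 2 => ℝ) i)).uniformContinuous.comp_tendstoUniformly
            (hfg.comp proj))
        exact (key 0 _ _ t1).add (key 1 _ _ t2)
      · exact (continuous_eval_const (F := C(Torus, ℝ)) (proj y)).continuousAt.tendsto.comp t0
    have hdiff : Differentiable ℝ fun y => G 0 0 (proj y) := fun y => (hd y).differentiableAt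
    have hp : ∀ i, partialDeriv i (G 0 0) = if i = 0 then G 1 0 else G 0 1 := by
      intro i
      ext x
      obtain ⟨y, rfl⟩ := proj_isOpenQuotientMap.surjective x
      rw [partialDeriv_proj i hdiff, (hd y).fderiv]
      fin_cases i <;> simp
    refine ⟨?_, fun a b hab => ?_⟩
    · push_cast
      rw [contDiff_succ_iff_hasFDerivAt]
      refine ⟨_, ?_, hd⟩
      exact (h0.1.smul contDiff_const).add (h1.1.smul contDiff_const)
    -- In `multiDeriv` the derivative in direction `1` acts first, so it is peeled off first
    -- whenever it occurs.
    · match a, b with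
      | 0, 0 => rfl
      | a + 1, 0 =>
        have := h0.2 a 0 (by omega)
        simp only [multiDeriv, Function.iterate_zero, id_eq, Function.iterate_succ_apply,
          hp, if_true] at this ⊢
        exact this
      | a, b + 1 =>
        have := h1.2 a b (by omega)
        simp only [multiDeriv, Function.iterate_succ_apply, hp] at this ⊢
        simpa using this

/-- The space of jets of order `m`. -/
abbrev Jets (m : ℕ) : Type := MultiIdx m → C(Torus, ℝ)

/-- All derivatives of order at most `m` of `realTrig F c`. -/
def trigJet (m : ℕ) (F : Finset Mode) (c : Mode → ℂ) : Jets m :=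
  fun δ => realTrig F fun k => multiCoef δ.1.1 δ.1.2 k * c k

/-- This replaces completeness of `C^m`: a limit of jets of trigonometric polynomials is a jet. The
value `0` given to `G` beyond order `m` is never used. -/
lemma exists_jet_eq_of_tendsto {m : ℕ} {F : ℕ → Finset Mode} {c : ℕ → Mode → ℂ} {y : Jets m}
    (h : Tendsto (fun j => trigJet m (F j) (c j)) atTop (𝓝 y)) :
    ∃ f : CmTorus m, CmTorus.jet m f = y := by
  have hlt : ∀ {a b : ℕ}, a + b ≤ m → a < m + 1 ∧ b < m + 1 := fun h => by omega
  set G : ℕ → ℕ → C(Torus, ℝ) := fun a b =>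
    if hab : a + b ≤ m then y ⟨(⟨a, (hlt hab).1⟩, ⟨b, (hlt hab).2⟩), hab⟩ else 0 with hG
  obtain ⟨h1, h2⟩ := contDiff_of_tendsto_realTrig m (F := F) (c := c) (G := G) fun a b hab => by
    simp only [hG, dif_pos hab]
    exact tendsto_pi_nhds.1 h ⟨(⟨a, (hlt hab).1⟩, ⟨b, (hlt hab).2⟩), hab⟩
  refine ⟨⟨G 0 0, h1⟩, ?_⟩
  ext δ x
  have h3 := h2 δ.1.1 δ.1.2 δ.2
  have h4 : G δ.1.1 δ.1.2 = y δ := by simp only [hG]; rw [dif_pos δ.2]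
  rw [← h4]
  exact congrFun h3 x

lemma continuous_realTrig (F : Finset Mode) : Continuous fun c => realTrig F c := by
  set U : Mode → C(Torus, ℝ) := fun k => ⟨fun x => (UnitAddTorus.mFourier k.1 x).re, by fun_prop⟩
  set W : Mode → C(Torus, ℝ) := fun k => ⟨fun x => (UnitAddTorus.mFourier k.1 x).im, by fun_prop⟩
  have h : (fun c => realTrig F c) = fun c => ∑ k ∈ F, ((c k).re • U k - (c k).im • W k) := by
    ext c x
    simp only [realTrig_apply, ContinuousMap.coe_sum, Finset.sum_apply, ContinuousMap.sub_apply,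
      ContinuousMap.smul_apply, smul_eq_mul, Complex.mul_re]
    rfl
  rw [h]
  fun_prop

lemma continuous_trigJet (m : ℕ) (F : Finset Mode) : Continuous fun c => trigJet m F c :=
  continuous_pi fun δ => (continuous_realTrig F).comp (by fun_prop)

lemma realTrig_sub (F : Finset Mode) (c d : Mode → ℂ) :
    realTrig F (fun k => c k - d k) = realTrig F c - realTrig F d := by
  ext x
  simp [realTrig_apply, sub_mul, Finset.sum_sub_distrib]

lemma realTrig_sum {ι : Type*} (I : Finset ι) (w : ι → ℝ) (F : Finset Mode) (c : ι → Mode → ℂ) :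
    realTrig F (fun k => ∑ i ∈ I, (w i : ℂ) * c i k) = ∑ i ∈ I, w i • realTrig F (c i) := by
  ext x
  simp only [realTrig_apply, ContinuousMap.coe_sum, Finset.sum_apply, ContinuousMap.smul_apply,
    smul_eq_mul, Finset.mul_sum, Finset.sum_mul, Complex.re_sum]
  rw [Finset.sum_comm]
  refine Finset.sum_congr rfl fun i _ => Finset.sum_congr rfl fun k _ => ?_
  rw [mul_assoc, Complex.re_ofReal_mul]

lemma trigJet_sub (m : ℕ) (F : Finset Mode) (c d : Mode → ℂ) :
    trigJet m F (fun k => c k - d k) = trigJet m F c - trigJet m F d := by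
  ext1 δ
  simp only [trigJet, mul_sub, realTrig_sub, Pi.sub_apply]

lemma trigJet_sum {ι : Type*} (m : ℕ) (I : Finset ι) (w : ι → ℝ) (F : Finset Mode)
    (c : ι → Mode → ℂ) :
    trigJet m F (fun k => ∑ i ∈ I, (w i : ℂ) * c i k) = ∑ i ∈ I, w i • trigJet m F (c i) := by
  ext1 δ
  simp only [trigJet, Finset.sum_apply, Pi.smul_apply]
  rw [← realTrig_sum]
  congr 1
  ext k
  rw [Finset.mul_sum]
  exact Finset.sum_congr rfl fun i _ => by ring

lemma enorm_trigJet_pow_le (m : ℕ) {N : ℕ} {F : Finset Mode}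
    (hF : ∀ k ∈ F, ∀ i, |k.1 i| ≤ N) (c : Mode → ℂ) {q : ℕ} (hq : q ≠ 0) :
    ‖trigJet m F c‖ₑ ^ q ≤ ((2 * (q * N) + 1) ^ 2 : ℕ) *
      ∑ δ : MultiIdx m, ∫⁻ x, ‖trigJet m F c δ x‖ₑ ^ q ∂torusMeasure := by
  have h : ∃ δ : MultiIdx m, ‖trigJet m F c‖ = ‖trigJet m F c δ‖ := by
    obtain ⟨δ, -, hδ⟩ := Finset.exists_mem_eq_sup' (s := (Finset.univ : Finset (MultiIdx m)))
      ⟨⟨(0, 0), by simp⟩, Finset.mem_univ _⟩ fun δ => ‖trigJet m F c δ‖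
    refine ⟨δ, le_antisymm ?_ (norm_le_pi_norm _ _)⟩
    rw [← hδ]
    refine (pi_norm_le_iff_of_nonneg ?_).2 fun δ' => Finset.le_sup' (fun δ => ‖trigJet m F c δ‖)
      (Finset.mem_univ δ')
    rw [hδ]
    exact norm_nonneg _
  obtain ⟨δ, hδ⟩ := h
  have : ‖trigJet m F c‖ₑ = ‖trigJet m F c δ‖ₑ := by
    rw [← ofReal_norm, ← ofReal_norm, hδ]
  rw [this]
  refine (enorm_pow_le_lintegral (complexify_realTrig_mem hF _) hq).trans ?_
  gcongr
  exact Finset.single_le_sum (f := fun δ => ∫⁻ x, ‖trigJet m F c δ x‖ₑ ^ q ∂torusMeasure)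
    (fun _ _ => bot_le) (Finset.mem_univ δ)

end Trig

/-! ### Moments of the supremum of a random trigonometric polynomial. -/

section RandomTrig

variable {Ω : Type*} [MeasurableSpace Ω] {P : Measure Ω}

lemma measurable_norm_trigJet (m : ℕ) (F : Finset Mode) {z : Ω → Mode → ℂ} (hz : Measurable z) :
    Measurable fun ω => ‖trigJet m F (z ω)‖ :=
  (continuous_trigJet m F).norm.measurable.comp hz

/-- The supremum over the torus is replaced by an integral, and Tonelli's theorem then leaves only
pointwise subgaussian moments. -/
lemma lintegral_trigJet_pow_le [IsProbabilityMeasure P] (m : ℕ) {N : ℕ} {F : Finset Mode}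
    (hF : ∀ k ∈ F, ∀ i, |k.1 i| ≤ N) {z : Ω → Mode → ℂ} (hz : Measurable z) {q : ℕ} (hq : q ≠ 0)
    {s : ℝ} (hs : 0 < s) (hsg : ∀ δ x, SubGauss (fun ω => trigJet m F (z ω) δ x) s P) :
    ∫⁻ ω, ‖trigJet m F (z ω)‖ₑ ^ q ∂P ≤ ((2 * (q * N) + 1) ^ 2 : ℕ) *
      (Fintype.card (MultiIdx m) * ENNReal.ofReal (4 * q.factorial * s ^ q)) := by
  have hmeas : ∀ δ : MultiIdx m, Measurable fun p : Ω × Torus => ‖trigJet m F (z p.1) δ p.2‖ₑ ^ q := by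
    intro δ
    have hzk : ∀ k, Measurable fun ω => z ω k := fun k => (measurable_pi_apply k).comp hz
    simp only [trigJet, realTrig_apply]
    have : ∀ k : Mode, Measurable fun x : Torus => UnitAddTorus.mFourier k.1 x :=
      fun k => (UnitAddTorus.mFourier k.1).continuous.measurable
    fun_prop
  calc _ ≤ ∫⁻ ω, ((2 * (q * N) + 1) ^ 2 : ℕ) *
        ∑ δ : MultiIdx m, ∫⁻ x, ‖trigJet m F (z ω) δ x‖ₑ ^ q ∂torusMeasure ∂P :=
        lintegral_mono fun ω => enorm_trigJet_pow_le m hF (z ω) hq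
    _ = ((2 * (q * N) + 1) ^ 2 : ℕ) *
        ∑ δ : MultiIdx m, ∫⁻ x, ∫⁻ ω, ‖trigJet m F (z ω) δ x‖ₑ ^ q ∂P ∂torusMeasure := by
        rw [lintegral_const_mul' _ _ (ENNReal.natCast_ne_top _), lintegral_finsetSum]
        · congr 1
          refine Finset.sum_congr rfl fun δ _ => ?_
          exact lintegral_lintegral_swap (hmeas δ).aemeasurable
        · exact fun δ _ => (hmeas δ).lintegral_prod_right'
    _ ≤ ((2 * (q * N) + 1) ^ 2 : ℕ) * ∑ δ : MultiIdx m, ∫⁻ _,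
          ENNReal.ofReal (4 * q.factorial * s ^ q) ∂torusMeasure := by
        gcongr with δ _ x
        exact (hsg δ x).lintegral_pow_le hs q
    _ = _ := by
        rw [lintegral_const, measure_univ, mul_one, Finset.sum_const, Finset.card_univ,
          nsmul_eq_mul]

end RandomTrig

/-! ### Approximation by interpolated trigonometric polynomials -/

section Interpolation

/-- The modes `k = 2πn` with `|n_i| ≤ N`. -/
def modeBox (N : ℕ) : Finset Mode := (latticeBox N).subtype (· ≠ 0)

lemma mem_modeBox {N : ℕ} {k : Mode} : k ∈ modeBox N ↔ ∀ i, |k.1 i| ≤ N := by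
  rw [modeBox, Finset.mem_subtype, mem_latticeBox]

lemma modeBox_mono {M N : ℕ} (h : M ≤ N) : modeBox M ⊆ modeBox N := fun k hk =>
  mem_modeBox.2 fun i => (mem_modeBox.1 hk i).trans (by exact_mod_cast h)

/-- The function that increases linearly from `0` to `1` on `[0, 1]`. -/
def ramp (x : ℝ) : ℝ := max 0 (min x 1)

lemma ramp_of_nonpos {x : ℝ} (h : x ≤ 0) : ramp x = 0 :=
  max_eq_left ((min_le_left _ _).trans h)

lemma ramp_of_one_le {x : ℝ} (h : 1 ≤ x) : ramp x = 1 := by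
  rw [ramp, min_eq_right h, max_eq_right zero_le_one]

lemma monotone_ramp : Monotone ramp := fun _ _ h => max_le_max le_rfl (min_le_min h le_rfl)

/-- A hat function supported in `[i, i + 2]`. -/
def hat (i : ℕ) (x : ℝ) : ℝ := ramp (x - i) - ramp (x - (i + 1 : ℕ))

lemma hat_nonneg (i : ℕ) (x : ℝ) : 0 ≤ hat i x :=
  sub_nonneg.2 (monotone_ramp (by push_cast; linarith))

lemma hat_le_one (i : ℕ) (x : ℝ) : hat i x ≤ 1 := by
  have h1 : ramp (x - i) ≤ 1 := max_le zero_le_one (min_le_right _ _)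
  have h2 : 0 ≤ ramp (x - (i + 1 : ℕ)) := le_max_left _ _
  rw [hat]
  linarith

lemma abs_sub_le_of_hat_ne_zero {i : ℕ} {x : ℝ} (h : hat i x ≠ 0) : |x - i| ≤ 2 := by
  rw [abs_le]
  constructor
  · by_contra! hlt
    refine h ?_
    rw [hat, ramp_of_nonpos (by linarith), ramp_of_nonpos (by push_cast; linarith), sub_zero]
  · by_contra! hlt
    refine h ?_
    rw [hat, ramp_of_one_le (by linarith), ramp_of_one_le (by push_cast; linarith), sub_self]

lemma continuous_hat (i : ℕ) : Continuous (hat i) := by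
  unfold hat ramp
  fun_prop

lemma sum_hat {L : ℕ} {x : ℝ} (h1 : 1 ≤ x) (h2 : x ≤ L) : ∑ i ∈ Finset.range L, hat i x = 1 := by
  have h : ∑ i ∈ Finset.range L, hat i x = ramp (x - (0 : ℕ)) - ramp (x - L) :=
    Finset.sum_range_sub' (fun i : ℕ => ramp (x - i)) L
  rw [h, Nat.cast_zero, sub_zero, ramp_of_one_le h1, ramp_of_nonpos (by linarith), sub_zero]

/-- The number of grid points at level `j`. -/
def gridSize (j : ℕ) : ℕ := 2 * 4 ^ j

/-- The grid points at level `j`, with spacing `2^{-j}`. -/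
def gridPt (j i : ℕ) : ℝ := (i - 4 ^ j) / 2 ^ j

/-- The weights of the interpolation at level `j`. -/
def gridWeight (j i : ℕ) (t : ℝ) : ℝ := hat i (2 ^ j * t + 4 ^ j)

lemma gridWeight_nonneg (j i : ℕ) (t : ℝ) : 0 ≤ gridWeight j i t := hat_nonneg _ _

lemma gridWeight_le_one (j i : ℕ) (t : ℝ) : gridWeight j i t ≤ 1 := hat_le_one _ _

lemma continuous_gridWeight (j i : ℕ) : Continuous (gridWeight j i) :=
  (continuous_hat i).comp (by fun_prop)

/-- The hat functions telescope. The grid at level `j` runs over `[-2^j, 2^j)`, so any given compact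
set is eventually covered. -/
lemma sum_gridWeight {j : ℕ} {t : ℝ} (h : |t| + 1 ≤ 2 ^ j) :
    ∑ i ∈ Finset.range (gridSize j), gridWeight j i t = 1 := by
  obtain ⟨h1, h2⟩ := abs_le.1 (le_sub_iff_add_le.2 h)
  have h3 : (1 : ℝ) ≤ 2 ^ j := one_le_pow₀ one_le_two
  have h4 : (4 : ℝ) ^ j = 2 ^ j * 2 ^ j := by rw [← mul_pow]; norm_num
  refine sum_hat ?_ ?_
  · rw [h4]; nlinarith
  · simp only [gridSize]; push_cast; rw [h4]; nlinarith

lemma abs_sub_gridPt_le {j i : ℕ} {t : ℝ} (h : gridWeight j i t ≠ 0) :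
    |t - gridPt j i| ≤ 2 / 2 ^ j := by
  have h1 := abs_sub_le_of_hat_ne_zero h
  have h2 : t - gridPt j i = (2 ^ j * t + 4 ^ j - i) / 2 ^ j := by
    simp only [gridPt]; field_simp; ring
  rw [h2, abs_div, abs_of_pos (show (0 : ℝ) < 2 ^ j by positivity)]
  gcongr

/-- The interpolation at level `j` of the jets of the trigonometric polynomials of degree `2^j`
with coefficients `z`. -/
def interp (m : ℕ) (z : ℝ → Mode → ℂ) (j : ℕ) : C(ℝ, Jets m) where
  toFun t := ∑ i ∈ Finset.range (gridSize j),
    gridWeight j i t • trigJet m (modeBox (2 ^ j)) (z (gridPt j i))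
  continuous_toFun := by
    have := continuous_gridWeight j
    fun_prop

lemma interp_apply (m : ℕ) (z : ℝ → Mode → ℂ) (j : ℕ) (t : ℝ) :
    interp m z j t = ∑ i ∈ Finset.range (gridSize j),
      gridWeight j i t • trigJet m (modeBox (2 ^ j)) (z (gridPt j i)) := rfl

lemma interp_eq_trigJet (m : ℕ) (z : ℝ → Mode → ℂ) (j : ℕ) (t : ℝ) :
    interp m z j t = trigJet m (modeBox (2 ^ j)) fun k =>
      ∑ i ∈ Finset.range (gridSize j), (gridWeight j i t : ℂ) * z (gridPt j i) k := by
  rw [interp_apply]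
  exact (trigJet_sum m _ (fun i => gridWeight j i t) _ fun i => z (gridPt j i)).symm

/-- The pairs of nearby grid points at the levels `j + 1` and `j`. -/
def gridPairs (j : ℕ) : Finset (ℕ × ℕ) :=
  {p ∈ Finset.range (gridSize (j + 1)) ×ˢ Finset.range (gridSize j) |
    |gridPt (j + 1) p.1 - gridPt j p.2| ≤ 4 / 2 ^ j}

lemma card_gridPairs_le (j : ℕ) : (gridPairs j).card ≤ 16 * 16 ^ j := by
  refine (Finset.card_filter_le _ _).trans ?_
  rw [Finset.card_product, Finset.card_range, Finset.card_range, gridSize, gridSize]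
  have : 16 ^ j = 4 ^ j * 4 ^ j := by rw [← mul_pow]; norm_num
  rw [this, pow_succ]
  exact le_of_eq (by ring)

/-- The coefficients of the difference of the polynomials at two grid points of consecutive
levels. -/
def pairCoef (z : ℝ → Mode → ℂ) (j : ℕ) (p : ℕ × ℕ) (k : Mode) : ℂ :=
  z (gridPt (j + 1) p.1) k - if k ∈ modeBox (2 ^ j) then z (gridPt j p.2) k else 0

lemma trigJet_indicator (m : ℕ) {F F' : Finset Mode} (h : F' ⊆ F) (d : Mode → ℂ) :
    trigJet m F (fun k => if k ∈ F' then d k else 0) = trigJet m F' d := by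
  ext δ x
  simp only [trigJet, realTrig_apply]
  rw [← Finset.sum_subset h]
  · exact Finset.sum_congr rfl fun k hk => by rw [if_pos hk]
  · intro k _ hk
    rw [if_neg hk]
    simp

lemma trigJet_pairCoef (m : ℕ) (z : ℝ → Mode → ℂ) (j : ℕ) (p : ℕ × ℕ) :
    trigJet m (modeBox (2 ^ (j + 1))) (pairCoef z j p) =
      trigJet m (modeBox (2 ^ (j + 1))) (z (gridPt (j + 1) p.1)) -
        trigJet m (modeBox (2 ^ j)) (z (gridPt j p.2)) := by
  rw [← trigJet_indicator m (modeBox_mono (Nat.pow_le_pow_right two_pos (Nat.le_succ j)))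
    (z (gridPt j p.2)), ← trigJet_sub]
  rfl

/-- The `ℓ^q` norm of all differences of polynomials at neighbouring grid points. -/
def levelBound (m q : ℕ) (z : ℝ → Mode → ℂ) (j : ℕ) : ℝ :=
  (∑ p ∈ gridPairs j, ‖trigJet m (modeBox (2 ^ (j + 1))) (pairCoef z j p)‖ ^ q) ^ ((q : ℝ)⁻¹)

lemma levelBound_nonneg (m q : ℕ) (z : ℝ → Mode → ℂ) (j : ℕ) : 0 ≤ levelBound m q z j := by
  unfold levelBound; positivity

lemma norm_pairCoef_le_levelBound {m q : ℕ} (hq : q ≠ 0) (z : ℝ → Mode → ℂ) {j : ℕ} {p : ℕ × ℕ}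
    (hp : p ∈ gridPairs j) :
    ‖trigJet m (modeBox (2 ^ (j + 1))) (pairCoef z j p)‖ ≤ levelBound m q z j := by
  rw [levelBound, Real.le_rpow_inv_iff_of_pos (norm_nonneg _)
    (Finset.sum_nonneg fun _ _ => by positivity) (by positivity), Real.rpow_natCast]
  exact Finset.single_le_sum
    (f := fun p => ‖trigJet m (modeBox (2 ^ (j + 1))) (pairCoef z j p)‖ ^ q)
    (fun _ _ => by positivity) hp

/-- A difference of two averages is the double average of the differences. -/
lemma norm_sum_smul_sub_sum_smul_le {E : Type*} [NormedAddCommGroup E] [NormedSpace ℝ E]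
    {I J : Finset ℕ} {v w : ℕ → ℝ} {a b : ℕ → E} {M : ℝ} (hv : ∀ i, 0 ≤ v i) (hw : ∀ i, 0 ≤ w i)
    (hv1 : ∑ i ∈ I, v i = 1) (hw1 : ∑ i ∈ J, w i = 1)
    (h : ∀ i ∈ I, ∀ l ∈ J, v i ≠ 0 → w l ≠ 0 → ‖a i - b l‖ ≤ M) :
    ‖∑ i ∈ I, v i • a i - ∑ l ∈ J, w l • b l‖ ≤ M := by
  have e : ∑ i ∈ I, v i • a i - ∑ l ∈ J, w l • b l =
      ∑ i ∈ I, ∑ l ∈ J, (v i * w l) • (a i - b l) := by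
    simp only [smul_sub, Finset.sum_sub_distrib]
    congr 1
    · refine Finset.sum_congr rfl fun i _ => ?_
      rw [← Finset.sum_smul, ← Finset.mul_sum, hw1, mul_one]
    · rw [Finset.sum_comm]
      refine Finset.sum_congr rfl fun l _ => ?_
      rw [← Finset.sum_smul, ← Finset.sum_mul, hv1, one_mul]
  rw [e]
  calc _ ≤ ∑ i ∈ I, ∑ l ∈ J, v i * w l * M := by
        refine (norm_sum_le _ _).trans (Finset.sum_le_sum fun i hi =>
          (norm_sum_le _ _).trans (Finset.sum_le_sum fun l hl => ?_))
        rw [norm_smul, Real.norm_eq_abs, abs_of_nonneg (mul_nonneg (hv i) (hw l))]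
        by_cases h0 : v i = 0
        · simp [h0]
        by_cases h1 : w l = 0
        · simp [h1]
        exact mul_le_mul_of_nonneg_left (h i hi l hl h0 h1) (mul_nonneg (hv i) (hw l))
    _ = M := by
        simp only [← Finset.sum_mul, ← Finset.mul_sum, hv1, hw1, one_mul, mul_one]

/-- Only grid points close to `t` carry weight, so all pairs in the double average lie in
`gridPairs`, and the bound does not depend on `t`. -/
lemma norm_interp_succ_sub_le {m q : ℕ} (hq : q ≠ 0) (z : ℝ → Mode → ℂ) {j : ℕ} {t : ℝ}
    (ht : |t| + 1 ≤ 2 ^ j) : ‖interp m z (j + 1) t - interp m z j t‖ ≤ levelBound m q z j := by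
  have ht' : |t| + 1 ≤ 2 ^ (j + 1) := ht.trans (pow_le_pow_right₀ one_le_two (Nat.le_succ j))
  rw [interp_apply, interp_apply]
  refine norm_sum_smul_sub_sum_smul_le (gridWeight_nonneg _ · t) (gridWeight_nonneg _ · t)
    (sum_gridWeight ht') (sum_gridWeight ht) fun i hi l hl h1 h2 => ?_
  rw [← trigJet_pairCoef m z j (i, l)]
  refine norm_pairCoef_le_levelBound hq z (Finset.mem_filter.2
    ⟨Finset.mem_product.2 ⟨hi, hl⟩, ?_⟩)
  have e1 := abs_sub_gridPt_le h1
  have e2 := abs_sub_gridPt_le h2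
  have e3 : (2 : ℝ) / 2 ^ (j + 1) ≤ 2 / 2 ^ j := by gcongr <;> norm_num
  have e4 : (4 : ℝ) / 2 ^ j = 2 / 2 ^ j + 2 / 2 ^ j := by ring
  dsimp only
  rw [abs_sub_comm] at e1
  calc |gridPt (j + 1) i - gridPt j l| ≤ |gridPt (j + 1) i - t| + |t - gridPt j l| :=
        abs_sub_le _ _ _
    _ ≤ _ := by rw [e4]; linarith

lemma natCast_add_one_le_two_pow {N j : ℕ} (h : N ≤ j) : (N : ℝ) + 1 ≤ 2 ^ j := by
  have h1 : N + 1 ≤ 2 ^ j := (Nat.succ_le_of_lt (Nat.lt_two_pow_self)).trans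
    (Nat.pow_le_pow_right two_pos h)
  exact_mod_cast h1

lemma exists_tendsto_interp {m q : ℕ} (hq : q ≠ 0) {z : ℝ → Mode → ℂ}
    (hz : Summable (levelBound m q z)) :
    ∃ Y : C(ℝ, Jets m), Tendsto (interp m z) atTop (𝓝 Y) := by
  have h : Summable fun j => interp m z (j + 1) - interp m z j := by
    refine ContinuousMap.summable_of_locally_summable_norm fun K => ?_
    obtain ⟨R, hR⟩ := K.isCompact.isBounded.exists_norm_le
    obtain ⟨N, hN⟩ := exists_nat_ge R
    refine Summable.of_norm_bounded_eventually_nat hz ?_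
    filter_upwards [eventually_ge_atTop N] with j hj
    rw [norm_norm]
    refine (ContinuousMap.norm_le _ (levelBound_nonneg _ _ _ _)).2 fun t => ?_
    refine norm_interp_succ_sub_le hq z ?_
    have h1 : |(t : ℝ)| ≤ R := hR t t.2
    linarith [natCast_add_one_le_two_pow hj]
  refine ⟨(∑' j, (interp m z (j + 1) - interp m z j)) + interp m z 0, ?_⟩
  refine (h.hasSum.tendsto_sum_nat.add_const (interp m z 0)).congr fun n => ?_
  rw [Finset.sum_range_sub, sub_add_cancel]

/-- A crude bound for the interpolation at level `j`. -/
def crudeBound (m : ℕ) (z : ℝ → Mode → ℂ) (j : ℕ) : ℝ :=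
  ∑ i ∈ Finset.range (gridSize j), ‖trigJet m (modeBox (2 ^ j)) (z (gridPt j i))‖

lemma crudeBound_nonneg (m : ℕ) (z : ℝ → Mode → ℂ) (j : ℕ) : 0 ≤ crudeBound m z j := by
  unfold crudeBound; positivity

lemma norm_interp_le (m : ℕ) (z : ℝ → Mode → ℂ) (j : ℕ) (t : ℝ) :
    ‖interp m z j t‖ ≤ crudeBound m z j := by
  rw [interp_apply]
  refine (norm_sum_le _ _).trans (Finset.sum_le_sum fun i _ => ?_)
  rw [norm_smul, Real.norm_eq_abs, abs_of_nonneg (gridWeight_nonneg _ _ _)]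
  exact mul_le_of_le_one_left (norm_nonneg _) (gridWeight_le_one _ _ _)

/-- Telescope from level `N`, the first at which the weights are known to sum to `1` on all of `[-N,
N]`. -/
lemma norm_le_of_tendsto_interp {m q : ℕ} (hq : q ≠ 0) {z : ℝ → Mode → ℂ}
    (hz : Summable (levelBound m q z)) {t : ℝ} {y : Jets m}
    (hy : Tendsto (fun j => interp m z j t) atTop (𝓝 y)) {N : ℕ} (ht : |t| ≤ N) :
    ‖y‖ ≤ crudeBound m z N + ∑' j, levelBound m q z j := by
  have h : ∀ n, ‖interp m z (N + n) t‖ ≤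
      crudeBound m z N + ∑ j ∈ Finset.range n, levelBound m q z (N + j) := by
    intro n
    induction n with
    | zero => simpa using norm_interp_le m z N t
    | succ n ih =>
      have h1 := norm_interp_succ_sub_le (m := m) hq z (j := N + n) (t := t)
        (by linarith [natCast_add_one_le_two_pow (Nat.le_add_right N n)])
      rw [Finset.sum_range_succ]
      have h2 := norm_le_norm_add_norm_sub' (interp m z (N + n + 1) t) (interp m z (N + n) t)
      rw [← add_assoc N n 1]
      linarith
  have h3 : Tendsto (fun n => interp m z (N + n) t) atTop (𝓝 y) :=
    hy.comp (tendsto_atTop_mono (fun n => Nat.le_add_left n N) tendsto_id)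
  refine le_of_tendsto h3.norm (Eventually.of_forall fun n => (h n).trans ?_)
  gcongr
  have h4 : ∑ j ∈ Finset.range n, levelBound m q z (N + j) =
      ∑ j ∈ (Finset.range n).map (addLeftEmbedding N), levelBound m q z j := by
    rw [Finset.sum_map]; rfl
  rw [h4]
  exact hz.sum_le_tsum _ fun j _ => levelBound_nonneg _ _ _ _

lemma norm_jet {m : ℕ} (f : CmTorus m) : ‖CmTorus.jet m f‖ = ‖f‖ := rfl

lemma isometry_jet (m : ℕ) : Isometry (CmTorus.jet m) :=
  AddMonoidHomClass.isometry_of_norm _ norm_jet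

/-- `jet` is an isometry, so a pointwise lift is automatically continuous. -/
lemma exists_lift_jet {m : ℕ} (Y : C(ℝ, Jets m)) (h : ∀ t, ∃ f, CmTorus.jet m f = Y t) :
    ∃ Φ : C(ℝ, CmTorus m), ∀ t, CmTorus.jet m (Φ t) = Y t := by
  choose f hf using h
  have h1 : CmTorus.jet m ∘ f = Y := funext hf
  exact ⟨⟨f, (isometry_jet m).isUniformInducing.isInducing.continuous_iff.2
    (by rw [h1]; exact Y.continuous)⟩, hf⟩

lemma exists_limit {m q : ℕ} (hq : q ≠ 0) {z : ℝ → Mode → ℂ} (hz : Summable (levelBound m q z)) :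
    ∃ Φ : C(ℝ, CmTorus m), ∀ t,
      Tendsto (fun j => interp m z j t) atTop (𝓝 (CmTorus.jet m (Φ t))) := by
  obtain ⟨Y, hY⟩ := exists_tendsto_interp hq hz
  have h : ∀ t, Tendsto (fun j => interp m z j t) atTop (𝓝 (Y t)) := fun t =>
    ((continuous_eval_const (F := C(ℝ, Jets m)) t).tendsto Y).comp hY
  obtain ⟨Φ, hΦ⟩ := exists_lift_jet Y fun t => exists_jet_eq_of_tendsto (m := m)
    (F := fun j => modeBox (2 ^ j)) (c := fun j k => ∑ i ∈ Finset.range (gridSize j),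
      (gridWeight j i t : ℂ) * z (gridPt j i) k)
      ((h t).congr fun j => interp_eq_trigJet m z j t)
  exact ⟨Φ, fun t => by rw [hΦ]; exact h t⟩

end Interpolation

/-! ### Sizes of the modes -/

section ModeSizes

lemma waveNorm_nonneg (k : Mode) : 0 ≤ waveNorm k := by
  unfold waveNorm
  have := Real.pi_pos
  positivity

lemma two_pi_mul_abs_le_waveNorm (k : Mode) (i : Fin 2) : 2 * Real.pi * |(k.1 i : ℝ)| ≤ waveNorm k := by
  have := Real.pi_pos
  unfold waveNorm
  gcongr
  refine Real.abs_le_sqrt ?_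
  fin_cases i
  · exact le_add_of_nonneg_right (sq_nonneg _)
  · exact le_add_of_nonneg_left (sq_nonneg _)

lemma natCast_le_waveNorm {N : ℕ} {k : Mode} (hk : k ∉ modeBox N) : (N : ℝ) ≤ waveNorm k := by
  rw [mem_modeBox] at hk
  push Not at hk
  obtain ⟨i, hi⟩ := hk
  refine le_trans ?_ (two_pi_mul_abs_le_waveNorm k i)
  have h1 : (N : ℝ) ≤ |(k.1 i : ℝ)| := by exact_mod_cast hi.le
  nlinarith [Real.pi_gt_three, abs_nonneg (k.1 i : ℝ)]

lemma one_le_waveNorm (k : Mode) : 1 ≤ waveNorm k := by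
  have h : ∃ i, k.1 i ≠ 0 := by
    by_contra! h
    exact k.2 (funext h)
  obtain ⟨i, hi⟩ := h
  refine le_trans ?_ (two_pi_mul_abs_le_waveNorm k i)
  have h1 : (1 : ℝ) ≤ |(k.1 i : ℝ)| := by exact_mod_cast Int.one_le_abs hi
  nlinarith [Real.pi_gt_three]

lemma norm_derivCoef_le (i : Fin 2) (k : Mode) : ‖derivCoef i k‖ ≤ waveNorm k := by
  refine le_trans (le_of_eq ?_) (two_pi_mul_abs_le_waveNorm k i)
  simp [derivCoef, abs_of_pos Real.pi_pos]

lemma norm_multiCoef_le {m a b : ℕ} (h : a + b ≤ m) (k : Mode) :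
    ‖multiCoef a b k‖ ≤ waveNorm k ^ m := by
  rw [multiCoef, norm_mul, norm_pow, norm_pow]
  calc _ ≤ waveNorm k ^ a * waveNorm k ^ b := by
        have := waveNorm_nonneg k
        gcongr <;> exact norm_derivCoef_le _ _
    _ = waveNorm k ^ (a + b) := (pow_add _ _ _).symm
    _ ≤ _ := pow_le_pow_right₀ (one_le_waveNorm k) h

lemma norm_multiCoef_mul_mFourier_le {m : ℕ} (δ : MultiIdx m) (x : Torus) (k : Mode) :
    ‖multiCoef δ.1.1 δ.1.2 k * UnitAddTorus.mFourier k.1 x‖ ≤ waveNorm k ^ m := by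
  rw [norm_mul, norm_mFourier_apply, mul_one]
  exact norm_multiCoef_le δ.2 k

variable {H : ℝ} {α lam : Mode → ℝ}

lemma sqrt_mul_rpow_sq {l a : ℝ} (hl : 0 ≤ l) (ha : 0 < a) (H : ℝ) :
    (√l * a ^ (-H)) ^ 2 = l * a ^ (-(2 * H)) := by
  rw [mul_pow, Real.sq_sqrt hl, ← Real.rpow_natCast, ← Real.rpow_mul ha.le]
  congr 2
  push_cast
  ring

/-- The tail of the series at frequencies above `N` decays like `N^{-g}`. -/
lemma modeScale_high_le (hα : ∀ k, 0 < α k) (hl : ∀ k, 0 ≤ lam k) {m : ℕ} {γ g : ℝ} (hg : 0 < g)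
    (hgγ : g ≤ γ)
    (hsum : Summable fun k : Mode =>
      lam k * α k ^ (-(2 * H)) * waveNorm k ^ (2 * (m : ℝ) + 2 * γ))
    {N : ℕ} (hN : N ≠ 0) {F : Finset Mode} (hF : ∀ k ∈ F, k ∉ modeBox N) {c : Mode → ℂ}
    (hc : ∀ k, ‖c k‖ ≤ waveNorm k ^ m) :
    modeScale H α lam F c (fun _ => 1) ≤
      √(∑' k, lam k * α k ^ (-(2 * H)) * waveNorm k ^ (2 * (m : ℝ) + 2 * γ)) / (N : ℝ) ^ g := by
  have hNpos : (0 : ℝ) < N := by positivity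
  have hterm : ∀ k ∈ F, (‖c k‖ * 1 * (√(lam k) * α k ^ (-H))) ^ 2 ≤
      lam k * α k ^ (-(2 * H)) * waveNorm k ^ (2 * (m : ℝ) + 2 * γ) / ((N : ℝ) ^ g) ^ 2 := by
    intro k hk
    have hw := one_le_waveNorm k
    have hw0 : 0 < waveNorm k := by linarith
    have h1 : (N : ℝ) ^ g ≤ waveNorm k ^ γ :=
      (Real.rpow_le_rpow hNpos.le (natCast_le_waveNorm (hF k hk)) hg.le).trans
        (Real.rpow_le_rpow_of_exponent_le hw hgγ)
    have h2 : waveNorm k ^ (2 * (m : ℝ) + 2 * γ) = (waveNorm k ^ m) ^ 2 * (waveNorm k ^ γ) ^ 2 := by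
      rw [Real.rpow_add hw0, ← Real.rpow_natCast (waveNorm k ^ γ), ← Real.rpow_mul hw0.le,
        ← pow_mul, ← Real.rpow_natCast (waveNorm k)]
      push_cast
      ring_nf
    have ha := hα k
    have hlk := hl k
    rw [le_div_iff₀ (by positivity), mul_one, mul_pow, sqrt_mul_rpow_sq hlk ha, h2]
    calc ‖c k‖ ^ 2 * (lam k * α k ^ (-(2 * H))) * ((N : ℝ) ^ g) ^ 2
        ≤ (waveNorm k ^ m) ^ 2 * (lam k * α k ^ (-(2 * H))) * (waveNorm k ^ γ) ^ 2 := by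
          gcongr
          exact hc k
      _ = _ := by ring
  have hpos : ∀ k, 0 ≤ lam k * α k ^ (-(2 * H)) * waveNorm k ^ (2 * (m : ℝ) + 2 * γ) := fun k => by
    have := hl k
    have := hα k
    have := waveNorm_nonneg k
    positivity
  rw [modeScale, ← Real.sqrt_sq (show (0 : ℝ) ≤ (N : ℝ) ^ g by positivity),
    ← Real.sqrt_div' _ (sq_nonneg _)]
  refine Real.sqrt_le_sqrt ((Finset.sum_le_sum hterm).trans ?_)
  rw [← Finset.sum_div]
  gcongr
  exact hsum.sum_le_tsum _ fun k _ => hpos k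

/-- Since `α` is bounded below, lowering the exponent costs a constant. It is needed because the
time exponent `g` may not exceed `H`, while `γ` may. -/
lemma summable_of_le_exponent {a : ℝ} (ha : 0 < a) (hα : ∀ k, a ≤ α k) (hl : ∀ k, 0 ≤ lam k)
    {m : ℕ} {γ g : ℝ} (hgγ : g ≤ γ)
    (hsum : Summable fun k : Mode => lam k * α k ^ (2 * γ - 2 * H) * waveNorm k ^ (2 * m)) :
    Summable fun k : Mode => lam k * α k ^ (2 * g - 2 * H) * waveNorm k ^ (2 * m) := by
  refine (hsum.mul_left (a ^ (2 * g - 2 * γ))).of_nonneg_of_le (fun k => ?_) fun k => ?_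
  · have := hl k
    have := ha.trans_le (hα k)
    have := waveNorm_nonneg k
    positivity
  · have hk := ha.trans_le (hα k)
    have := hl k
    have := waveNorm_nonneg k
    have h1 : α k ^ (2 * g - 2 * H) = α k ^ (2 * g - 2 * γ) * α k ^ (2 * γ - 2 * H) := by
      rw [← Real.rpow_add hk]; ring_nf
    have h2 : α k ^ (2 * g - 2 * γ) ≤ a ^ (2 * g - 2 * γ) :=
      Real.rpow_le_rpow_of_nonpos ha (hα k) (by linarith)
    calc _ = lam k * (α k ^ (2 * g - 2 * γ) * α k ^ (2 * γ - 2 * H)) * waveNorm k ^ (2 * m) := by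
          rw [h1]
      _ ≤ lam k * (a ^ (2 * g - 2 * γ) * α k ^ (2 * γ - 2 * H)) * waveNorm k ^ (2 * m) := by
          gcongr
      _ = _ := by ring

lemma modeScale_increment_le (hα : ∀ k, 0 < α k) (hl : ∀ k, 0 ≤ lam k) {m : ℕ} {ν g : ℝ}
    (hν : 0 < ν) (hsum : Summable fun k : Mode =>
      lam k * α k ^ (2 * g - 2 * H) * waveNorm k ^ (2 * m))
    (F : Finset Mode) {c : Mode → ℂ} (hc : ∀ k, ‖c k‖ ≤ waveNorm k ^ m) {d : ℝ} (hd : 0 ≤ d) :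
    modeScale H α lam F c (fun k => (ν * α k * d) ^ g) ≤
      (ν * d) ^ g * √(∑' k, lam k * α k ^ (2 * g - 2 * H) * waveNorm k ^ (2 * m)) := by
  have hterm : ∀ k ∈ F, (‖c k‖ * (ν * α k * d) ^ g * (√(lam k) * α k ^ (-H))) ^ 2 ≤
      ((ν * d) ^ g) ^ 2 * (lam k * α k ^ (2 * g - 2 * H) * waveNorm k ^ (2 * m)) := by
    intro k _
    have ha := hα k
    have hlk := hl k
    have h1 : (ν * α k * d) ^ g = (ν * d) ^ g * α k ^ g := by
      rw [← Real.mul_rpow (by positivity) ha.le]; ring_nf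
    have h2 : α k ^ (2 * g - 2 * H) = (α k ^ g) ^ 2 * α k ^ (-(2 * H)) := by
      rw [← Real.rpow_natCast (α k ^ g), ← Real.rpow_mul ha.le, ← Real.rpow_add ha]
      push_cast
      ring_nf
    rw [mul_pow, sqrt_mul_rpow_sq hlk ha, h1, h2, mul_comm 2 m, pow_mul]
    calc (‖c k‖ * ((ν * d) ^ g * α k ^ g)) ^ 2 * (lam k * α k ^ (-(2 * H)))
        ≤ (waveNorm k ^ m * ((ν * d) ^ g * α k ^ g)) ^ 2 * (lam k * α k ^ (-(2 * H))) := by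
          gcongr
          exact hc k
      _ = _ := by ring
  rw [modeScale, ← Real.sqrt_sq (show 0 ≤ (ν * d) ^ g by positivity),
    ← Real.sqrt_mul (sq_nonneg _)]
  refine Real.sqrt_le_sqrt ((Finset.sum_le_sum hterm).trans ?_)
  rw [← Finset.mul_sum]
  gcongr
  refine hsum.sum_le_tsum _ fun k _ => ?_
  have := hl k
  have := hα k
  have := waveNorm_nonneg k
  positivity

end ModeSizes

/-! ### Estimates for the interpolations of the solution -/

section Estimates

variable {Ω : Type*} [MeasurableSpace Ω] {P : Measure Ω}
  {ν H : ℝ} {α lam : Mode → ℝ} {β : Mode → ℝ → Ω → ℂ} {ψ : ℝ → Ω → V}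

/-- The path of the Fourier coefficients of the solution. -/
def coefPath (ψ : ℝ → Ω → V) (ω : Ω) (t : ℝ) (k : Mode) : ℂ := coef (ψ t ω) k

lemma trigJet_apply_eq_sum (m : ℕ) (F : Finset Mode) (c : Mode → ℂ) (δ : MultiIdx m) (x : Torus) :
    trigJet m F c δ x =
      ∑ k ∈ F, (multiCoef δ.1.1 δ.1.2 k * UnitAddTorus.mFourier k.1 x * c k).re := by
  rw [trigJet, realTrig_apply]
  refine Finset.sum_congr rfl fun k _ => ?_
  congr 1
  ring

lemma sum_sdiff_add_sum_sub_re {F' F : Finset Mode} (h : F' ⊆ F) (c u v : Mode → ℂ) :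
    ∑ k ∈ F \ F', (c k * u k).re + ∑ k ∈ F', (c k * (u k - v k)).re =
      ∑ k ∈ F, (c k * (u k - if k ∈ F' then v k else 0)).re := by
  rw [← Finset.sum_sdiff h]
  refine congrArg₂ _ (Finset.sum_congr rfl fun k hk => ?_) (Finset.sum_congr rfl fun k hk => ?_)
  · rw [if_neg (Finset.mem_sdiff.1 hk).2, sub_zero]
  · rw [if_pos hk]

/-- The difference consists of the modes new at level `j + 1`, at the finer grid time, and of a time
increment of the old modes. The tail bound and the increment bound both decay like `2^{-gj}`. -/
lemma exists_subGauss_pair [IsProbabilityMeasure P] (hA : StandingAssumption ν H α lam β P) {m : ℕ}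
    {γ g : ℝ} (hg : 0 < g) (hgγ : g ≤ γ) (hgH : g ≤ H)
    (hsum₁ : Summable fun k : Mode => lam k * α k ^ (2 * γ - 2 * H) * waveNorm k ^ (2 * m))
    (hsum₂ : Summable fun k : Mode =>
      lam k * α k ^ (-(2 * H)) * waveNorm k ^ (2 * (m : ℝ) + 2 * γ))
    (hψ : IsErgodicMildSolution ν H α lam β P ψ) :
    ∃ D > 0, ∀ j, ∀ p ∈ gridPairs j, ∀ (δ : MultiIdx m) (x : Torus),
      SubGauss (fun ω => trigJet m (modeBox (2 ^ (j + 1))) (pairCoef (coefPath ψ ω) j p) δ x)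
        (D / ((2 : ℝ) ^ g) ^ j) P := by
  obtain ⟨a, ha, hα⟩ := hA.alpha_lower
  have hν := hA.nu_pos
  have hsum := summable_of_le_exponent ha hα hA.lam_nonneg hgγ hsum₁
  set S₁ := √(∑' k, lam k * α k ^ (2 * g - 2 * H) * waveNorm k ^ (2 * m))
  set S₂ := √(∑' k, lam k * α k ^ (-(2 * H)) * waveNorm k ^ (2 * (m : ℝ) + 2 * γ))
  have hS₁ : 0 ≤ S₁ := Real.sqrt_nonneg _
  have hS₂ : 0 ≤ S₂ := Real.sqrt_nonneg _
  -- The `4` is the constant in `gridPairs`; the `+ 1` makes `D` positive even if all `λ_k` vanish,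
  -- as the moment bounds require.
  refine ⟨8 * S₂ + 16 * ((ν * 4) ^ g * S₁) + 1, by positivity, fun j p hp δ x => ?_⟩
  set c : Mode → ℂ := fun k => multiCoef δ.1.1 δ.1.2 k * UnitAddTorus.mFourier k.1 x with hc
  have hcn : ∀ k, ‖c k‖ ≤ waveNorm k ^ m := norm_multiCoef_mul_mFourier_le δ x
  have hsub : modeBox (2 ^ j) ⊆ modeBox (2 ^ (j + 1)) :=
    modeBox_mono (Nat.pow_le_pow_right two_pos (Nat.le_succ j))
  have h1 := subGauss_sum_coef hA hψ (modeBox (2 ^ (j + 1)) \ modeBox (2 ^ j)) c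
    (gridPt (j + 1) p.1)
  have h2 := subGauss_sum_coef_increment hA hψ (modeBox (2 ^ j)) c (gridPt j p.2)
    (gridPt (j + 1) p.1) hg hgH
  have hb : ((2 ^ j : ℕ) : ℝ) ^ g = ((2 : ℝ) ^ g) ^ j := by
    push_cast
    rw [← Real.rpow_natCast, ← Real.rpow_natCast, ← Real.rpow_mul zero_le_two,
      ← Real.rpow_mul zero_le_two, mul_comm]
  refine ((h1.add h2).congr (ae_of_all _ fun ω => ?_)).mono ?_
  · exact (sum_sdiff_add_sum_sub_re hsub c _ _).trans (trigJet_apply_eq_sum m _ _ δ x).symm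
  · have e1 := modeScale_high_le (H := H) hA.alpha_pos hA.lam_nonneg hg hgγ hsum₂
      (N := 2 ^ j) (by positivity) (F := modeBox (2 ^ (j + 1)) \ modeBox (2 ^ j))
      (fun k hk => (Finset.mem_sdiff.1 hk).2) hcn
    have e2 := modeScale_increment_le (H := H) hA.alpha_pos hA.lam_nonneg hν hsum
      (modeBox (2 ^ j)) hcn (abs_nonneg (gridPt (j + 1) p.1 - gridPt j p.2))
    have e3 : (ν * |gridPt (j + 1) p.1 - gridPt j p.2|) ^ g ≤ (ν * 4) ^ g / ((2 : ℝ) ^ g) ^ j := by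
      rw [← hb, ← Real.div_rpow (by positivity) (by positivity)]
      refine Real.rpow_le_rpow (by positivity) ?_ hg.le
      rw [mul_div_assoc]
      gcongr
      push_cast
      exact (Finset.mem_filter.1 hp).2
    rw [hb] at e1
    have e4 : modeScale H α lam (modeBox (2 ^ j)) c (fun k =>
        (ν * α k * |gridPt (j + 1) p.1 - gridPt j p.2|) ^ g) ≤
        (ν * 4) ^ g / ((2 : ℝ) ^ g) ^ j * S₁ :=
      e2.trans (mul_le_mul_of_nonneg_right e3 hS₁)
    have e5 : 0 ≤ 1 / ((2 : ℝ) ^ g) ^ j := by positivity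
    calc _ ≤ 8 * (S₂ / ((2 : ℝ) ^ g) ^ j) + 16 * ((ν * 4) ^ g / ((2 : ℝ) ^ g) ^ j * S₁) :=
          add_le_add (mul_le_mul_of_nonneg_left e1 (by norm_num))
            (mul_le_mul_of_nonneg_left e4 (by norm_num))
      _ ≤ 8 * (S₂ / ((2 : ℝ) ^ g) ^ j) + 16 * ((ν * 4) ^ g / ((2 : ℝ) ^ g) ^ j * S₁) +
          1 / ((2 : ℝ) ^ g) ^ j := le_add_of_nonneg_right e5
      _ = _ := by ring

lemma measurable_coefPath (hψ : IsErgodicMildSolution ν H α lam β P ψ) (t : ℝ) :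
    Measurable fun ω => coefPath ψ ω t :=
  measurable_pi_lambda _ fun k => hψ.mildSolution.measurable_coef t k

lemma measurable_pairCoef (hψ : IsErgodicMildSolution ν H α lam β P ψ) (j : ℕ) (p : ℕ × ℕ) :
    Measurable fun ω => pairCoef (coefPath ψ ω) j p := by
  refine measurable_pi_lambda _ fun k => ?_
  have := hψ.mildSolution.measurable_coef (gridPt (j + 1) p.1) k
  have := hψ.mildSolution.measurable_coef (gridPt j p.2) k
  unfold pairCoef coefPath
  split_ifs <;> fun_prop

lemma measurable_levelBound (hψ : IsErgodicMildSolution ν H α lam β P ψ) (m q j : ℕ) :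
    Measurable fun ω => levelBound m q (coefPath ψ ω) j := by
  have := fun p => measurable_norm_trigJet m (modeBox (2 ^ (j + 1))) (measurable_pairCoef hψ j p)
  unfold levelBound
  fun_prop

lemma measurable_crudeBound (hψ : IsErgodicMildSolution ν H α lam β P ψ) (m j : ℕ) :
    Measurable fun ω => crudeBound m (coefPath ψ ω) j := by
  have := fun t => measurable_norm_trigJet m (modeBox (2 ^ j)) (measurable_coefPath hψ t)
  unfold crudeBound
  fun_prop

lemma memLp_crudeBound [IsProbabilityMeasure P] (hA : StandingAssumption ν H α lam β P)
    (hψ : IsErgodicMildSolution ν H α lam β P ψ) (m j : ℕ) :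
    MemLp (fun ω => crudeBound m (coefPath ψ ω) j) 2 P := by
  refine memLp_finsetSum _ fun i _ => ?_
  refine ⟨(measurable_norm_trigJet m _ (measurable_coefPath hψ _)).aestronglyMeasurable, ?_⟩
  rw [eLpNorm_norm, eLpNorm_lt_top_iff_lintegral_rpow_enorm_lt_top (by norm_num) (by norm_num)]
  have hsg : ∀ (δ : MultiIdx m) (x : Torus),
      SubGauss (fun ω => trigJet m (modeBox (2 ^ j)) (coefPath ψ ω (gridPt j i)) δ x)
        (8 * modeScale H α lam (modeBox (2 ^ j)) (fun k => (waveNorm k ^ m : ℝ)) (fun _ => 1) + 1)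
        P := by
    intro δ x
    refine ((subGauss_sum_coef hA hψ (modeBox (2 ^ j)) (fun k =>
      multiCoef δ.1.1 δ.1.2 k * UnitAddTorus.mFourier k.1 x) (gridPt j i)).congr
      (ae_of_all _ fun ω => (trigJet_apply_eq_sum m _ _ δ x).symm)).mono ?_
    have h := sqrt_sum_sq_le_mul (subset_refl (modeBox (2 ^ j))) zero_le_one
      (x := fun k => ‖multiCoef δ.1.1 δ.1.2 k * UnitAddTorus.mFourier k.1 x‖ * 1 *
        (√(lam k) * α k ^ (-H)))
      (y := fun k => ‖((waveNorm k ^ m : ℝ) : ℂ)‖ * 1 * (√(lam k) * α k ^ (-H)))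
      (fun k => by have := hA.alpha_pos k; positivity) (fun k => by
        have := hA.alpha_pos k
        rw [one_mul]
        gcongr
        rw [Complex.norm_real, Real.norm_eq_abs, abs_of_nonneg (pow_nonneg (waveNorm_nonneg k) m)]
        exact norm_multiCoef_mul_mFourier_le δ x k)
    rw [one_mul] at h
    unfold modeScale
    linarith
  have h0 : 0 ≤ modeScale H α lam (modeBox (2 ^ j)) (fun k => (waveNorm k ^ m : ℝ)) (fun _ => 1) :=
    Real.sqrt_nonneg _
  have h := lintegral_trigJet_pow_le (P := P) m (N := 2 ^ j) (F := modeBox (2 ^ j))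
    (fun k hk => mem_modeBox.1 hk) (measurable_coefPath hψ (gridPt j i)) two_ne_zero
    (by positivity) hsg
  simp only [ENNReal.toReal_ofNat, ENNReal.rpow_ofNat]
  refine h.trans_lt (ENNReal.mul_lt_top (ENNReal.natCast_lt_top _)
    (ENNReal.mul_lt_top (ENNReal.natCast_lt_top _) ENNReal.ofReal_lt_top))

/-- The exponential rates balance: `16^j` pairs and `4^j` from the supremum over the torus, against
`128^{-j}` from the moments, leave `2^{-j}`. -/
lemma lintegral_levelBound_pow_le [IsProbabilityMeasure P]
    (hψ : IsErgodicMildSolution ν H α lam β P ψ) {m : ℕ} {D b : ℝ} (hD : 0 < D)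
    (hb : 0 < b) (hsg : ∀ j, ∀ p ∈ gridPairs j, ∀ (δ : MultiIdx m) (x : Torus),
      SubGauss (fun ω => trigJet m (modeBox (2 ^ (j + 1))) (pairCoef (coefPath ψ ω) j p) δ x)
        (D / b ^ j) P) {q : ℕ} (hq : q ≠ 0) (hbq : 128 ≤ b ^ q) (j : ℕ) :
    ∫⁻ ω, ‖levelBound m q (coefPath ψ ω) j‖ₑ ^ q ∂P ≤
      ENNReal.ofReal (16 * (5 * q) ^ 2 * (Fintype.card (MultiIdx m) * (4 * q.factorial * D ^ q)) *
        (1 / 2) ^ j) := by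
  have h1 : ∀ ω, ‖levelBound m q (coefPath ψ ω) j‖ₑ ^ q = ∑ p ∈ gridPairs j,
      ‖trigJet m (modeBox (2 ^ (j + 1))) (pairCoef (coefPath ψ ω) j p)‖ₑ ^ q := by
    intro ω
    rw [Real.enorm_of_nonneg (levelBound_nonneg _ _ _ _), ← ENNReal.ofReal_pow
      (levelBound_nonneg _ _ _ _), levelBound, ← Real.rpow_natCast, ← Real.rpow_mul
      (Finset.sum_nonneg fun _ _ => by positivity), inv_mul_cancel₀ (by exact_mod_cast hq),
      Real.rpow_one, ENNReal.ofReal_sum_of_nonneg fun _ _ => by positivity]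
    refine Finset.sum_congr rfl fun p _ => ?_
    rw [ENNReal.ofReal_pow (norm_nonneg _), ofReal_norm]
  simp_rw [h1]
  rw [lintegral_finsetSum _ fun p _ => by
    have := (measurable_norm_trigJet m (modeBox (2 ^ (j + 1)))
      (measurable_pairCoef hψ j p)).ennreal_ofReal.pow_const q
    simpa only [ofReal_norm] using this]
  calc _ ≤ ∑ p ∈ gridPairs j, ((2 * (q * 2 ^ (j + 1)) + 1) ^ 2 : ℕ) *
        (Fintype.card (MultiIdx m) * ENNReal.ofReal (4 * q.factorial * (D / b ^ j) ^ q)) :=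
        Finset.sum_le_sum fun p hp => lintegral_trigJet_pow_le m
          (fun k hk => mem_modeBox.1 hk) (measurable_pairCoef hψ j p) hq (by positivity)
          (hsg j p hp)
    _ = ENNReal.ofReal ((gridPairs j).card * (((2 * (q * 2 ^ (j + 1)) + 1) ^ 2 : ℕ) *
        (Fintype.card (MultiIdx m) * (4 * q.factorial * (D / b ^ j) ^ q)))) := by
        rw [Finset.sum_const, nsmul_eq_mul, ENNReal.ofReal_mul (Nat.cast_nonneg _),
          ENNReal.ofReal_mul (Nat.cast_nonneg _),
          ENNReal.ofReal_mul (p := (Fintype.card (MultiIdx m) : ℝ)) (Nat.cast_nonneg _),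
          ENNReal.ofReal_natCast, ENNReal.ofReal_natCast, ENNReal.ofReal_natCast]
    _ ≤ _ := by
        refine ENNReal.ofReal_le_ofReal ?_
        have hq1 : (1 : ℝ) ≤ q := by exact_mod_cast Nat.one_le_iff_ne_zero.2 hq
        have h2j : (1 : ℝ) ≤ 2 ^ j := one_le_pow₀ one_le_two
        have c1 : ((gridPairs j).card : ℝ) ≤ 16 * 16 ^ j := by exact_mod_cast card_gridPairs_le j
        have c2 : (((2 * (q * 2 ^ (j + 1)) + 1) ^ 2 : ℕ) : ℝ) ≤ (5 * q) ^ 2 * 4 ^ j := by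
          have : (4 : ℝ) ^ j = (2 ^ j) ^ 2 := by rw [← pow_mul, mul_comm, pow_mul]; norm_num
          rw [this, ← mul_pow]
          push_cast
          gcongr
          rw [pow_succ]
          nlinarith
        have c3 : (D / b ^ j) ^ q ≤ D ^ q * (1 / 128) ^ j := by
          rw [div_pow, ← pow_mul, mul_comm j q, pow_mul, div_eq_mul_one_div, ← one_div_pow]
          gcongr
        calc _ ≤ 16 * 16 ^ j * ((5 * q) ^ 2 * 4 ^ j * (Fintype.card (MultiIdx m) *
              (4 * q.factorial * (D ^ q * (1 / 128) ^ j)))) := by gcongr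
          _ = 16 * (5 * q) ^ 2 * (Fintype.card (MultiIdx m) * (4 * q.factorial * D ^ q)) *
              (16 ^ j * 4 ^ j * (1 / 128) ^ j) := by ring
          _ = _ := by rw [← mul_pow, ← mul_pow]; norm_num

/-- On a probability space the `L²` norm is at most the `L^q` norm, and the latter is geometric with
ratio `2^{-1/q}`. -/
lemma tsum_eLpNorm_levelBound_ne_top [IsProbabilityMeasure P]
    (hψ : IsErgodicMildSolution ν H α lam β P ψ) {m q : ℕ} (hq : 2 ≤ q) {A : ℝ} (hA : 0 ≤ A)
    (h : ∀ j, ∫⁻ ω, ‖levelBound m q (coefPath ψ ω) j‖ₑ ^ q ∂P ≤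
      ENNReal.ofReal (A * (1 / 2) ^ j)) :
    ∑' j, eLpNorm (fun ω => levelBound m q (coefPath ψ ω) j) 2 P ≠ ⊤ := by
  have hq0 : (0 : ℝ) < q := by positivity
  set ρ : ℝ := (1 / 2) ^ ((q : ℝ)⁻¹) with hρ
  have hρ0 : 0 ≤ ρ := by positivity
  have hρ1 : ρ < 1 := Real.rpow_lt_one (by norm_num) (by norm_num) (by positivity)
  have h1 : ∀ j, eLpNorm (fun ω => levelBound m q (coefPath ψ ω) j) 2 P ≤
      ENNReal.ofReal (A ^ ((q : ℝ)⁻¹) * ρ ^ j) := by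
    intro j
    refine (eLpNorm_le_eLpNorm_of_exponent_le (q := (q : ℝ≥0∞)) (by exact_mod_cast hq)
      (measurable_levelBound hψ m q j).aestronglyMeasurable).trans ?_
    rw [eLpNorm_eq_lintegral_rpow_enorm_toReal (by positivity) (ENNReal.natCast_ne_top _)]
    simp only [ENNReal.toReal_natCast, ENNReal.rpow_natCast, one_div]
    refine (ENNReal.rpow_le_rpow (h j) (by positivity)).trans_eq ?_
    rw [ENNReal.ofReal_rpow_of_nonneg (by positivity) (by positivity), Real.mul_rpow hA
      (by positivity), hρ, ← Real.rpow_natCast, ← Real.rpow_natCast, ← Real.rpow_mul (by norm_num),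
      ← Real.rpow_mul (by norm_num), mul_comm (j : ℝ)]
  refine ne_top_of_le_ne_top ?_ (ENNReal.tsum_le_tsum h1)
  exact ((summable_geometric_of_lt_one hρ0 hρ1).mul_left _).tsum_ofReal_ne_top

/-- Minkowski's inequality for the partial sums, then Fatou's lemma. -/
lemma memLp_tsum_of_tsum_eLpNorm_ne_top {f : ℕ → Ω → ℝ} (hf : ∀ j, Measurable (f j))
    (h : ∑' j, eLpNorm (f j) 2 P ≠ ⊤) : MemLp (fun ω => ∑' j, f j ω) 2 P := by
  refine ⟨(Measurable.tsum hf).aestronglyMeasurable, ?_⟩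
  have h1 := summable_norm_of_tsum_eLpNorm_ne_top one_le_two
    (fun j => (hf j).aestronglyMeasurable) h
  have h2 := Lp.eLpNorm_lim_le_liminf_eLpNorm (p := 2) (μ := P)
    (f := fun n ω => ∑ j ∈ Finset.range n, f j ω)
    (fun n => (Finset.measurable_fun_sum _ fun j _ => hf j).aestronglyMeasurable)
    (fun ω => ∑' j, f j ω) (by
      filter_upwards [h1] with ω hω
      exact hω.of_norm.hasSum.tendsto_sum_nat)
  refine (h2.trans ?_).trans_lt h.lt_top
  refine liminf_le_of_frequently_le' (Frequently.of_forall fun n => ?_)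
  refine le_trans ?_ (ENNReal.sum_le_tsum (Finset.range n))
  have := eLpNorm_sum_le (p := 2) (μ := P) (s := Finset.range n) (f := f)
    (fun j _ => (hf j).aestronglyMeasurable) one_le_two
  rwa [show (fun ω => ∑ j ∈ Finset.range n, f j ω) = ∑ j ∈ Finset.range n, f j from
    funext fun ω => (Finset.sum_apply ω _ _).symm]

end Estimates

/-! ### Identification of the limit -/

/-- The Fourier coefficients of the interpolation. -/
def interpCoef (z : ℝ → Mode → ℂ) (j : ℕ) (t : ℝ) (k : Mode) : ℂ :=
  ∑ i ∈ Finset.range (gridSize j), (gridWeight j i t : ℂ) * z (gridPt j i) k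

lemma interp_zero_eq_realTrig (m : ℕ) (z : ℝ → Mode → ℂ) (j : ℕ) (t : ℝ) (h : _) :
    interp m z j t ⟨(0, 0), h⟩ = realTrig (modeBox (2 ^ j)) (interpCoef z j t) := by
  rw [interp_eq_trigJet, trigJet]
  congr 1
  funext k
  simp [multiCoef, interpCoef]

lemma continuous_complexify : Continuous complexify :=
  ContinuousMap.continuous_postcomp (⟨fun x : ℝ => (x : ℂ), by fun_prop⟩ : C(ℝ, ℂ))

/-- Taking real parts averages `c k` with the conjugate of `c (-k)`. For symmetric coefficients this
changes nothing. -/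
lemma fourierFunctional_complexify_realTrig {F : Finset Mode} (hF : ∀ k ∈ F, -k ∈ F)
    {c : Mode → ℂ} (hc : ∀ k, c (-k) = starRingEnd ℂ (c k)) {k : Mode} (hk : k ∈ F) :
    fourierFunctional k.1 (complexify (realTrig F c)) = c k := by
  have h1 : ∀ l : Mode, (k.1 = l.1) = (k = l) := fun l => propext Subtype.ext_iff.symm
  have h2 : ∀ l : Mode, (k.1 = -l.1) = (-k = l) := fun l => propext
    ⟨fun h => Subtype.ext (show -k.1 = l.1 by rw [h, neg_neg]), fun h => by
      rw [← h]; exact (neg_neg k.1).symm⟩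
  simp only [complexify_realTrig, map_sum, map_add, map_smul, fourierFunctional_mFourier, h1, h2,
    smul_eq_mul, mul_ite, mul_one, mul_zero, Finset.sum_add_distrib, Finset.sum_ite_eq, if_pos hk,
    if_pos (hF k hk), hc, Complex.conj_conj]
  ring

lemma fourierFunctional_zero_complexify_realTrig (F : Finset Mode) (c : Mode → ℂ) :
    fourierFunctional 0 (complexify (realTrig F c)) = 0 := by
  simp only [complexify_realTrig, map_sum, map_add, map_smul, fourierFunctional_mFourier]
  refine Finset.sum_eq_zero fun k _ => ?_
  rw [if_neg k.2.symm, if_neg (neg_ne_zero.2 k.2).symm, smul_zero, smul_zero, add_zero]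

/-- Completeness of the Fourier basis; membership in `V` supplies the zero mode. -/
lemma coeFn_ae_eq_of_fourierFunctional_eq {u : C(Torus, ℝ)} {f : V}
    (h0 : fourierFunctional 0 (complexify u) = 0)
    (h : ∀ k : Mode, fourierFunctional k.1 (complexify u) = coef f k) :
    (f : L2Torus) =ᵐ[torusMeasure] fun x => ((u x : ℝ) : ℂ) := by
  have key : ContinuousMap.toLp (E := ℂ) 2 torusMeasure ℂ (complexify u) = (f : L2Torus) := by
    refine (UnitAddTorus.mFourierBasis (d := Fin 2)).repr.injective ?_
    ext n
    rw [HilbertBasis.repr_apply_apply, HilbertBasis.repr_apply_apply, UnitAddTorus.coe_mFourierBasis]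
    by_cases hn : n = 0
    · subst hn
      exact h0.trans ((mem_V_iff f).1 f.2).symm
    · exact h ⟨n, hn⟩
  rw [← key]
  exact ContinuousMap.coeFn_toLp torusMeasure (complexify u)

section Identification

variable {Ω : Type*} [MeasurableSpace Ω] {P : Measure Ω}
  {ν H : ℝ} {α lam : Mode → ℝ} {β : Mode → ℝ → Ω → ℂ} {ψ : ℝ → Ω → V}

/-- The first moments are summable, so `∑ |X_j|` is almost surely finite and its terms tend to `0`.
-/
lemma ae_tendsto_zero_of_subGauss {X : ℕ → Ω → ℝ} {D ρ : ℝ} (hD : 0 < D) (hρ : 0 < ρ)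
    (hρ1 : ρ < 1) {J : ℕ} (hX : ∀ j, J ≤ j → SubGauss (X j) (D * ρ ^ j) P) :
    ∀ᵐ ω ∂P, Tendsto (fun j => X j ω) atTop (𝓝 0) := by
  have h1 : ∫⁻ ω, ∑' j, ‖X (j + J) ω‖ₑ ∂P ≠ ⊤ := by
    rw [lintegral_tsum fun j => (hX _ (Nat.le_add_left J j)).2.aemeasurable.enorm]
    refine ne_top_of_le_ne_top ?_ (ENNReal.tsum_le_tsum fun j => by
      simpa only [pow_one] using (hX _ (Nat.le_add_left J j)).lintegral_pow_le (by positivity) 1)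
    have : Summable fun j => 4 * (Nat.factorial 1 : ℝ) * (D * ρ ^ (j + J)) :=
      (((summable_nat_add_iff J).2 (summable_geometric_of_lt_one hρ.le hρ1)).mul_left D).mul_left _
    exact this.tsum_ofReal_ne_top
  have h2 : AEMeasurable (fun ω => ∑' j, ‖X (j + J) ω‖ₑ) P :=
    AEMeasurable.tsum fun j => (hX _ (Nat.le_add_left J j)).2.aemeasurable.enorm
  filter_upwards [ae_lt_top' h2 h1] with ω hω
  rw [← tendsto_add_atTop_iff_nat J, tendsto_zero_iff_enorm_tendsto_zero]
  exact ENNReal.tendsto_atTop_zero_of_tsum_ne_top hω.ne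

lemma re_interpCoef_sub {z : ℝ → Mode → ℂ} {j : ℕ} {t : ℝ} (ht : |t| + 1 ≤ 2 ^ j) (c : ℂ)
    (k : Mode) : (c * (interpCoef z j t k - z t k)).re =
      ∑ i ∈ Finset.range (gridSize j), gridWeight j i t * (c * (z (gridPt j i) k - z t k)).re := by
  have h : interpCoef z j t k - z t k =
      ∑ i ∈ Finset.range (gridSize j), (gridWeight j i t : ℂ) * (z (gridPt j i) k - z t k) := by
    have h1 : ∑ i ∈ Finset.range (gridSize j), (gridWeight j i t : ℂ) = 1 := by
      exact_mod_cast sum_gridWeight ht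
    simp only [mul_sub, Finset.sum_sub_distrib, ← Finset.sum_mul, h1, one_mul]
    rfl
  rw [h, Finset.mul_sum, Complex.re_sum]
  refine Finset.sum_congr rfl fun i _ => ?_
  rw [mul_left_comm, Complex.re_ofReal_mul]

variable [IsProbabilityMeasure P]

lemma subGauss_re_interpCoef_sub (hA : StandingAssumption ν H α lam β P)
    (hψ : IsErgodicMildSolution ν H α lam β P ψ) {j : ℕ} {t : ℝ} (ht : |t| + 1 ≤ 2 ^ j) (c : ℂ)
    (k : Mode) :
    SubGauss (fun ω => (c * (interpCoef (coefPath ψ ω) j t k - coefPath ψ ω t k)).re)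
      (16 * (‖c‖ * (ν * α k * 2) ^ H * (√(lam k) * α k ^ (-H))) * (1 / 2 ^ H) ^ j) P := by
  have hν := hA.nu_pos
  have hH := hA.hurst.1
  have hα := hA.alpha_pos k
  set s := 16 * (‖c‖ * (ν * α k * 2) ^ H * (√(lam k) * α k ^ (-H))) * (1 / 2 ^ H) ^ j with hs
  have h1 : ∀ i, SubGauss (fun ω => gridWeight j i t *
      (c * (coefPath ψ ω (gridPt j i) k - coefPath ψ ω t k)).re) (gridWeight j i t * s) P := by
    intro i
    by_cases hw : gridWeight j i t = 0
    · simp only [hw, zero_mul]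
      exact SubGauss.zero
    have h2 := subGauss_sum_coef_increment hA hψ {k} (fun _ => c) t (gridPt j i) hH le_rfl
    have h3 := abs_sub_gridPt_le hw
    simp only [Finset.sum_singleton, modeScale] at h2
    rw [Real.sqrt_sq (by positivity)] at h2
    have h4 : SubGauss (fun ω => (c * (coefPath ψ ω (gridPt j i) k - coefPath ψ ω t k)).re) s P := by
      refine SubGauss.mono h2 ?_
      have h5 : (ν * α k * |gridPt j i - t|) ^ H ≤ (ν * α k * 2) ^ H * (1 / 2 ^ H) ^ j := by
        rw [one_div_pow, ← Real.rpow_mul_natCast zero_le_two, mul_comm H, Real.rpow_natCast_mul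
          zero_le_two, mul_one_div, ← Real.div_rpow (by positivity) (by positivity), mul_div_assoc,
          abs_sub_comm]
        gcongr
      rw [hs]
      calc _ ≤ 16 * (‖c‖ * ((ν * α k * 2) ^ H * (1 / 2 ^ H) ^ j) * (√(lam k) * α k ^ (-H))) := by
            gcongr
        _ = _ := by ring
    have h6 := h4.const_mul (gridWeight j i t)
    rwa [abs_of_nonneg (gridWeight_nonneg j i t)] at h6
  have h2 := SubGauss.sum (Finset.range (gridSize j)) fun i _ => h1 i
  rw [← Finset.sum_mul, sum_gridWeight ht, one_mul] at h2
  exact h2.congr (ae_of_all _ fun ω => (re_interpCoef_sub ht c k).symm)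

lemma ae_tendsto_interpCoef (hA : StandingAssumption ν H α lam β P)
    (hψ : IsErgodicMildSolution ν H α lam β P ψ) (t : ℝ) (k : Mode) :
    ∀ᵐ ω ∂P, Tendsto (fun j => interpCoef (coefPath ψ ω) j t k) atTop
      (𝓝 (coefPath ψ ω t k)) := by
  have hν := hA.nu_pos
  have hα := hA.alpha_pos k
  obtain ⟨J, hJ⟩ := exists_nat_ge |t|
  have h (c : ℂ) := ae_tendsto_zero_of_subGauss (P := P)
    (X := fun j ω => (c * (interpCoef (coefPath ψ ω) j t k - coefPath ψ ω t k)).re)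
    (D := 16 * (‖c‖ * (ν * α k * 2) ^ H * (√(lam k) * α k ^ (-H))) + 1) (by positivity)
    (ρ := 1 / 2 ^ H) (by positivity)
    ((div_lt_one (by positivity)).2 (Real.one_lt_rpow one_lt_two hA.hurst.1)) (J := J)
    fun j hj => (subGauss_re_interpCoef_sub hA hψ
      ((add_le_add_left hJ 1).trans (natCast_add_one_le_two_pow hj)) c k).mono (by
        gcongr
        linarith)
  -- The multipliers `1` and `-i` recover the real and the imaginary part.
  filter_upwards [h 1, h (-Complex.I)] with ω h1 h2
  rw [tendsto_iff_norm_sub_tendsto_zero]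
  refine squeeze_zero (fun _ => norm_nonneg _) (fun j => Complex.norm_le_abs_re_add_abs_im _) ?_
  simp only [one_mul, neg_mul, Complex.neg_re, Complex.I_mul_re, neg_neg] at h1 h2
  simpa using h1.abs.add h2.abs

/-- A continuous limit of the interpolations is a version of the solution. -/
lemma ae_coeFn_eq_of_tendsto_interp (hA : StandingAssumption ν H α lam β P)
    (hψ : IsErgodicMildSolution ν H α lam β P ψ) {m : ℕ} (t : ℝ) {Φ : Ω → CmTorus m}
    (h : ∀ᵐ ω ∂P, Tendsto (fun j => interp m (coefPath ψ ω) j t) atTop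
      (𝓝 (CmTorus.jet m (Φ ω)))) :
    ∀ᵐ ω ∂P, (ψ t ω : L2Torus) =ᵐ[torusMeasure] fun x => ((Φ ω x : ℝ) : ℂ) := by
  have h1 : ∀ᵐ ω ∂P, ∀ k, Tendsto (fun j => interpCoef (coefPath ψ ω) j t k) atTop
      (𝓝 (coefPath ψ ω t k)) := ae_all_iff.2 fun k => ae_tendsto_interpCoef hA hψ t k
  have h2 : ∀ᵐ ω ∂P, ∀ j i k, coefPath ψ ω (gridPt j i) (-k) =
      starRingEnd ℂ (coefPath ψ ω (gridPt j i) k) :=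
    ae_all_iff.2 fun j => ae_all_iff.2 fun i => ae_all_iff.2 fun k => coef_neg hA hψ _ k
  filter_upwards [h, h1, h2] with ω hω hlim hconj
  have hc : ∀ j k, interpCoef (coefPath ψ ω) j t (-k) =
      starRingEnd ℂ (interpCoef (coefPath ψ ω) j t k) := by
    intro j k
    simp only [interpCoef, map_sum, map_mul, hconj, Complex.conj_ofReal]
  have hF : ∀ j, ∀ k ∈ modeBox (2 ^ j), -k ∈ modeBox (2 ^ j) := fun j k hk =>
    mem_modeBox.2 fun i => (abs_neg (k.1 i)).trans_le (mem_modeBox.1 hk i)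
  set u : C(Torus, ℝ) := CmTorus.jet m (Φ ω) ⟨(0, 0), by simp⟩ with hu
  have hT : ∀ n, Tendsto (fun j => fourierFunctional n (complexify
      (realTrig (modeBox (2 ^ j)) (interpCoef (coefPath ψ ω) j t)))) atTop
      (𝓝 (fourierFunctional n (complexify u))) := by
    intro n
    have := (tendsto_pi_nhds.1 hω) ⟨(0, 0), by simp⟩
    simp only [interp_zero_eq_realTrig] at this
    exact (((fourierFunctional n).continuous.comp continuous_complexify).tendsto u).comp this
  refine coeFn_ae_eq_of_fourierFunctional_eq (u := u) ?_ fun k => ?_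
  · refine tendsto_nhds_unique (hT 0) ?_
    simp only [fourierFunctional_zero_complexify_realTrig, tendsto_const_nhds]
  -- Once the box contains `k`, the `k`-th Fourier coefficient of the interpolation is exactly
  -- `interpCoef`, whose limit is known.
  · refine tendsto_nhds_unique (hT k.1) ((hlim k).congr' ?_)
    obtain ⟨J, hJ⟩ : ∃ J : ℕ, ∀ i, |k.1 i| ≤ J := by
      refine ⟨∑ i, (k.1 i).natAbs, fun i => ?_⟩
      rw [Int.abs_eq_natAbs]
      exact_mod_cast Finset.single_le_sum (f := fun i => (k.1 i).natAbs) (fun _ _ => Nat.zero_le _)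
        (Finset.mem_univ i)
    filter_upwards [eventually_ge_atTop J] with j hj
    refine (fourierFunctional_complexify_realTrig (hF j) (hc j) (mem_modeBox.2 fun i => ?_)).symm
    exact (hJ i).trans (by exact_mod_cast hj.trans Nat.lt_two_pow_self.le)

end Identification

/-! ### The continuous version -/

section Version

variable {Ω : Type*} {ψ : ℝ → Ω → V}

/-- The event on which the interpolations converge. -/
def convSet (m q : ℕ) (ψ : ℝ → Ω → V) : Set Ω := {ω | Summable (levelBound m q (coefPath ψ ω))}

open Classical in
/-- The limit of the interpolations, set to `0` where they do not converge. -/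
def version (m : ℕ) {q : ℕ} (hq : q ≠ 0) (ψ : ℝ → Ω → V) (ω : Ω) : C(ℝ, CmTorus m) :=
  if h : ω ∈ convSet m q ψ then (exists_limit hq h).choose else ContinuousMap.const ℝ 0

lemma tendsto_interp_version {m q : ℕ} (hq : q ≠ 0) {ω : Ω} (h : ω ∈ convSet m q ψ) (t : ℝ) :
    Tendsto (fun j => interp m (coefPath ψ ω) j t) atTop
      (𝓝 (CmTorus.jet m (version m hq ψ ω t))) := by
  rw [version, dif_pos h]
  exact (exists_limit hq h).choose_spec t

lemma norm_restrict_version_le {m q : ℕ} (hq : q ≠ 0) {ω : Ω} (h : ω ∈ convSet m q ψ) {T₁ T₂ : ℝ}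
    {N : ℕ} (h₁ : |T₁| ≤ N) (h₂ : |T₂| ≤ N) :
    ‖(version m hq ψ ω).restrict (Icc T₁ T₂)‖ ≤
      crudeBound m (coefPath ψ ω) N + ∑' j, levelBound m q (coefPath ψ ω) j := by
  refine (ContinuousMap.norm_le _ (add_nonneg (crudeBound_nonneg _ _ _)
    (tsum_nonneg fun j => levelBound_nonneg _ _ _ _))).2 fun t => ?_
  have ht : |(t : ℝ)| ≤ N := abs_le.2 ⟨(abs_le.1 h₁).1.trans t.2.1, t.2.2.trans (abs_le.1 h₂).2⟩
  exact norm_le_of_tendsto_interp hq h (tendsto_interp_version hq h t) ht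

variable [MeasurableSpace Ω] {P : Measure Ω}
  {ν H : ℝ} {α lam : Mode → ℝ} {β : Mode → ℝ → Ω → ℂ}

lemma measurableSet_convSet (hψ : IsErgodicMildSolution ν H α lam β P ψ) (m q : ℕ) :
    MeasurableSet (convSet m q ψ) := by
  have h : convSet m q ψ = {ω | ∑' j, ENNReal.ofReal (levelBound m q (coefPath ψ ω) j) = ⊤}ᶜ := by
    ext ω
    refine ⟨fun h => Summable.tsum_ofReal_ne_top h, fun h => ?_⟩
    have h1 := ENNReal.summable_toReal h
    simp only [ENNReal.toReal_ofReal (levelBound_nonneg m q (coefPath ψ ω) _)] at h1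
    exact h1
  rw [h]
  exact (measurableSet_eq_fun (Measurable.tsum fun j =>
    (measurable_levelBound hψ m q j).ennreal_ofReal) measurable_const).compl

/-- The version is defined by choice, but its values are pointwise limits of measurable
trigonometric polynomials, cut off by the measurable convergence event. -/
lemma measurable_version (hψ : IsErgodicMildSolution ν H α lam β P ψ) (m : ℕ) {q : ℕ}
    (hq : q ≠ 0) (t : ℝ) (x : Torus) : Measurable fun ω => version m hq ψ ω t x := by
  refine measurable_of_tendsto_metrizable (f := fun j => (convSet m q ψ).indicator fun ω =>
    realTrig (modeBox (2 ^ j)) (interpCoef (coefPath ψ ω) j t) x) (fun j => ?_)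
    (tendsto_pi_nhds.2 fun ω => ?_)
  · refine Measurable.indicator ?_ (measurableSet_convSet hψ m q)
    have h : ∀ s k, Measurable fun ω => coefPath ψ ω s k :=
      fun s k => hψ.mildSolution.measurable_coef s k
    simp only [realTrig_apply, interpCoef]
    fun_prop
  · by_cases hω : ω ∈ convSet m q ψ
    · have h := ((continuous_eval_const (F := C(Torus, ℝ)) x).tendsto _).comp
        ((tendsto_pi_nhds.1 (tendsto_interp_version hq hω t)) ⟨(0, 0), by simp⟩)
      simp only [Function.comp_def, interp_zero_eq_realTrig] at h
      simp only [indicator_of_mem hω]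
      exact h
    · simp only [indicator_of_notMem hω, version, dif_neg hω]
      exact tendsto_const_nhds

lemma exists_tsum_eLpNorm_levelBound_ne_top [IsProbabilityMeasure P]
    (hA : StandingAssumption ν H α lam β P) {m : ℕ} {γ : ℝ} (hγ : 0 < γ)
    (hsum₁ : Summable fun k : Mode => lam k * α k ^ (2 * γ - 2 * H) * waveNorm k ^ (2 * m))
    (hsum₂ : Summable fun k : Mode =>
      lam k * α k ^ (-(2 * H)) * waveNorm k ^ (2 * (m : ℝ) + 2 * γ))
    (hψ : IsErgodicMildSolution ν H α lam β P ψ) :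
    ∃ q ≠ 0, ∑' j, eLpNorm (fun ω => levelBound m q (coefPath ψ ω) j) 2 P ≠ ⊤ := by
  have hg : 0 < min γ H := lt_min hγ hA.hurst.1
  obtain ⟨D, hD, hsg⟩ := exists_subGauss_pair hA hg (min_le_left _ _) (min_le_right _ _)
    hsum₁ hsum₂ hψ
  have hb : 1 < (2 : ℝ) ^ min γ H := Real.one_lt_rpow one_lt_two hg
  -- The moment is taken to be `q = n + 2`: large enough to beat the counting factors, and at least
  -- `2` to control the `L²` norm.
  obtain ⟨n, hn⟩ := pow_unbounded_of_one_lt 128 hb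
  have hbq : 128 ≤ ((2 : ℝ) ^ min γ H) ^ (n + 2) :=
    hn.le.trans (pow_le_pow_right₀ hb.le (Nat.le_add_right n 2))
  exact ⟨n + 2, by omega, tsum_eLpNorm_levelBound_ne_top hψ (by omega) (by positivity)
    (lintegral_levelBound_pow_le hψ hD (by positivity) hsg (by omega) hbq)⟩

end Version

end FractionalFlow

end

open FractionalFlow in
theorem mainTheorem5 {Ω : Type*} [MeasurableSpace Ω] (P : Measure Ω) [IsProbabilityMeasure P]
    (ν H : ℝ) (α lam : Mode → ℝ) (β : Mode → ℝ → Ω → ℂ)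
    (hA : StandingAssumption ν H α lam β P)
    (m : ℕ) (γ : ℝ) (hγ : γ ∈ Ioo (0 : ℝ) 1)
    (hsum₁ : Summable fun k : Mode => lam k * α k ^ (2 * γ - 2 * H) * waveNorm k ^ (2 * m))
    (hsum₂ : Summable fun k : Mode =>
      lam k * α k ^ (-(2 * H)) * waveNorm k ^ (2 * (m : ℝ) + 2 * γ))
    (ψ : ℝ → Ω → V) (hψ : IsErgodicMildSolution ν H α lam β P ψ) :
    ∃ Ψ : Ω → C(ℝ, CmTorus m),
      (∀ (t : ℝ) (x : Torus), Measurable fun ω => Ψ ω t x) ∧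
      (∀ t : ℝ, ∀ᵐ ω ∂P, (ψ t ω : L2Torus) =ᵐ[torusMeasure] fun x => ((Ψ ω t x : ℝ) : ℂ)) ∧
      ∀ T₁ T₂ : ℝ, T₁ < T₂ → ∃ K : Ω → ℝ, Measurable K ∧ (∀ ω, 0 < K ω) ∧ MemLp K 2 P ∧
        ∀ᵐ ω ∂P, ‖(Ψ ω).restrict (Icc T₁ T₂)‖ ≤ K ω := by
  obtain ⟨q, hq, hS⟩ := exists_tsum_eLpNorm_levelBound_ne_top hA hγ.1 hsum₁ hsum₂ hψ
  have hG : ∀ᵐ ω ∂P, ω ∈ convSet m q ψ := by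
    filter_upwards [summable_norm_of_tsum_eLpNorm_ne_top one_le_two
      (fun j => (measurable_levelBound hψ m q j).aestronglyMeasurable) hS] with ω hω
    exact hω.of_norm
  refine ⟨version m hq ψ, measurable_version hψ m hq, fun t => ?_, fun T₁ T₂ _ => ?_⟩
  · exact ae_coeFn_eq_of_tendsto_interp hA hψ t
      (hG.mono fun ω hω => tendsto_interp_version hq hω t)
  · obtain ⟨N, hN⟩ := exists_nat_ge (max |T₁| |T₂|)
    -- Adding `1` makes the bound positive for every `ω`, including those where the real series
    -- diverges and its sum is `0` by convention.
    refine ⟨fun ω => 1 + (crudeBound m (coefPath ψ ω) N + ∑' j, levelBound m q (coefPath ψ ω) j),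
      ?_, fun ω => ?_, ?_, ?_⟩
    · exact measurable_const.add ((measurable_crudeBound hψ m N).add
        (Measurable.tsum (measurable_levelBound hψ m q)))
    · have h1 := crudeBound_nonneg m (coefPath ψ ω) N
      have h2 : 0 ≤ ∑' j, levelBound m q (coefPath ψ ω) j :=
        tsum_nonneg fun j => levelBound_nonneg _ _ _ _
      positivity
    · have h1 := memLp_crudeBound hA hψ m N
      have h2 := memLp_tsum_of_tsum_eLpNorm_ne_top (measurable_levelBound hψ m q) hS
      exact (memLp_const (1 : ℝ)).add (h1.add h2)
    · filter_upwards [hG] with ω hω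
      have := norm_restrict_version_le hq hω ((le_max_left _ _).trans hN)
        ((le_max_right _ _).trans hN)
      linarith
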